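/- Let $n\ge 2$ and let $(M,\boldsymbol p)$ be an $n$-dimensional projective manifold: $M$ is a smooth manifold without boundary and $\boldsymbol p$ is a projective equivalence class of smooth torsion-free affine connections on $TM$, where $\nabla$ and $\hat\nabla$ are projectively related if $\hat\nabla_aY^b=\nabla_aY^b+\Upsilon_aY^b+\Upsilon_cY^c\delta_a^b$ for a smooth one-form $\Upsilon$. For $w\in\mathbb R$ let $\mathcal E(w)$ be the oriented line bundle $\big((\Lambda^nTM)^2\big)^{w/(2n+2)}$, on which each $\nabla\in\boldsymbol p$ acts, and let $P_{ab}=\frac{1}{n^2-1}(n\,\mathrm{Ric}_{ab}+\mathrm{Ric}_{ba})$ be the projective Schouten tensor of $\nabla$, where $\mathrm{Ric}_{bd}=R_{ab}{}^a{}_d$. The choice of $\nabla\in\boldsymbol p$ splits the standard tractor bundle as $\mathcal T\cong TM\otimes\mathcal E(-1)\oplus\mathcal E(-1)$. For a smooth section $\tau$ of $\mathcal E(2)$ let $L(\tau)$ be the symmetric bilinear form on $\mathcal T$ given in this splitting by $$L(\tau)\big((\nu,\rho),(\nu',\rho')\big)=\big(\tfrac12\nabla_a\nabla_b\tau+P_{ab}\tau\big)\nu^a\nu'^b+\tfrac12(\nabla_a\tau)(\nu^a\rho'+\nu'^a\rho)+\tau\rho\rho'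 .$$ Write $M_0=\{\tau=0\}$, $M_+=\{\tau>0\}$, $M_-=\{\tau<0\}$. Consider the condition $(\ast)$ for every $x\in M_0$ there is $\nabla\in\boldsymbol p$ with $\operatorname{rank}(\nabla_a\nabla_b\tau)_x<\operatorname{rank}L(\tau)_x$. If $L(\tau)$ is nondegenerate at every point of $M$, then $(\ast)$ holds. If $(\ast)$ holds, then: (i) $M$ is the disjoint union of the open sets $M_+$, $M_-$ and the closed set $M_0$, and $M_0$ is the boundary of $M_+$ and of $M_-$. Either $M_0$ is empty, or $L(\tau)$ is not definite at any point of $M_0$ and $M_0$ is a smoothly embedded (separating) hypersurface of $M$. (ii) Suppose that $M_0\neq\varnothing$ and that $L(\tau)$ has signature $(p,q,0)$ at each point of $M_0$ ($p$ plus signs, $q$ minus signs, nullity $0$). Then $p,q\ge1$, and $M_0$ inherits a conformal structure $\boldsymbol c$ of signature $(p-1,q-1)$: for each metric $g\in\boldsymbol c$ and each $x\in M_0$, up to a positive factor $g_x$ is the form which $L(\tau)_x$ induces on $T_xM_0$ (weights suppressed), i.e. there is $k>0$ such that $L(\tau)_x\big((u,a),(v,b)\big)=k\,g_x(u,v)$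 for all $u,v\in T_xM_0$ and all $a,b$, in the splitting of each $\nabla\in\boldsymbol p$. (iii) On $M\setminus M_0$ there is a connection $\nabla^\tau\in\boldsymbol p|_{M\setminus M_0}$ with $\nabla^\tau\tau=0$. If $M$ is closed (compact), then, for each such $\nabla^\tau$ and both choices of sign, $(M\setminus M_\mp,\boldsymbol p)$ is a projective compactification of order $2$ of $(M_\pm,\nabla^\tau)$ with boundary $M_0$. That is, $M\setminus M_\mp$ is a compact smooth manifold with boundary $M_0$ and interior $M_\pm$, embedded in $M$ as a smooth domain; $\nabla^\tau\in\boldsymbol p|_{M_\pm}$; and each $x\in M_0$ has an open neighbourhood $U$ with a smooth function $r$ such that $r>0$ on $U\cap M_\pm$, $r=0$ and $dr\ne0$ on $U\cap M_0$, and $$\nabla^\tau_\mu\xi+\frac{dr(\mu)}{2r}\,\xi+\frac{dr(\xi)}{2r}\,\mu$$ on $U\cap M_\pm$ extends smoothly up to the boundary for all vector fields $\mu,\xi$ which are smooth up to the boundary. -/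

import Mathlib

open Set Bundle
open scoped Manifold ContDiff Topology

noncomputable section

namespace ProjDiff

/-! ## Affine connections and projective structures -/

/-- The model space of an `n`-manifold; its canonical basis at `x` is the coordinate frame of the
preferred chart at `x`. -/
abbrev Model (n : ℕ) : Type := EuclideanSpace ℝ (Fin n)

section Connections

variable (n : ℕ) (M : Type*) [TopologicalSpace M] [ChartedSpace (Model n) M]
  [IsManifold (𝓡 n) ∞ M]

/-- Vector fields (not necessarily smooth). -/
abbrev VField : Type _ := (x : M) → TangentSpace (𝓡 n) x

/-- The type of the operator underlying a linear connection on `TM` (or on the tangent bundle of an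
open subset): `D Y x u` is `(∇_u Y)(x)`. -/
abbrev ConnOp : Type _ :=
  VField n M → (x : M) → TangentSpace (𝓡 n) x →L[ℝ] TangentSpace (𝓡 n) x

variable {n M}

/-- A vector field which is smooth on the set `s` (for a smooth domain `s` with boundary this is
smoothness up to the boundary). -/
def SmoothFieldOn (Y : VField n M) (s : Set M) : Prop :=
  ContMDiffOn (𝓡 n) ((𝓡 n).prod 𝓘(ℝ, Model n)) ∞
    (fun x ↦ (TotalSpace.mk' (Model n) x (Y x) : TangentBundle (𝓡 n) M)) s

/-- A vector field which is differentiable at `x`. -/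
def DiffFieldAt (Y : VField n M) (x : M) : Prop :=
  MDifferentiableAt (𝓡 n) ((𝓡 n).prod 𝓘(ℝ, Model n))
    (fun x ↦ (TotalSpace.mk' (Model n) x (Y x) : TangentBundle (𝓡 n) M)) x

/-- A one-form which is smooth on `s`. -/
def SmoothOneFormOn (U : (x : M) → TangentSpace (𝓡 n) x →L[ℝ] ℝ) (s : Set M) : Prop :=
  ContMDiffOn (𝓡 n) ((𝓡 n).prod 𝓘(ℝ, Model n →L[ℝ] ℝ)) ∞
    (fun x ↦ TotalSpace.mk' (Model n →L[ℝ] ℝ)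
      (E := fun x : M ↦ TangentSpace (𝓡 n) x →L[ℝ] Bundle.Trivial M ℝ x) x (U x)) s

/-- `D` is a smooth torsion-free affine connection on the open set `s`. -/
structure IsAffineConnectionOn (D : ConnOp n M) (s : Set M) : Prop where
  isCovariantDerivativeOn : IsCovariantDerivativeOn (Model n) D s
  smooth : ContMDiffCovariantDerivativeOn (Model n) ∞ D s
  torsionFree : ∀ X Y : VField n M, ∀ x ∈ s, DiffFieldAt X x → DiffFieldAt Y x →
    D Y x (X x) - D X x (Y x) = VectorField.mlieBracket (𝓡 n) X Y x

/-- `D` and `D'` are projectively related on `s`: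
`∇'_a Y^b = ∇_a Y^b + Υ_a Y^b + Υ_c Y^c δ_a^b` for a smooth one-form `Υ` on `s`. -/
def ProjRelatedOn (D D' : ConnOp n M) (s : Set M) : Prop :=
  ∃ U : (x : M) → TangentSpace (𝓡 n) x →L[ℝ] ℝ, SmoothOneFormOn U s ∧
    ∀ Y : VField n M, ∀ x ∈ s, DiffFieldAt Y x → ∀ u : TangentSpace (𝓡 n) x,
      D' Y x u = D Y x u + U x u • Y x + U x (Y x) • u

variable (n M) in
/-- A projective structure: an equivalence class of projectively related smooth torsion-free affine
connections on `M`. -/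
structure ProjStructure where
  conns : Set (ConnOp n M)
  nonempty : conns.Nonempty
  isAffine : ∀ D ∈ conns, IsAffineConnectionOn D univ
  mem_iff : ∀ D ∈ conns, ∀ D',
    D' ∈ conns ↔ IsAffineConnectionOn D' univ ∧ ProjRelatedOn D D' univ

/-- The connection `D` on the open set `s` belongs to the restriction of the projective structure
`P` to `s`. -/
def ProjStructure.MemOn (P : ProjStructure n M) (D : ConnOp n M) (s : Set M) : Prop :=
  IsAffineConnectionOn D s ∧ ∀ D₀ ∈ P.conns, ProjRelatedOn D₀ D s

/-! ## Curvature -/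

/-- The coordinate basis of the tangent space at `x`. -/
def coordBasis (x : M) : Module.Basis (Fin n) ℝ (TangentSpace (𝓡 n) x) :=
  (EuclideanSpace.basisFun (Fin n) ℝ).toBasis

/-- The extension of a tangent vector at `x` to a local vector field with constant coefficients in
the preferred chart at `x`. -/
def extendField {x : M} (v : TangentSpace (𝓡 n) x) : VField n M := FiberBundle.extend (Model n) v

/-- `R(u,v)z = ∇_u ∇_v z - ∇_v ∇_u z - ∇_{[u,v]} z`, that is `u^a v^b R_{ab}^c_d z^d`. -/
def curvature (D : ConnOp n M) (x : M) (u v z : TangentSpace (𝓡 n) x) : TangentSpace (𝓡 n) x :=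
  D (fun y ↦ D (extendField z) y (extendField v y)) x u
    - D (fun y ↦ D (extendField z) y (extendField u y)) x v
    - D (extendField z) x (VectorField.mlieBracket (𝓡 n) (extendField u) (extendField v) x)

/-- The Ricci tensor `Ric_{bd} = R_{ab}^a_d`: the bilinear form `(v, z) ↦ tr (u ↦ R(u, v) z)`. -/
def ricci (D : ConnOp n M) (x : M) : LinearMap.BilinForm ℝ (TangentSpace (𝓡 n) x) :=
  Matrix.toBilin (coordBasis x) fun i j ↦ ∑ k, (coordBasis x).repr
    (curvature D x (coordBasis x k) (coordBasis x i) (coordBasis x j)) k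

/-- The projective Schouten tensor `P_{ab} = (n Ric_{ab} + Ric_{ba}) / (n² - 1)` of a torsion-free
connection. It is determined by
`R_{ab}^c_d = W_{ab}^c_d + δ_a^c P_{bd} - δ_b^c P_{ad} + (P_{ba} - P_{ab}) δ_d^c` with `W`
trace-free, and it is `Ric / (n - 1)` if `Ric` is symmetric, i.e. if the connection is special. -/
def schouten (D : ConnOp n M) (x : M) : LinearMap.BilinForm ℝ (TangentSpace (𝓡 n) x) :=
  (1 / ((n : ℝ) ^ 2 - 1)) • ((n : ℝ) • ricci D x + (ricci D x).flip)

end Connections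

/-! ## Projective densities -/

section Densities

variable (n : ℕ) (M : Type*) [TopologicalSpace M] [ChartedSpace (Model n) M]
  [IsManifold (𝓡 n) ∞ M]

lemma det_tangent_coordChange_ne_zero (i j : atlas (Model n) M) (x : M)
    (hx : x ∈ i.1.source ∩ j.1.source) :
    ((tangentBundleCore (𝓡 n) M).coordChange i j x).det ≠ 0 := by
  have h : ((tangentBundleCore (𝓡 n) M).coordChange j i x).comp
      ((tangentBundleCore (𝓡 n) M).coordChange i j x) = ContinuousLinearMap.id ℝ _ := by
    ext1 v
    rw [ContinuousLinearMap.comp_apply,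
      (tangentBundleCore (𝓡 n) M).coordChange_comp i j i x ⟨hx, hx.1⟩,
      (tangentBundleCore (𝓡 n) M).coordChange_self i x hx.1]
    rfl
  intro h0
  have h1 := congrArg ContinuousLinearMap.det h
  rw [ContinuousLinearMap.det, ContinuousLinearMap.toLinearMap_comp, LinearMap.det_comp] at h1
  rw [ContinuousLinearMap.det] at h0
  rw [h0, mul_zero] at h1
  simp [ContinuousLinearMap.det] at h1

/-- The bundle `E(w)` of projective densities of weight `w`, i.e. the power `w / (2n + 2)` of the
naturally oriented line bundle `(Λⁿ TM)²`: the coordinates of a tangent vector transform under a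
change of charts with the Jacobian matrix `J`, and the coefficient of a density of weight `w`
transforms with `(det J)² ^ (w / (2n + 2)) = |det J| ^ (w / (n + 1))`. -/
def densityCore (w : ℝ) : VectorBundleCore ℝ M ℝ (atlas (Model n) M) where
  baseSet i := i.1.source
  isOpen_baseSet i := i.1.open_source
  indexAt := achart (Model n)
  mem_baseSet_at := mem_chart_source (Model n)
  coordChange i j x :=
    (|((tangentBundleCore (𝓡 n) M).coordChange i j x).det| ^ (w / ((n : ℝ) + 1))) •
      ContinuousLinearMap.id ℝ ℝ
  coordChange_self i x hx v := by
    have h : (tangentBundleCore (𝓡 n) M).coordChange i i x = ContinuousLinearMap.id ℝ _ := by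
      ext1 v
      exact (tangentBundleCore (𝓡 n) M).coordChange_self i x hx v
    rw [h]
    simp [ContinuousLinearMap.det]
  continuousOn_coordChange i j := by
    refine ContinuousOn.smul (ContinuousOn.rpow_const ?_ ?_) continuousOn_const
    · exact (ContinuousLinearMap.continuous_det.comp_continuousOn
        ((tangentBundleCore (𝓡 n) M).continuousOn_coordChange i j)).abs
    · intro x hx
      exact Or.inl (abs_ne_zero.2 (det_tangent_coordChange_ne_zero n M i j x hx))
  coordChange_comp i j k x hx v := by
    have h : (tangentBundleCore (𝓡 n) M).coordChange i k x =
        ((tangentBundleCore (𝓡 n) M).coordChange j k x).comp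
          ((tangentBundleCore (𝓡 n) M).coordChange i j x) := by
      ext1 v
      exact ((tangentBundleCore (𝓡 n) M).coordChange_comp i j k x hx v).symm
    have h2 : ((tangentBundleCore (𝓡 n) M).coordChange i k x).det =
        ((tangentBundleCore (𝓡 n) M).coordChange j k x).det *
          ((tangentBundleCore (𝓡 n) M).coordChange i j x).det := by
      rw [h]
      exact LinearMap.det_comp _ _
    rw [h2, abs_mul, Real.mul_rpow (abs_nonneg _) (abs_nonneg _)]
    simp [mul_assoc]

/-- The fibres of the line bundle `E(w)`; each fibre is an oriented copy of `ℝ`, through the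
preferred chart at the base point. -/
abbrev DensityBundle (w : ℝ) : M → Type := (densityCore n M w).Fiber

/-- Smooth projective densities of weight `w`, i.e. smooth sections of `E(w)`. -/
abbrev Density (w : ℝ) : Type _ :=
  ContMDiffSection (𝓡 n) ℝ ∞ (DensityBundle n M w)

variable {n M}

/-- The coefficient of a density at `x` in the preferred chart at `x`. Its sign does not depend on
the chart, as `E(w)` is oriented. -/
def dval {w : ℝ} (σ : (x : M) → DensityBundle n M w x) (x : M) : ℝ := σ x

/-- The connection induced by `D` on `E(w)`: in the coordinate frame at `x`,
`∇_u σ = ∂_u σ + (w / (n + 1)) Γ^c_{ac} u^a σ`, where `Γ^c_{ac} u^a` is the trace of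
`v ↦ ∇_u v` on coordinate vector fields. -/
def densityDeriv {w : ℝ} (D : ConnOp n M) (σ : (x : M) → DensityBundle n M w x) (x : M) :
    TangentSpace (𝓡 n) x →L[ℝ] ℝ :=
  mvfderiv (𝓡 n) (fun y ↦ (trivializationAt ℝ (DensityBundle n M w) x
      (TotalSpace.mk' ℝ y (σ y))).2) x
    + ((w / ((n : ℝ) + 1)) * dval σ x) •
      ∑ i, (EuclideanSpace.proj i : Model n →L[ℝ] ℝ).comp (D (extendField (coordBasis x i)) x)

/-- The bilinear form `∇∇σ`, with `(∇∇σ)(u, v) = u^a v^b ∇_a ∇_b σ`, i.e.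
`(∇∇σ)(u, v) = ∇_u (∇_V σ) - ∇_{∇_u V} σ` for `V` extending `v`. -/
def hessian {w : ℝ} (D : ConnOp n M) (σ : (x : M) → DensityBundle n M w x) (x : M) :
    LinearMap.BilinForm ℝ (TangentSpace (𝓡 n) x) :=
  Matrix.toBilin (coordBasis x) fun i j ↦
    densityDeriv (w := w) D
        (fun y ↦ (densityDeriv D σ y (extendField (coordBasis x j) y) : ℝ)) x (coordBasis x i)
      - densityDeriv D σ x (D (extendField (coordBasis x j)) x (coordBasis x i))

/-! ## The bilinear form `L(τ)` on the standard tractor bundle -/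

/-- The fibre of the standard tractor bundle at `x` in the splitting
`𝒯 ≅ TM ⊗ E(-1) ⊕ E(-1)` given by a connection in the projective class; `E(-1)` is
trivialized at `x` by the preferred chart. -/
abbrev TractorFiber (x : M) : Type := TangentSpace (𝓡 n) x × ℝ

/-- The symmetric bilinear form `L(τ)` on the tractor fibre at `x`, where `L` is the splitting
operator on densities of weight 2. In the splitting given by `D` it has the slots `τ`,
`½ ∇_a τ`, `½ ∇_a ∇_b τ + P_{ab} τ`. -/
def tractorForm (D : ConnOp n M) (τ : Density n M 2) (x : M) :
    LinearMap.BilinForm ℝ (TractorFiber (n := n) x) :=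
  LinearMap.mk₂ ℝ
    (fun V W ↦
      ((1 / 2 : ℝ) • hessian D τ x + dval τ x • schouten D x) V.1 W.1
        + (1 / 2) * densityDeriv D τ x V.1 * W.2 + (1 / 2) * densityDeriv D τ x W.1 * V.2
        + dval τ x * V.2 * W.2)
    (by intro V V' W; simp only [Prod.fst_add, Prod.snd_add, map_add, LinearMap.add_apply]; ring)
    (by
      intro c V W
      simp only [Prod.smul_fst, Prod.smul_snd, map_smul, LinearMap.smul_apply, smul_eq_mul]
      ring)
    (by intro V W W'; simp only [Prod.fst_add, Prod.snd_add, map_add]; ring)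
    (by intro c V W; simp only [Prod.smul_fst, Prod.smul_snd, map_smul, smul_eq_mul]; ring)

end Densities

/-! ## Rank, signature, definiteness -/

section Forms

variable {V : Type*} [AddCommGroup V] [Module ℝ V]

/-- The rank of a bilinear form. -/
def formRank (B : LinearMap.BilinForm ℝ V) : ℕ := Module.finrank ℝ (LinearMap.range B)

/-- `B` has signature `(p, q, r)`: `p` plus signs, `q` minus signs and nullity `r`. -/
def HasSignature (B : LinearMap.BilinForm ℝ V) (p q r : ℕ) : Prop :=
  sigPos B.toQuadraticMap = p ∧ sigNeg B.toQuadraticMap = q ∧ p + q + r = Module.finrank ℝ V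

/-- `B` is positive or negative definite. -/
def IsDefiniteForm (B : LinearMap.BilinForm ℝ V) : Prop :=
  (∀ v, v ≠ 0 → 0 < B v v) ∨ (∀ v, v ≠ 0 → B v v < 0)

end Forms

/-! ## Zero locus and strata -/

section Strata

variable {n : ℕ} {M : Type*} [TopologicalSpace M] [ChartedSpace (Model n) M]
  [IsManifold (𝓡 n) ∞ M]

/-- The zero locus `M_0`. -/
def zeroLocus (τ : Density n M 2) : Set M := {x | dval τ x = 0}

/-- The set `M_+`. -/
def posLocus (τ : Density n M 2) : Set M := {x | 0 < dval τ x}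

/-- The set `M_-`. -/
def negLocus (τ : Density n M 2) : Set M := {x | dval τ x < 0}

/-- `rank (∇∇τ) < rank L(τ)` on the zero locus of `τ`. Along the zero locus `∇∇τ` depends on the
connection in the projective class; some connection in the class, for each point, is enough. -/
def RankLTRank (P : ProjStructure n M) (τ : Density n M 2) : Prop :=
  ∀ x ∈ zeroLocus τ, ∃ D ∈ P.conns, formRank (hessian D τ x) < formRank (tractorForm D τ x)

/-- `L(τ)` is nondegenerate at each point (this does not depend on the splitting). -/
def NondegenerateL (P : ProjStructure n M) (τ : Density n M 2) : Prop :=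
  ∀ x, ∃ D ∈ P.conns, (tractorForm D τ x).Nondegenerate

/-- `D` is the connection `∇^τ` on the open set `τ ≠ 0`: it belongs to the projective structure
there and preserves `τ`. -/
def IsScaleConnection (P : ProjStructure n M) (τ : Density n M 2) (D : ConnOp n M) : Prop :=
  P.MemOn D (zeroLocus τ)ᶜ ∧ ∀ x ∈ (zeroLocus τ)ᶜ, densityDeriv D τ x = 0

/-- The closed set `S` separates `M` into the open sets `A` and `B`, and is their common
boundary. -/
structure Separates (S A B : Set M) : Prop where
  isClosed : IsClosed S
  isOpen_left : IsOpen A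
  isOpen_right : IsOpen B
  cover : A ∪ S ∪ B = univ
  disjoint_left : Disjoint A S
  disjoint_right : Disjoint S B
  disjoint : Disjoint A B
  frontier_left : frontier A = S
  frontier_right : frontier B = S

/-! ## Projective compactification -/

/-- `N` is a smooth domain in `M` (a submanifold of codimension zero with boundary) with interior
`Ω` and boundary `S`: `N` is the disjoint union of the open set `Ω` and of `S`, and at each point of
`S` there is a chart of the smooth structure, with a coordinate `x^i`, in which `N` is `x^i ≥ 0` and
`S` is `x^i = 0`. -/
structure IsSmoothDomain (N Ω S : Set M) : Prop where
  isOpen : IsOpen Ω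
  union : Ω ∪ S = N
  disjoint : Disjoint Ω S
  charts : ∀ x ∈ S, ∃ φ ∈ IsManifold.maximalAtlas (𝓡 n) ∞ M, ∃ i : Fin n, x ∈ φ.source ∧
    ∀ y ∈ φ.source, (y ∈ N ↔ 0 ≤ φ y i) ∧ (y ∈ S ↔ φ y i = 0)

/-- `r` is a local defining function on `U ∩ N` for the boundary `S` of the smooth domain `N` with
interior `Ω`: it is smooth on the open set `U`, positive in the interior, zero on the boundary, and
`dr` has no zero on the boundary. -/
structure IsLocalDefiningFunction (r : M → ℝ) (U Ω S : Set M) : Prop where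
  smooth : ContMDiffOn (𝓡 n) 𝓘(ℝ, ℝ) ∞ r U
  pos : ∀ y ∈ U ∩ Ω, 0 < r y
  zero : ∀ y ∈ U ∩ S, r y = 0
  deriv_ne : ∀ y ∈ U ∩ S, mvfderiv (𝓡 n) r y ≠ 0

/-- The connection `D` on the interior `Ω` of the smooth domain `N` with boundary `S` is
projectively compact of order `α`: near each boundary point there is a local defining function `r`
such that `∇_μ ξ + dr(μ)/(α r) ξ + dr(ξ)/(α r) μ` is smooth up to the boundary for all vector fields
`μ`, `ξ` which are smooth up to the boundary. -/
def IsProjCompactOfOrder (α : ℝ) (N Ω S : Set M) (D : ConnOp n M) : Prop :=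
  ∀ x ∈ S, ∃ U : Set M, IsOpen U ∧ x ∈ U ∧ ∃ r : M → ℝ,
    IsLocalDefiningFunction (n := n) r U Ω S ∧
    ∀ μ ξ : VField n M, SmoothFieldOn μ (U ∩ N) → SmoothFieldOn ξ (U ∩ N) →
      ∃ η : VField n M, SmoothFieldOn η (U ∩ N) ∧ ∀ y ∈ U ∩ Ω,
        η y = D ξ y (μ y) + (mvfderiv (𝓡 n) r y (μ y) / (α * r y)) • ξ y
          + (mvfderiv (𝓡 n) r y (ξ y) / (α * r y)) • μ y

/-- `(N, P)` is a projective compactification of order `α` of `(Ω, D)`, with boundary `S`: `N` is a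
compact manifold with interior `Ω` and boundary `S`, the connection `D` on `Ω` is projectively
compact of order `α`, and `P` restricts to the projective class of `D` on `Ω`. -/
structure IsProjCompactification (P : ProjStructure n M) (α : ℝ) (N Ω S : Set M)
    (D : ConnOp n M) : Prop where
  isCompact : IsCompact N
  isSmoothDomain : IsSmoothDomain (n := n) N Ω S
  mem : P.MemOn D Ω
  isProjCompact : IsProjCompactOfOrder α N Ω S D

end Strata

/-! ## Conformal structures -/

section Conformal

variable (m : ℕ) (S : Type*) [TopologicalSpace S] [ChartedSpace (Model m) S]
  [IsManifold (𝓡 m) ∞ S]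

/-- A smooth pseudo-Riemannian metric on `S`. -/
structure PseudoMetric where
  form (x : S) : TangentSpace (𝓡 m) x →L[ℝ] TangentSpace (𝓡 m) x →L[ℝ] ℝ
  symm (x : S) (u v : TangentSpace (𝓡 m) x) : form x u v = form x v u
  nondegenerate (x : S) (u : TangentSpace (𝓡 m) x) : (∀ v, form x u v = 0) → u = 0
  smooth : ContMDiff (𝓡 m) ((𝓡 m).prod 𝓘(ℝ, Model m →L[ℝ] Model m →L[ℝ] ℝ)) ∞
    (fun x ↦ TotalSpace.mk' (Model m →L[ℝ] Model m →L[ℝ] ℝ)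
      (E := fun x : S ↦ TangentSpace (𝓡 m) x →L[ℝ] TangentSpace (𝓡 m) x →L[ℝ] ℝ) x (form x))

/-- A conformal structure: a class of pseudo-Riemannian metrics, any two of which differ by a
smooth positive factor, and which is closed under multiplication with such factors. -/
structure ConformalStructure where
  metrics : Set (PseudoMetric m S)
  nonempty : metrics.Nonempty
  mem_iff : ∀ g ∈ metrics, ∀ g', g' ∈ metrics ↔
    ∃ f : S → ℝ, ContMDiff (𝓡 m) 𝓘(ℝ, ℝ) ∞ f ∧ (∀ x, 0 < f x) ∧
      ∀ x u v, g'.form x u v = f x * g.form x u v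

variable {m S}

/-- The metric at `x` as a bilinear form. -/
def PseudoMetric.bilin (g : PseudoMetric m S) (x : S) :
    LinearMap.BilinForm ℝ (TangentSpace (𝓡 m) x) :=
  LinearMap.mk₂ ℝ (fun u v ↦ g.form x u v) (by simp) (by simp) (by simp) (by simp)

/-- The conformal structure has signature `(p, q)`. -/
def ConformalStructure.HasSig (c : ConformalStructure m S) (p q : ℕ) : Prop :=
  ∀ g ∈ c.metrics, ∀ x, HasSignature (g.bilin x) p q 0

end Conformal

section Induced

variable {n : ℕ} {M : Type*} [TopologicalSpace M] [ChartedSpace (Model n) M]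
  [IsManifold (𝓡 n) ∞ M]

/-- The conformal structure `c` on the hypersurface `S` is the one induced by `L(τ)`: at `x ∈ S`,
the tractors of the form `(u, a)` with `u ∈ T_x S` (weights suppressed) form the orthogonal space
of the null line `X = (0, a)`, and the form induced by `L(τ)` on the quotient `T_x S` is a positive
multiple of each metric in `c`, in each splitting. -/
def IsInducedConformal (P : ProjStructure n M) (τ : Density n M 2) (S : Set M)
    [ChartedSpace (Model (n - 1)) S] [IsManifold (𝓡 (n - 1)) ∞ S]
    (c : ConformalStructure (n - 1) S) : Prop :=
  ∀ g ∈ c.metrics, ∀ x : S, ∃ k : ℝ, 0 < k ∧ ∀ D ∈ P.conns,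
    ∀ u v : TangentSpace (𝓡 (n - 1)) x, ∀ a b : ℝ,
      tractorForm D τ (x : M)
        (mfderiv (𝓡 (n - 1)) (𝓡 n) (Subtype.val : S → M) x u, a)
        (mfderiv (𝓡 (n - 1)) (𝓡 n) (Subtype.val : S → M) x v, b) = k * g.form x u v

end Induced

end ProjDiff

end

open ProjDiff
open scoped Manifold ContDiff

/-! At a zero of `τ` the form `L(τ)` has only the slots `½∇∇τ` and `½∇τ`. If `∇τ` vanished there as
well, `L(τ)` would be the pullback of `½∇∇τ` along the projection of the tractor fibre to `TM`, and
its rank could not exceed that of `∇∇τ`. So the rank condition forces `dτ ≠ 0` along the zero locus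
(`mvfderiv_dcoef_ne_zero`), and the coefficient of `τ` in a chart is itself a coordinate near each
zero (`exists_chart_of_mem_zeroLocus`). This gives the common boundary and the slice charts of `M_0`
(`exists_isSmoothEmbedding_of_charts`). The tractor `(0, 1)` is null at a zero, so `L(τ)` is not
definite there.

For the conformal structure: `TM_0` lies in the kernel of `∇τ`, so on tractors `(u, a)` with `u`
tangent to `M_0` the form `L(τ)` is `½∇∇τ`. A projective change alters this only by terms with a
factor `∇τ`, which vanish on `TM_0` (`hessian_eq_of_projRelated`). It is the form induced on `X^⊥ /
X` for the null vector `X = (0, 1)`; passing to this quotient removes one plus and one minus sign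
(`hasSignature_of_null_quotient`). Division by a positive density of weight 2 gives a metric. For
its smoothness `∇∇τ` must be computed in one chart for all nearby points (`hessian_chart`); the
consistency of the chart formulas rests on Jacobi's formula for the determinant
(`densityDeriv_chart`).

For the compactification: a projective change by `Υ` adds `2τΥ` to `∇τ`, so `∇^τ` arises from `Υ =
-∇τ/(2τ)`. With `f` the coefficient of `τ` in a chart, `Υ` equals `-df/(2f)` minus a smooth form
(`scaleForm_chart`). For `r = ±f` the correction terms of order 2 cancel exactly the singular part,
and the rest is smooth up to the boundary (`exists_smooth_extension`). -/

open Set Bundle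
open scoped Manifold ContDiff Topology

noncomputable section

namespace ProjDiff

/-! ### Rank and signature of bilinear forms -/

section LinearAlgebra

open LinearMap

variable {T U V : Type*} [AddCommGroup T] [Module ℝ T] [AddCommGroup U] [Module ℝ U]
  [AddCommGroup V] [Module ℝ V]

lemma formRank_eq_finrank_of_nondegenerate [FiniteDimensional ℝ V] {B : LinearMap.BilinForm ℝ V}
    (hB : B.Nondegenerate) : formRank B = Module.finrank ℝ V := by
  rw [formRank, LinearMap.finrank_range_of_inj]
  exact LinearMap.ker_eq_bot.1 (LinearMap.BilinForm.Nondegenerate.ker_eq_bot hB)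

lemma formRank_le_finrank [FiniteDimensional ℝ V] (B : LinearMap.BilinForm ℝ V) :
    formRank B ≤ Module.finrank ℝ V :=
  LinearMap.finrank_range_le B

/-- A bilinear form which factors through `H` along `P` has rank at most that of `H`. -/
lemma formRank_le_of_factor [FiniteDimensional ℝ U] {H : LinearMap.BilinForm ℝ U}
    {B : LinearMap.BilinForm ℝ V}
    (P : V →ₗ[ℝ] U) (c : ℝ) (h : ∀ v w, B v w = c * H (P v) (P w)) : formRank B ≤ formRank H := by
  have hB : B = (c • P.dualMap) ∘ₗ H ∘ₗ P := by
    ext v w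
    simp [h]
  rw [formRank, hB, LinearMap.range_comp]
  refine (Submodule.finrank_map_le _ _).trans ?_
  exact Submodule.finrank_mono (LinearMap.range_comp_le_range P H)

/-- If `B` vanishes on the line `ℝ X`, its restriction to a hyperplane of the kernel of `B(X, ·)`
complementary to `X` loses at most one plus sign. -/
lemma sigPos_le_sigPos_add_one [FiniteDimensional ℝ T] [FiniteDimensional ℝ U]
    {Q : QuadraticForm ℝ (U × ℝ)} {β : QuadraticForm ℝ T}
    (j : T →ₗ[ℝ] U) (hj : Function.Injective j)
    (hdim : Module.finrank ℝ T + 1 = Module.finrank ℝ U)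
    (h : ∀ t a, Q (j t, a) = β t) : sigPos Q ≤ sigPos β + 1 := by
  obtain ⟨W, hW, hpos⟩ := exists_finrank_eq_sigPos_and_posDef Q
  have hpos' : ∀ w ∈ W, w ≠ 0 → 0 < Q w := fun w hw h0 ↦
    hpos ⟨w, hw⟩ (fun h' ↦ h0 (congrArg Subtype.val h'))
  let J : T × ℝ →ₗ[ℝ] U × ℝ := j.prodMap LinearMap.id
  have hJ : Function.Injective J := Function.Injective.prodMap hj Function.injective_id
  let W' : Submodule ℝ (T × ℝ) := W.comap J
  -- The range of `J` is a hyperplane of `U × ℝ`, so intersecting with it lowers the dimension of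
  -- `W` by at most one.
  have hdimW : Module.finrank ℝ W ≤ Module.finrank ℝ W' + 1 := by
    have h1 : Module.finrank ℝ W' = Module.finrank ℝ (W ⊓ LinearMap.range J : Submodule ℝ _) := by
      have : (W ⊓ LinearMap.range J) = W'.map J := by
        rw [Submodule.map_comap_eq, inf_comm]
      rw [this]
      exact (LinearEquiv.finrank_eq (Submodule.equivMapOfInjective J hJ W'))
    have h2 := Submodule.finrank_sup_add_finrank_inf_eq W (LinearMap.range J)
    have h3 : Module.finrank ℝ (LinearMap.range J) = Module.finrank ℝ T + 1 := by
      rw [LinearMap.finrank_range_of_inj hJ]; simp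
    have h4 : Module.finrank ℝ (W ⊔ LinearMap.range J : Submodule ℝ _) ≤
        Module.finrank ℝ U + 1 := by
      refine (Submodule.finrank_le _).trans ?_
      simp
    omega
  -- Dropping the last coordinate is injective on `W'`: a vector `(0, a)` has value `β 0 = 0`, while
  -- `Q` is positive on nonzero vectors of `W`.
  let p : W' →ₗ[ℝ] T := (LinearMap.fst ℝ T ℝ) ∘ₗ W'.subtype
  have hp0 : ∀ w : W', p w = 0 → w = 0 := by
    rintro ⟨⟨t, a⟩, hw⟩ h0
    have ht : t = 0 := h0
    subst ht
    by_contra hne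
    have hne' : J (0, a) ≠ 0 := fun h' ↦
      hne (Subtype.ext (hJ (h'.trans (map_zero J).symm)))
    have h5 := hpos' _ hw hne'
    have h6 : Q (J (0, a)) = β 0 := h 0 a
    rw [h6] at h5
    simp at h5
  have hp : Function.Injective p := (injective_iff_map_eq_zero p).2 hp0
  have hle : Module.finrank ℝ (LinearMap.range p) ≤ sigPos β := by
    apply le_sigPos_of_posDef
    rintro ⟨_, ⟨⟨⟨t, a⟩, hw⟩, rfl⟩⟩ hne
    change 0 < β t
    rw [← h t a]
    refine hpos' _ hw fun h0 ↦ hne ?_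
    have : (t, a) = (0 : T × ℝ) := hJ (by rw [map_zero]; exact h0)
    exact Subtype.ext (congrArg Prod.fst this)
  rw [LinearMap.finrank_range_of_inj hp] at hle
  omega

/-- The signature of the form induced on `X^⊥ / X` for a null vector `X`. -/
lemma hasSignature_of_null_quotient [FiniteDimensional ℝ T] [FiniteDimensional ℝ U]
    {B : LinearMap.BilinForm ℝ (U × ℝ)} {β : LinearMap.BilinForm ℝ T}
    (j : T →ₗ[ℝ] U) (hj : Function.Injective j)
    (hdim : Module.finrank ℝ T + 1 = Module.finrank ℝ U)
    (h : ∀ s t a b, B (j s, a) (j t, b) = β s t) {p q : ℕ} (hB : HasSignature B p q 0) :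
    1 ≤ p ∧ 1 ≤ q ∧ HasSignature β (p - 1) (q - 1) 0 := by
  obtain ⟨hp, hq, hpq⟩ := hB
  have h1 : sigPos B.toQuadraticMap ≤ sigPos β.toQuadraticMap + 1 :=
    sigPos_le_sigPos_add_one j hj hdim fun t a ↦ by simp [h]
  have h2 : sigPos (-B.toQuadraticMap) ≤ sigPos (-β.toQuadraticMap) + 1 :=
    sigPos_le_sigPos_add_one j hj hdim fun t a ↦ by simp [h]
  rw [sigPos_neg, sigPos_neg] at h2
  have h3 := QuadraticForm.sigPos_add_sigNeg_add_radical (Q := β.toQuadraticMap)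
  have h4 : Module.finrank ℝ (U × ℝ) = Module.finrank ℝ U + 1 := by simp
  rw [h4] at hpq
  -- The indices of `β` are at least `p - 1` and `q - 1`, and their sum is at most `dim T = p + q -
  -- 2`, so both bounds are equalities; `p = 0` or `q = 0` would violate the same count.
  refine ⟨by omega, by omega, by omega, by omega, by omega⟩

/-- Multiplication of vectors by `1/√c` is an isometry from `β` to `β'`. -/
lemma HasSignature.smul_pos {β β' : LinearMap.BilinForm ℝ T} {p q r : ℕ} 
    (h : HasSignature β p q r) {c : ℝ} (hc : 0 < c) (h' : ∀ u v, β' u v = c * β u v) : HasSignature β' p q r := by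
  have he : QuadraticMap.Equivalent β.toQuadraticMap β'.toQuadraticMap := by
    refine ⟨⟨LinearEquiv.smulOfUnit (Units.mk0 (Real.sqrt c)⁻¹ (by positivity)), fun m ↦ ?_⟩⟩
    have hs : Real.sqrt c * Real.sqrt c = c := Real.mul_self_sqrt hc.le
    have hs0 : Real.sqrt c ≠ 0 := by positivity
    change β' ((Real.sqrt c)⁻¹ • m) ((Real.sqrt c)⁻¹ • m) = β m m
    rw [h']
    simp only [map_smul, LinearMap.smul_apply, smul_eq_mul]
    field_simp
    rw [pow_two, hs]
  exact ⟨he.sigPos_eq ▸ h.1, he.sigNeg_eq ▸ h.2.1, h.2.2⟩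

/-- A form whose nullity is zero separates points. -/
lemma HasSignature.eq_zero_of_forall [FiniteDimensional ℝ T] {β : LinearMap.BilinForm ℝ T} {p q : ℕ}
    (h : HasSignature β p q 0) (hs : ∀ u v, β u v = β v u) {u : T} (hu : ∀ v, β u v = 0) :
    u = 0 := by
  have h3 := QuadraticForm.sigPos_add_sigNeg_add_radical (Q := β.toQuadraticMap)
  obtain ⟨hp, hq, hpq⟩ := h
  have h4 : Module.finrank ℝ β.toQuadraticMap.radical = 0 := by omega
  rw [Submodule.finrank_eq_zero] at h4
  have : u ∈ β.toQuadraticMap.radical := by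
    rw [QuadraticMap.mem_radical_iff']
    refine ⟨by simp [hu], fun v ↦ ?_⟩
    simp [hu, hs v u]
  rw [h4] at this
  simpa using this

end LinearAlgebra

/-! ### Vector fields in a fixed chart -/

section Coordinates

variable {n : ℕ} {M : Type*} [TopologicalSpace M] [ChartedSpace (Model n) M]

lemma chart_source_mem_nhds {x y : M} (hy : y ∈ (chartAt (Model n) x).source) :
    (chartAt (Model n) x).source ∈ 𝓝 y :=
  (chartAt (Model n) x).open_source.mem_nhds hy

lemma eq_sum_single (v : Model n) : v = ∑ k, v k • EuclideanSpace.single k (1 : ℝ) := by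
  simpa using ((EuclideanSpace.basisFun (Fin n) ℝ).sum_repr v).symm

variable [IsManifold (𝓡 n) ∞ M]

/-- The components of tangent vectors at `y` with respect to the chart at `x`. -/
def tcoord (x y : M) : TangentSpace (𝓡 n) y →L[ℝ] Model n :=
  (trivializationAt (Model n) (TangentSpace (𝓡 n)) x).continuousLinearMapAt ℝ y

/-- The vector field on the domain of the chart at `x` with constant components `v`. -/
def constField (x : M) (v : Model n) : VField n M := fun y ↦
  (trivializationAt (Model n) (TangentSpace (𝓡 n)) x).symmL ℝ y v

lemma tcoord_eq {x y : M} (hy : y ∈ (chartAt (Model n) x).source) (v : TangentSpace (𝓡 n) y) :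
    tcoord x y v = (trivializationAt (Model n) (TangentSpace (𝓡 n)) x ⟨y, v⟩).2 := by
  unfold tcoord
  rw [Trivialization.continuousLinearMapAt_apply, Trivialization.linearMapAt_apply]
  exact if_pos hy

lemma trivializationAt_self (x : M) (v : TangentSpace (𝓡 n) x) :
    (trivializationAt (Model n) (TangentSpace (𝓡 n)) x ⟨x, v⟩).2 = v :=
  (tangentBundleCore (𝓡 n) M).coordChange_self (achart (Model n) x) x (mem_chart_source _ x) v

/-- The curvature and `∇∇σ` are defined with `extendField`. It is compared with `constField` on the
chart domain only, which suffices because connections are local operators. -/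
lemma extendField_apply {x y : M} (hy : y ∈ (chartAt (Model n) x).source)
    (v : TangentSpace (𝓡 n) x) : extendField v y = constField x v y := by
  unfold constField extendField FiberBundle.extend
  rw [trivializationAt_self]
  exact ((trivializationAt (Model n) (TangentSpace (𝓡 n)) x).symmL_apply (R := ℝ) hy v).symm

lemma extendField_eventuallyEq {x : M} (v : TangentSpace (𝓡 n) x) :
    ∀ᶠ y in 𝓝 x, extendField v y = constField x v y := by
  filter_upwards [chart_source_mem_nhds (n := n) (mem_chart_source _ x)] with y hy
  exact extendField_apply hy v

lemma tcoord_constField {x y : M} (hy : y ∈ (chartAt (Model n) x).source) (v : Model n) :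
    tcoord x y (constField x v y) = v :=
  (trivializationAt (Model n) (TangentSpace (𝓡 n)) x).continuousLinearMapAt_symmL (R := ℝ) hy v

lemma constField_tcoord {x y : M} (hy : y ∈ (chartAt (Model n) x).source)
    (v : TangentSpace (𝓡 n) y) : constField x (tcoord x y v) y = v :=
  (trivializationAt (Model n) (TangentSpace (𝓡 n)) x).symmL_continuousLinearMapAt (R := ℝ) hy v

lemma tcoord_self (x : M) (v : TangentSpace (𝓡 n) x) : tcoord x x v = v := by
  rw [tcoord_eq (mem_chart_source _ x)]
  exact trivializationAt_self x v

lemma constField_self (x : M) (v : Model n) : constField x v x = v := by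
  have h := constField_tcoord (mem_chart_source _ x) (show TangentSpace (𝓡 n) x from v)
  rw [tcoord_self] at h
  exact h

/-- The coordinate frame of the chart at `x`. -/
abbrev frame (x : M) (k : Fin n) : VField n M := constField x (EuclideanSpace.single k 1)

lemma coordBasis_apply (x : M) (k : Fin n) :
    coordBasis x k = (EuclideanSpace.single k 1 : Model n) := by
  change (EuclideanSpace.basisFun (Fin n) ℝ).toBasis k = _
  simp

lemma extendField_coordBasis_apply {x y : M} (hy : y ∈ (chartAt (Model n) x).source) (k : Fin n) :
    extendField (coordBasis x k) y = frame x k y := by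
  rw [extendField_apply hy, coordBasis_apply]

lemma constField_eq_sum (x : M) (v : Model n) (y : M) :
    constField x v y = ∑ k, v k • frame x k y := by
  conv_lhs => rw [eq_sum_single v]
  unfold frame constField
  rw [map_sum]
  simp only [map_smul]

lemma eq_sum_frame {x y : M} (hy : y ∈ (chartAt (Model n) x).source) (v : TangentSpace (𝓡 n) y) :
    v = ∑ k, tcoord x y v k • frame x k y := by
  rw [← constField_eq_sum, constField_tcoord hy]

/-- The chart at `x` serves for all nearby points `y`, and the version within a set covers
smoothness up to the boundary. -/
lemma contMDiffWithinAt_tcoord_iff {x y : M} {Y : VField n M} {s : Set M} {r : ℕ∞}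
    (hy : y ∈ (chartAt (Model n) x).source) :
    ContMDiffWithinAt (𝓡 n) ((𝓡 n).prod 𝓘(ℝ, Model n)) r
      (fun x ↦ (TotalSpace.mk' (Model n) x (Y x) : TangentBundle (𝓡 n) M)) s y ↔
    ContMDiffWithinAt (𝓡 n) 𝓘(ℝ, Model n) r (fun z ↦ tcoord x z (Y z)) s y := by
  have : IsManifold (𝓡 n) (r + 1) M := .of_le (n := ∞) (by exact_mod_cast le_top)
  have : ContMDiffVectorBundle r (Model n) (TangentSpace (𝓡 n) : M → Type _) (𝓡 n) :=
    TangentBundle.contMDiffVectorBundle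
  have h := (trivializationAt (Model n) (TangentSpace (𝓡 n)) x).contMDiffWithinAt_section
    (IB := 𝓡 n) (n := r) (s := Y) s (x₀ := y) hy
  refine h.trans (Filter.EventuallyEq.contMDiffWithinAt_iff ?_ ?_)
  · filter_upwards [mem_nhdsWithin_of_mem_nhds (chart_source_mem_nhds hy)] with z hz
    rw [tcoord_eq hz]
  · rw [tcoord_eq hy]

lemma contMDiffOn_constField (x : M) (v : Model n) :
    SmoothFieldOn (constField x v) (chartAt (Model n) x).source := fun y hy ↦ by
  refine (contMDiffWithinAt_tcoord_iff (r := ⊤) hy).2 ?_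
  exact (contMDiffWithinAt_const (c := v)).congr (fun z hz ↦ tcoord_constField hz v)
    (tcoord_constField hy v)

lemma SmoothFieldOn.diffAt {Y : VField n M} {s : Set M} (hY : SmoothFieldOn Y s) {y : M}
    (hs : s ∈ 𝓝 y) : DiffFieldAt Y y :=
  (hY.contMDiffAt hs).mdifferentiableAt (by simp)

lemma diffFieldAt_constField {x y : M} (hy : y ∈ (chartAt (Model n) x).source) (v : Model n) :
    DiffFieldAt (constField x v) y :=
  (contMDiffOn_constField x v).diffAt (chart_source_mem_nhds hy)

lemma diffFieldAt_iff_tcoord {x y : M} {Y : VField n M} (hy : y ∈ (chartAt (Model n) x).source) :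
    DiffFieldAt Y y ↔ MDifferentiableAt (𝓡 n) 𝓘(ℝ, Model n) (fun z ↦ tcoord x z (Y z)) y := by
  have h := (trivializationAt (Model n) (TangentSpace (𝓡 n)) x).mdifferentiableAt_section_iff
    (𝓡 n) Y (b₀ := y) hy
  refine h.trans (Filter.EventuallyEq.mdifferentiableAt_iff ?_)
  filter_upwards [chart_source_mem_nhds hy] with z hz
  rw [tcoord_eq hz]

lemma diffFieldAt_extendField {x : M} (v : TangentSpace (𝓡 n) x) :
    DiffFieldAt (extendField v) x := by
  have h := mem_chart_source (Model n) x
  rw [diffFieldAt_iff_tcoord h]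
  refine ((diffFieldAt_iff_tcoord h).1 (diffFieldAt_constField h v)).congr_of_eventuallyEq ?_
  filter_upwards [extendField_eventuallyEq v] with y hy
  rw [hy]

end Coordinates

/-! ### Coefficients of densities in a fixed chart -/

section Densities

variable {n : ℕ} {M : Type*} [TopologicalSpace M] [ChartedSpace (Model n) M]
  [IsManifold (𝓡 n) ∞ M]

/-- The coordinate change of the tangent bundle at `z`, from the chart at `y` to the chart at
`x`. -/
abbrev tchange (y x z : M) : Model n →L[ℝ] Model n :=
  (tangentBundleCore (𝓡 n) M).coordChange (achart (Model n) y) (achart (Model n) x) z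

lemma tcoord_constField_eq_tchange {x y z : M} (hx : z ∈ (chartAt (Model n) x).source)
    (hy : z ∈ (chartAt (Model n) y).source) (v : Model n) :
    tcoord x z (constField y v z) = tchange y x z v := by
  have h1 (u : TangentSpace (𝓡 n) z) : tcoord x z u = tchange z x z u :=
    DFunLike.congr_fun (TangentBundle.continuousLinearMapAt_trivializationAt_eq_core hx) u
  have h2 : constField y v z = tchange y z z v :=
    DFunLike.congr_fun (TangentBundle.symmL_trivializationAt_eq_core hy) v
  rw [h1, h2]
  exact (tangentBundleCore (𝓡 n) M).coordChange_comp (achart (Model n) y) (achart (Model n) z)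
    (achart (Model n) x) z ⟨⟨hy, mem_chart_source _ z⟩, hx⟩ v

/-- The coefficient of a density in the chart at `x`. -/
def dcoef {w : ℝ} (x : M) (σ : (x : M) → DensityBundle n M w x) (y : M) : ℝ :=
  (trivializationAt ℝ (DensityBundle n M w) x (TotalSpace.mk' ℝ y (σ y))).2

/-- The factor by which the coefficient of a density of weight `w` at `z` changes from the chart at
`y` to the chart at `x`. -/
def dfactor (w : ℝ) (y x z : M) : ℝ := |(tchange (n := n) y x z).det| ^ (w / ((n : ℝ) + 1))

lemma dcoef_eq {w : ℝ} (x : M) (σ : (x : M) → DensityBundle n M w x) (y : M) :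
    dcoef x σ y = dfactor (n := n) w y x y * dval σ y := rfl

/-- Positivity is the orientation of `E(w)`: the sign of a coefficient does not depend on the chart.
-/
lemma dfactor_pos (w : ℝ) {y x z : M} (hy : z ∈ (chartAt (Model n) y).source)
    (hx : z ∈ (chartAt (Model n) x).source) : 0 < dfactor (n := n) w y x z :=
  Real.rpow_pos_of_pos (abs_pos.2 (det_tangent_coordChange_ne_zero n M (achart (Model n) y)
    (achart (Model n) x) z ⟨hy, hx⟩)) _

lemma dcoef_change {w : ℝ} {x y z : M} (σ : (x : M) → DensityBundle n M w x)
    (hy : z ∈ (chartAt (Model n) y).source) (hx : z ∈ (chartAt (Model n) x).source) :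
    dcoef x σ z = dfactor (n := n) w y x z * dcoef y σ z :=
  ((densityCore n M w).coordChange_comp (achart (Model n) z) (achart (Model n) y)
    (achart (Model n) x) z ⟨⟨mem_chart_source _ z, hy⟩, hx⟩ (σ z)).symm

lemma dcoef_self {w : ℝ} (σ : (x : M) → DensityBundle n M w x) (x : M) :
    dcoef x σ x = dval σ x :=
  (densityCore n M w).coordChange_self (achart (Model n) x) x (mem_chart_source _ x) (σ x)

end Densities

/-! ### Derivative of powers of the determinant -/

section Jacobi

variable {n : ℕ}

lemma continuous_basis_det {V : Type*} [NormedAddCommGroup V] [NormedSpace ℝ V]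
    [FiniteDimensional ℝ V] (b : Module.Basis (Fin n) ℝ V) : Continuous b.det := by
  have h : (b.det : (Fin n → V) → ℝ) = fun v ↦ (Matrix.of fun i j ↦ b.repr (v j) i).det := by
    funext v; rfl
  rw [h]
  refine Continuous.matrix_det (continuous_matrix fun i j ↦ ?_)
  exact (LinearMap.continuous_of_finiteDimensional (b.coord i)).comp (continuous_apply j)

/-- This is Cramer's rule for the identity matrix. -/
lemma basis_det_update {V : Type*} [AddCommGroup V] [Module ℝ V]
    (b : Module.Basis (Fin n) ℝ V) (i : Fin n) (w : V) :
    b.det (Function.update b i w) = b.repr w i := by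
  rw [Module.Basis.det_apply, Module.Basis.toMatrix_update, Module.Basis.toMatrix_self,
    ← Matrix.cramer_apply, Matrix.cramer_one]
  rfl

/-- Jacobi's formula at an invertible endomorphism. -/
lemma hasFDerivAt_det_comp {V : Type*} [NormedAddCommGroup V] [NormedSpace ℝ V]
    [FiniteDimensional ℝ V] (b : Module.Basis (Fin n) ℝ V) (T T' : V →L[ℝ] V)
    (hT : ∀ v, T (T' v) = v) : ∃ G : (V →L[ℝ] V) →L[ℝ] ℝ,
      HasFDerivAt (fun L : V →L[ℝ] V ↦ L.det) G T ∧
      ∀ B, G B = T.det * ∑ i, b.repr (T' (B (b i))) i := by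
  let f : ContinuousMultilinearMap ℝ (fun _ : Fin n ↦ V) ℝ :=
    ⟨b.det.toMultilinearMap, continuous_basis_det b⟩
  let ev : (V →L[ℝ] V) →L[ℝ] (Fin n → V) :=
    ContinuousLinearMap.pi fun i ↦ ContinuousLinearMap.apply ℝ V (b i)
  have hf (L : V →L[ℝ] V) (v : Fin n → V) : f (fun i ↦ L (v i)) = L.det * b.det v :=
    b.det_comp (L : V →ₗ[ℝ] V) v
  refine ⟨(f.linearDeriv (ev T)).comp ev, ?_, fun B ↦ ?_⟩
  · have h := (f.hasFDerivAt (ev T)).comp T ev.hasFDerivAt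
    refine h.congr_of_eventuallyEq (Filter.Eventually.of_forall fun L ↦ ?_)
    have := hf L b
    rw [b.det_self, mul_one] at this
    exact this.symm
  · rw [ContinuousLinearMap.comp_apply, ContinuousMultilinearMap.linearDeriv_apply, Finset.mul_sum]
    -- The `i`-th entry `B (b i)` is `T (T' (B (b i)))` and the others are `T (b j)`. Hence `det T`
    -- factors out, leaving the determinant of the basis with one entry replaced.
    refine Finset.sum_congr rfl fun i _ ↦ ?_
    rw [← basis_det_update, ← hf]
    congr 1
    funext j
    by_cases hj : j = i
    · subst hj; simp [hT, ev]
    · simp [hj, ev]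

/-- The derivative of a power of the absolute value of the determinant. -/
lemma hasFDerivAt_abs_det_rpow {V : Type*} [NormedAddCommGroup V] [NormedSpace ℝ V]
    [FiniteDimensional ℝ V] (b : Module.Basis (Fin n) ℝ V) (T T' : V →L[ℝ] V)
    (hT : ∀ v, T (T' v) = v) (h0 : T.det ≠ 0) (κ : ℝ) : ∃ G : (V →L[ℝ] V) →L[ℝ] ℝ,
      HasFDerivAt (fun L : V →L[ℝ] V ↦ |L.det| ^ κ) G T ∧
      ∀ B, G B = κ * |T.det| ^ κ * ∑ i, b.repr (T' (B (b i))) i := by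
  obtain ⟨G, hG, hGB⟩ := hasFDerivAt_det_comp b T T' hT
  -- Writing the derivative with `1/t` covers both signs of `t`, and the denominator then cancels
  -- the factor `det T` in Jacobi's formula.
  have h1 : HasDerivAt (fun t : ℝ ↦ |t| ^ κ) (κ * |T.det| ^ κ / T.det) T.det := by
    have ha : 0 < |T.det| := abs_pos.2 h0
    have h2 := (hasDerivAt_abs h0).rpow_const (p := κ) (Or.inl ha.ne')
    convert h2 using 1
    rw [Real.rpow_sub_one ha.ne']
    have h3 : (SignType.sign T.det : ℝ) * |T.det| = T.det := sign_mul_abs _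
    have h4 : (SignType.sign T.det : ℝ) * T.det = |T.det| := sign_mul_self _
    field_simp
    rw [← h4]; ring
  refine ⟨_, h1.comp_hasFDerivAt T hG, fun B ↦ ?_⟩
  rw [smul_apply, hGB, smul_eq_mul]
  field_simp

end Jacobi

/-! ### Chain and product rules for functions on a manifold -/

section VectorDerivative

variable {n : ℕ} {M : Type*} [TopologicalSpace M] [ChartedSpace (Model n) M]
  {E F : Type*} [NormedAddCommGroup E] [NormedSpace ℝ E] [NormedAddCommGroup F] [NormedSpace ℝ F]

lemma mvfderiv_comp_hasFDerivAt {h : M → E} {y : M} (hh : MDifferentiableAt (𝓡 n) 𝓘(ℝ, E) h y)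
    {G : E → F} {G' : E →L[ℝ] F} (hG : HasFDerivAt G G' (h y)) (u : TangentSpace (𝓡 n) y) :
    mvfderiv (𝓡 n) (fun z ↦ G (h z)) y u = G' (mvfderiv (𝓡 n) h y u) := by
  have h1 := (hG.hasMFDerivAt).comp y hh.hasMFDerivAt
  have h2 : mfderiv (𝓡 n) 𝓘(ℝ, F) (fun z ↦ G (h z)) y = _ := h1.mfderiv
  exact DFunLike.congr_fun h2 u

lemma mdifferentiableAt_comp_hasFDerivAt {h : M → E} {y : M}
    (hh : MDifferentiableAt (𝓡 n) 𝓘(ℝ, E) h y)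
    {G : E → F} {G' : E →L[ℝ] F} (hG : HasFDerivAt G G' (h y)) :
    MDifferentiableAt (𝓡 n) 𝓘(ℝ, F) (fun z ↦ G (h z)) y :=
  (hG.differentiableAt.mdifferentiableAt).comp y hh

lemma mvfderiv_clm {h : M → E} {y : M} (hh : MDifferentiableAt (𝓡 n) 𝓘(ℝ, E) h y)
    (L : E →L[ℝ] F) (u : TangentSpace (𝓡 n) y) :
    mvfderiv (𝓡 n) (fun z ↦ L (h z)) y u = L (mvfderiv (𝓡 n) h y u) :=
  mvfderiv_comp_hasFDerivAt hh L.hasFDerivAt u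

lemma mvfderiv_congr {h h' : M → E} {y : M} (hh : ∀ᶠ z in 𝓝 y, h z = h' z) :
    mvfderiv (𝓡 n) h y = mvfderiv (𝓡 n) h' y := by
  have h1 : mfderiv (𝓡 n) 𝓘(ℝ, E) h y = mfderiv (𝓡 n) 𝓘(ℝ, E) h' y :=
    Filter.EventuallyEq.mfderiv_eq hh
  ext u
  exact DFunLike.congr_fun h1 u

lemma mvfderiv_mul_apply {h h' : M → ℝ} {y : M} (hh : MDifferentiableAt (𝓡 n) 𝓘(ℝ, ℝ) h y)
    (hh' : MDifferentiableAt (𝓡 n) 𝓘(ℝ, ℝ) h' y) (u : TangentSpace (𝓡 n) y) :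
    mvfderiv (𝓡 n) (fun z ↦ h z * h' z) y u =
      h y * mvfderiv (𝓡 n) h' y u + h' y * mvfderiv (𝓡 n) h y u := by
  have h1 := mvfderiv_mul hh hh'
  have h2 := DFunLike.congr_fun h1 u
  simpa [Pi.mul_def] using h2

end VectorDerivative

/-! ### Connections on fields and densities in a chart -/

section Connections

variable {n : ℕ} {M : Type*} [TopologicalSpace M] [ChartedSpace (Model n) M]
  [IsManifold (𝓡 n) ∞ M]

/-- Differentiability is carried through the induction because a covariant derivative is additive
only on differentiable fields. -/
lemma conn_sum {D : ConnOp n M} {s : Set M} (hD : IsCovariantDerivativeOn (Model n) D s)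
    {y : M} (hy : y ∈ s) {ι : Type*} (t : Finset ι) (Y : ι → VField n M)
    (hY : ∀ i ∈ t, DiffFieldAt (Y i) y) :
    DiffFieldAt (∑ i ∈ t, Y i) y ∧ D (∑ i ∈ t, Y i) y = ∑ i ∈ t, D (Y i) y := by
  classical
  induction t using Finset.induction_on with
  | empty =>
    refine ⟨?_, ?_⟩
    · exact mdifferentiableAt_zeroSection ..
    · rw [Finset.sum_empty, Finset.sum_empty]
      exact hD.zero hy
  | insert a t ha ih =>
    obtain ⟨h1, h2⟩ := ih fun i hi ↦ hY i (Finset.mem_insert_of_mem hi)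
    have h3 := hY a (Finset.mem_insert_self a t)
    rw [Finset.sum_insert ha, Finset.sum_insert ha]
    refine ⟨mdifferentiableAt_add_section h3 h1, ?_⟩
    rw [hD.add h3 h1 hy, h2]

/-- A connection in the coordinate frame of the chart at `x`. -/
lemma conn_apply {D : ConnOp n M} {s : Set M} (hD : IsCovariantDerivativeOn (Model n) D s)
    {x y : M} (hs : s ∈ 𝓝 y) (hx : y ∈ (chartAt (Model n) x).source) {Y : VField n M}
    (hY : DiffFieldAt Y y) (u : TangentSpace (𝓡 n) y) :
    D Y y u = constField x (mvfderiv (𝓡 n) (fun z ↦ tcoord x z (Y z)) y u) y +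
      ∑ k, tcoord x y (Y y) k • D (frame x k) y u := by
  have hy : y ∈ s := mem_of_mem_nhds hs
  have hc := (diffFieldAt_iff_tcoord hx).1 hY
  let pr (k : Fin n) : Model n →L[ℝ] ℝ := EuclideanSpace.proj k
  have hk (k : Fin n) : MDifferentiableAt (𝓡 n) 𝓘(ℝ, ℝ) (fun z ↦ tcoord x z (Y z) k) y :=
    mdifferentiableAt_comp_hasFDerivAt hc (pr k).hasFDerivAt
  have hf (k : Fin n) := diffFieldAt_constField hx (EuclideanSpace.single k 1 : Model n)
  let Z (k : Fin n) : VField n M := (fun z ↦ tcoord x z (Y z) k) • frame x k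
  have hZ (k : Fin n) : DiffFieldAt (Z k) y := (hk k).smul_section (hf k)
  obtain ⟨h1, h2⟩ := conn_sum hD hy Finset.univ Z fun k _ ↦ hZ k
  -- The expansion in the frame holds only on the chart domain; locality of the connection is what
  -- allows the replacement.
  have h3 : D Y y = D (∑ k, Z k) y := by
    refine hD.congr_of_eventuallyEq hY h1 hs ?_
    filter_upwards [chart_source_mem_nhds hx] with z hz
    rw [Finset.sum_apply]
    exact eq_sum_frame hz (Y z)
  rw [h3, h2, constField_eq_sum, sum_apply, ← Finset.sum_add_distrib]
  refine Finset.sum_congr rfl fun k _ ↦ ?_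
  have h4 : D (Z k) y = _ := hD.leibniz (hf k) (hk k) hy
  have h5 : mvfderiv (𝓡 n) (fun z ↦ tcoord x z (Y z) k) y u =
    mvfderiv (𝓡 n) (fun z ↦ tcoord x z (Y z)) y u k := mvfderiv_clm hc (pr k) u
  rw [h4, ← h5, add_comm]
  rfl

/-- The trace of `v ↦ ∇_u v` in the coordinate frame of the chart at `x`. -/
def ctrace (D : ConnOp n M) (x y : M) : TangentSpace (𝓡 n) y →L[ℝ] ℝ :=
  ∑ k, (EuclideanSpace.proj k : Model n →L[ℝ] ℝ) ∘L tcoord x y ∘L D (frame x k) y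

lemma ctrace_apply (D : ConnOp n M) (x y : M) (u : TangentSpace (𝓡 n) y) :
    ctrace D x y u = ∑ k, tcoord x y (D (frame x k) y u) k := by
  simp [ctrace]

lemma densityDeriv_apply {w : ℝ} {D : ConnOp n M} {s : Set M}
    (hD : IsCovariantDerivativeOn (Model n) D s) {x : M} (hs : s ∈ 𝓝 x)
    (σ : (x : M) → DensityBundle n M w x) (u : TangentSpace (𝓡 n) x) :
    densityDeriv D σ x u = mvfderiv (𝓡 n) (dcoef x σ) x u +
      w / ((n : ℝ) + 1) * dcoef x σ x * ctrace D x x u := by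
  have hx := mem_chart_source (Model n) x
  have h (i : Fin n) : D (extendField (coordBasis x i)) x = D (frame x i) x := by
    refine hD.congr_of_eventuallyEq (diffFieldAt_extendField _) (diffFieldAt_constField hx _) hs ?_
    filter_upwards [chart_source_mem_nhds hx] with y hy
    exact extendField_coordBasis_apply hy i
  rw [densityDeriv, dcoef_self, ctrace_apply]
  simp only [h]
  rw [add_apply, smul_apply, sum_apply]
  simp only [tcoord_self]
  rfl

lemma mdifferentiableAt_tchange {x y z : M} (hy : z ∈ (chartAt (Model n) y).source)
    (hx : z ∈ (chartAt (Model n) x).source) :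
    MDifferentiableAt (𝓡 n) 𝓘(ℝ, Model n →L[ℝ] Model n) (tchange (n := n) y x) z := by
  have : (tangentBundleCore (𝓡 n) M).IsContMDiff (𝓡 n) ∞ :=
    tangentBundleCore.isContMDiff (h := (inferInstance : IsManifold (𝓡 n) ∞ M))
  have h := (tangentBundleCore (𝓡 n) M).contMDiffOn_coordChange (n := ∞) (𝓡 n)
    (achart (Model n) y) (achart (Model n) x)
  refine (h.contMDiffAt ?_).mdifferentiableAt (by simp)
  exact Filter.inter_mem (chart_source_mem_nhds hy) (chart_source_mem_nhds hx)

lemma tchange_tchange {x y z : M} (hy : z ∈ (chartAt (Model n) y).source)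
    (hx : z ∈ (chartAt (Model n) x).source) (v : Model n) :
    tchange x y z (tchange y x z v) = v := by
  rw [← tcoord_constField_eq_tchange hx hy, ← tcoord_constField_eq_tchange hy hx,
    constField_tcoord hx, tcoord_constField hy]

/-- With `T` the coordinate change, the contracted Christoffel symbols acquire the term `tr (T⁻¹ dT)
= d log |det T|`; the remaining part is the trace of an endomorphism and so does not depend on the
basis. -/
lemma ctrace_change {D : ConnOp n M} {s : Set M} (hD : IsCovariantDerivativeOn (Model n) D s)
    {x y : M} (hs : s ∈ 𝓝 y) (hx : y ∈ (chartAt (Model n) x).source)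
    (u : TangentSpace (𝓡 n) y) :
    ctrace D y y u = ctrace D x y u + ∑ i, tchange x y y
      (mvfderiv (𝓡 n) (tchange (n := n) y x) y u (EuclideanSpace.single i 1)) i := by
  have hy := mem_chart_source (Model n) y
  have hT := mdifferentiableAt_tchange hy hx
  have h1 (i : Fin n) : tcoord y y (D (frame y i) y u) i =
      tchange x y y (mvfderiv (𝓡 n) (tchange (n := n) y x) y u (EuclideanSpace.single i 1)) i
      + ∑ k, tchange y x y (EuclideanSpace.single i 1) k *
        tchange x y y (tcoord x y (D (frame x k) y u)) i := by
    rw [conn_apply hD hs hx (diffFieldAt_constField hy _) u, map_add, map_sum]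
    have h2 : mvfderiv (𝓡 n) (fun z ↦ tcoord x z (frame y i z)) y u =
        mvfderiv (𝓡 n) (tchange (n := n) y x) y u (EuclideanSpace.single i 1) := by
      refine Eq.trans ?_ (mvfderiv_clm hT (ContinuousLinearMap.apply ℝ (Model n)
        (EuclideanSpace.single i (1 : ℝ) : Model n)) u)
      refine DFunLike.congr_fun (mvfderiv_congr ?_) u
      filter_upwards [chart_source_mem_nhds hx, chart_source_mem_nhds hy] with z hz hz'
      exact tcoord_constField_eq_tchange hz hz' _
    rw [h2, tcoord_constField_eq_tchange hy hx, tcoord_constField_eq_tchange hx hy]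
    simp only [PiLp.add_apply, WithLp.ofLp_sum, Finset.sum_apply, map_smul, smul_eq_mul,
      WithLp.ofLp_smul, Pi.smul_apply]
    congr 1
    refine Finset.sum_congr rfl fun k _ ↦ ?_
    congr 1
    rw [← tcoord_constField_eq_tchange hy hx, constField_tcoord hx]
  rw [ctrace_apply, ctrace_apply]
  simp only [h1]
  rw [Finset.sum_add_distrib, add_comm]
  congr 1
  rw [Finset.sum_comm]
  refine Finset.sum_congr rfl fun k _ ↦ ?_
  have h3 := tchange_tchange hx hy (tcoord x y (D (frame x k) y u))
  conv_rhs => rw [← h3]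
  conv_rhs => rw [eq_sum_single (tchange x y y (tcoord x y (D (frame x k) y u))), map_sum]
  simp only [map_smul, WithLp.ofLp_sum, Finset.sum_apply, smul_eq_mul,
    WithLp.ofLp_smul, Pi.smul_apply]
  exact Finset.sum_congr rfl fun i _ ↦ mul_comm _ _

lemma mdifferentiableAt_dcoef_change {w : ℝ} {x x' y : M} {σ : (x : M) → DensityBundle n M w x}
    (hx : y ∈ (chartAt (Model n) x).source) (hx' : y ∈ (chartAt (Model n) x').source)
    (hσ : MDifferentiableAt (𝓡 n) 𝓘(ℝ, ℝ) (dcoef x σ) y) :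
    MDifferentiableAt (𝓡 n) 𝓘(ℝ, ℝ) (dcoef x' σ) y := by
  obtain ⟨G, hG, -⟩ := hasFDerivAt_abs_det_rpow (EuclideanSpace.basisFun (Fin n) ℝ).toBasis
    (tchange x x' y) (tchange x' x y) (tchange_tchange hx' hx)
    (det_tangent_coordChange_ne_zero n M (achart (Model n) x) (achart (Model n) x') y ⟨hx, hx'⟩)
    (w / ((n : ℝ) + 1))
  have h := mdifferentiableAt_comp_hasFDerivAt (mdifferentiableAt_tchange hx hx') hG
  refine (h.mul hσ).congr_of_eventuallyEq ?_
  filter_upwards [chart_source_mem_nhds hx, chart_source_mem_nhds hx'] with z hz hz'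
  exact dcoef_change σ hz hz'

/-- The covariant derivative of a density in the chart at `x`. -/
lemma densityDeriv_chart {w : ℝ} {D : ConnOp n M} {s : Set M}
    (hD : IsCovariantDerivativeOn (Model n) D s) {x y : M} (hs : s ∈ 𝓝 y)
    (hx : y ∈ (chartAt (Model n) x).source) {σ : (x : M) → DensityBundle n M w x}
    (hσ : MDifferentiableAt (𝓡 n) 𝓘(ℝ, ℝ) (dcoef x σ) y) (u : TangentSpace (𝓡 n) y) :
    dfactor (n := n) w y x y * densityDeriv D σ y u = mvfderiv (𝓡 n) (dcoef x σ) y u +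
      w / ((n : ℝ) + 1) * dcoef x σ y * ctrace D x y u := by
  have hy := mem_chart_source (Model n) y
  have hσ' := mdifferentiableAt_dcoef_change hx hy hσ
  obtain ⟨G, hG, hGB⟩ := hasFDerivAt_abs_det_rpow (EuclideanSpace.basisFun (Fin n) ℝ).toBasis
    (tchange y x y) (tchange x y y) (tchange_tchange hx hy)
    (det_tangent_coordChange_ne_zero n M (achart (Model n) y) (achart (Model n) x) y ⟨hy, hx⟩)
    (w / ((n : ℝ) + 1))
  have hT := mdifferentiableAt_tchange hy hx
  have h1 : mvfderiv (𝓡 n) (dcoef x σ) y u =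
      mvfderiv (𝓡 n) (fun z ↦ dfactor (n := n) w y x z * dcoef y σ z) y u := by
    refine DFunLike.congr_fun (mvfderiv_congr ?_) u
    filter_upwards [chart_source_mem_nhds hx, chart_source_mem_nhds hy] with z hz hz'
    exact dcoef_change σ hz' hz
  have h2 : mvfderiv (𝓡 n) (dfactor (n := n) w y x) y u =
      G (mvfderiv (𝓡 n) (tchange (n := n) y x) y u) :=
    mvfderiv_comp_hasFDerivAt hT hG u
  have h3 : MDifferentiableAt (𝓡 n) 𝓘(ℝ, ℝ) (dfactor (n := n) w y x) y :=
    mdifferentiableAt_comp_hasFDerivAt hT hG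
  -- By Jacobi's formula the derivative of the transition factor is `w/(n+1)` times this factor
  -- times the inhomogeneous term of `ctrace_change`, so the two contributions match.
  rw [h1, mvfderiv_mul_apply h3 hσ', h2, hGB,
    dcoef_change σ hy hx, densityDeriv_apply hD hs, ctrace_change hD hs hx]
  change _ = _ + _ * (_ * dfactor w y x y * _) + _
  simp only [OrthonormalBasis.coe_toBasis, EuclideanSpace.basisFun_apply,
    OrthonormalBasis.coe_toBasis_repr_apply, EuclideanSpace.basisFun_repr]
  ring

end Connections

/-! ### Smoothness of derivatives and of bundle homomorphisms -/

section Smoothness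

variable {n : ℕ} {M : Type*} [TopologicalSpace M] [ChartedSpace (Model n) M]
  [IsManifold (𝓡 n) ∞ M]

/-- The derivative of a smooth function along a smooth vector field is smooth, up to the
boundary. -/
lemma contMDiffOn_mvfderivWithin {E : Type*} [NormedAddCommGroup E] [NormedSpace ℝ E]
    {h : M → E} {Y : VField n M} {s : Set M}
    (hs : UniqueMDiffOn (𝓡 n) s) (hh : ContMDiffOn (𝓡 n) 𝓘(ℝ, E) ∞ h s)
    (hY : SmoothFieldOn Y s) :
    ContMDiffOn (𝓡 n) 𝓘(ℝ, E) ∞ (fun y ↦ mvfderivWithin (𝓡 n) h s y (Y y)) s := by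
  -- The derivative along `Y` is the fibre component of the tangent map of `h` composed with the
  -- section `Y`.
  have h1 := hh.contMDiffOn_tangentMapWithin (m := ∞) le_rfl hs
  have h2 : ContMDiffOn (𝓡 n) (𝓘(ℝ, E).tangent) ∞
      (fun y ↦ tangentMapWithin (𝓡 n) 𝓘(ℝ, E) h s ⟨y, Y y⟩) s :=
    h1.comp hY fun y hy ↦ hy
  have h3 := (contMDiff_snd_tangentBundle_modelSpace E 𝓘(ℝ, E) (n := ∞)).comp_contMDiffOn h2
  exact h3

lemma contMDiffOn_mvfderiv {E : Type*} [NormedAddCommGroup E] [NormedSpace ℝ E]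
    {h : M → E} {Y : VField n M} {s : Set M} (hs : IsOpen s)
    (hh : ContMDiffOn (𝓡 n) 𝓘(ℝ, E) ∞ h s) (hY : SmoothFieldOn Y s) :
    ContMDiffOn (𝓡 n) 𝓘(ℝ, E) ∞ (fun y ↦ mvfderiv (𝓡 n) h y (Y y)) s := by
  refine (contMDiffOn_mvfderivWithin hs.uniqueMDiffOn hh hY).congr fun y hy ↦ ?_
  have : mfderivWithin (𝓡 n) 𝓘(ℝ, E) h s y = mfderiv (𝓡 n) 𝓘(ℝ, E) h y :=
    mfderivWithin_of_isOpen hs hy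
  rw [mvfderivWithin, this]
  rfl

/-- A section of a bundle of homomorphisms is smooth if it is smooth on the coordinate frame. -/
lemma contMDiffAt_hom_of_frame {F : Type*} [NormedAddCommGroup F] [NormedSpace ℝ F]
    {V : M → Type*} [TopologicalSpace (TotalSpace F V)] [∀ x, AddCommGroup (V x)]
    [∀ x, Module ℝ (V x)] [∀ x, TopologicalSpace (V x)] [∀ x, IsTopologicalAddGroup (V x)]
    [∀ x, ContinuousSMul ℝ (V x)] [FiberBundle F V] [VectorBundle ℝ F V]
    {A : (x : M) → TangentSpace (𝓡 n) x →L[ℝ] V x} {x : M}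
    (h : ∀ k, ContMDiffAt (𝓡 n) ((𝓡 n).prod 𝓘(ℝ, F)) ∞
      (fun y ↦ TotalSpace.mk' F y (A y (frame x k y))) x) :
    ContMDiffAt (𝓡 n) ((𝓡 n).prod 𝓘(ℝ, Model n →L[ℝ] F)) ∞
      (fun y ↦ TotalSpace.mk' (Model n →L[ℝ] F) (E := fun y : M ↦ TangentSpace (𝓡 n) y →L[ℝ] V y)
        y (A y)) x := by
  rw [contMDiffAt_hom_bundle]
  refine ⟨contMDiffAt_id, ?_⟩
  have h1 : ∀ k, ContMDiffAt (𝓡 n) 𝓘(ℝ, F) ∞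
      (fun y ↦ (trivializationAt F V x ⟨y, A y (frame x k y)⟩).2) x := fun k ↦
    ((contMDiffAt_totalSpace (F := F) (E := V)).1 (h k)).2
  -- In the trivializations, `A y` is the sum over `k` of the `k`-th coordinate function times the
  -- components of `A y` on the `k`-th frame field.
  have h2 : ContMDiffAt (𝓡 n) 𝓘(ℝ, Model n →L[ℝ] F) ∞ (fun y ↦ ∑ k,
      ContinuousLinearMap.smulRightL ℝ (Model n) F (EuclideanSpace.proj k)
        (trivializationAt F V x ⟨y, A y (frame x k y)⟩).2) x := by
    refine ContMDiffAt.sum fun k _ ↦ ?_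
    exact ((ContinuousLinearMap.smulRightL ℝ (Model n) F
      (EuclideanSpace.proj k)).contMDiff.contMDiffAt).comp x (h1 k)
  refine h2.congr_of_eventuallyEq ?_
  filter_upwards [chart_source_mem_nhds (n := n) (mem_chart_source _ x),
    (trivializationAt F V x).open_baseSet.mem_nhds (mem_baseSet_trivializationAt F V x)]
    with y hy hy'
  ext v
  rw [ContinuousLinearMap.inCoordinates_eq hy hy']
  have h3 : (trivializationAt (Model n) (TangentSpace (𝓡 n)) x).symmL ℝ y v =
      ∑ k, v k • frame x k y := constField_eq_sum x v y
  have h4 (u : TangentSpace (𝓡 n) y) :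
      (trivializationAt F V x).continuousLinearEquivAt ℝ y hy' (A y u) =
        (trivializationAt F V x ⟨y, A y u⟩).2 := rfl
  have h5 : (((trivializationAt F V x).continuousLinearEquivAt ℝ y hy' : V y →L[ℝ] F) ∘L
      A y) ((trivializationAt (Model n) (TangentSpace (𝓡 n)) x).symmL ℝ y v) =
      ∑ k, v k • (trivializationAt F V x ⟨y, A y (frame x k y)⟩).2 := by
    rw [h3, map_sum]
    refine Finset.sum_congr rfl fun k _ ↦ ?_
    rw [map_smul]
    rfl
  refine Eq.trans ?_ (h5.trans ?_)
  · rw [← Trivialization.symm_continuousLinearEquivAt_eq _ hy]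
    rfl
  · rw [sum_apply]
    rfl

end Smoothness

/-! ### Smoothness and signs of density coefficients -/

section Densities

variable {n : ℕ} {M : Type*} [TopologicalSpace M] [ChartedSpace (Model n) M]
  [IsManifold (𝓡 n) ∞ M]

lemma contDiffAt_abs_det_rpow (L : Model n →L[ℝ] Model n) (h0 : L.det ≠ 0) (κ : ℝ) :
    ContDiffAt ℝ ∞ (fun L : Model n →L[ℝ] Model n ↦ |L.det| ^ κ) L := by
  have h1 : ContDiff ℝ ∞ (fun L : Model n →L[ℝ] Model n ↦ L.det) := by
    let b := (EuclideanSpace.basisFun (Fin n) ℝ).toBasis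
    let f : ContinuousMultilinearMap ℝ (fun _ : Fin n ↦ Model n) ℝ :=
      ⟨b.det.toMultilinearMap, continuous_basis_det b⟩
    let ev : (Model n →L[ℝ] Model n) →L[ℝ] (Fin n → Model n) :=
      ContinuousLinearMap.pi fun i ↦ ContinuousLinearMap.apply ℝ (Model n) (b i)
    have h2 : (fun L : Model n →L[ℝ] Model n ↦ L.det) = f ∘ ev := by
      funext L
      have := b.det_comp (L : Model n →ₗ[ℝ] Model n) b
      rw [b.det_self, mul_one] at this
      exact this.symm
    rw [h2]
    exact f.contDiff.comp ev.contDiff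
  exact ((contDiffAt_abs h0).comp L h1.contDiffAt).rpow_const_of_ne (abs_ne_zero.2 h0)

instance isContMDiff_densityCore (w : ℝ) : (densityCore n M w).IsContMDiff (𝓡 n) ∞ := by
  refine ⟨fun i j x hx ↦ ?_⟩
  have : (tangentBundleCore (𝓡 n) M).IsContMDiff (𝓡 n) ∞ :=
    tangentBundleCore.isContMDiff (h := (inferInstance : IsManifold (𝓡 n) ∞ M))
  have h1 := (tangentBundleCore (𝓡 n) M).contMDiffOn_coordChange (n := ∞) (𝓡 n) i j x hx
  have h2 := (contDiffAt_abs_det_rpow _ (det_tangent_coordChange_ne_zero n M i j x hx)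
    (w / ((n : ℝ) + 1))).contMDiffAt.comp_contMDiffWithinAt x h1
  exact h2.smul contMDiffWithinAt_const

lemma contMDiffOn_dcoef {w : ℝ} (σ : Density n M w) (x : M) :
    ContMDiffOn (𝓡 n) 𝓘(ℝ, ℝ) ∞ (dcoef x σ) (chartAt (Model n) x).source :=
  (((trivializationAt ℝ (DensityBundle n M w) x).contMDiffOn_section_baseSet_iff
    (IB := 𝓡 n) (n := ∞) (s := σ)).1 σ.contMDiff.contMDiffOn)

lemma mdifferentiableAt_dcoef {w : ℝ} (σ : Density n M w) {x y : M}
    (hx : y ∈ (chartAt (Model n) x).source) :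
    MDifferentiableAt (𝓡 n) 𝓘(ℝ, ℝ) (dcoef x σ) y :=
  ((contMDiffOn_dcoef σ x).contMDiffAt (chart_source_mem_nhds hx)).mdifferentiableAt (by simp)

lemma dcoef_eq_zero_iff {w : ℝ} (σ : (x : M) → DensityBundle n M w x) {x y : M}
    (hx : y ∈ (chartAt (Model n) x).source) : dcoef x σ y = 0 ↔ dval σ y = 0 := by
  rw [dcoef_eq, mul_eq_zero, or_iff_right (dfactor_pos w (mem_chart_source _ y) hx).ne']

lemma dcoef_pos_iff {w : ℝ} (σ : (x : M) → DensityBundle n M w x) {x y : M}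
    (hx : y ∈ (chartAt (Model n) x).source) : 0 < dcoef x σ y ↔ 0 < dval σ y := by
  rw [dcoef_eq, mul_pos_iff_of_pos_left (dfactor_pos w (mem_chart_source _ y) hx)]

end Densities

/-! ### Smoothness of connections in local frames -/

section Connections

variable {n : ℕ} {M : Type*} [TopologicalSpace M] [ChartedSpace (Model n) M]
  [IsManifold (𝓡 n) ∞ M]

variable [T2Space M]

/-- A smooth connection maps vector fields which are smooth near a point to sections which are
smooth near this point. -/
lemma contMDiffAt_conn {D : ConnOp n M} (hD : IsAffineConnectionOn D univ) {Y : VField n M}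
    {s : Set M} (hs : IsOpen s) (hY : SmoothFieldOn Y s) {y : M} (hy : y ∈ s) :
    ContMDiffAt (𝓡 n) ((𝓡 n).prod 𝓘(ℝ, Model n →L[ℝ] Model n)) ∞
      (fun z ↦ (TotalSpace.mk' (Model n →L[ℝ] Model n)
        (E := fun z : M ↦ TangentSpace (𝓡 n) z →L[ℝ] TangentSpace (𝓡 n) z) z (D Y z))) y := by
  -- Smoothness of `D` on `univ` concerns globally smooth fields. A bump function supported in `s`
  -- makes `Y` global without changing it near `y`.
  obtain ⟨ψ, -, hψ⟩ := (SmoothBumpFunction.nhds_basis_tsupport (I := 𝓡 n) y).mem_iff.1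
    (hs.mem_nhds hy)
  have h1 : ContMDiff (𝓡 n) ((𝓡 n).prod 𝓘(ℝ, Model n)) ∞
      (fun z ↦ TotalSpace.mk' (Model n) z (((ψ : M → ℝ) • Y) z)) :=
    ContMDiffOn.smul_section_of_tsupport ψ.contMDiff.contMDiffOn hs hψ hY
  have h2 := hD.smooth.contMDiff (σ := (ψ : M → ℝ) • Y) h1.contMDiffOn
  refine (h2.contMDiffAt Filter.univ_mem).congr_of_eventuallyEq ?_
  filter_upwards [ψ.eventuallyEq_one.eventually_nhds, hs.mem_nhds hy] with z hz hzs
  have h3 : D Y z = D ((ψ : M → ℝ) • Y) z := by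
    refine hD.isCovariantDerivativeOn.congr_of_eventuallyEq (hY.diffAt (hs.mem_nhds hzs))
      (h1.mdifferentiableAt (by simp)) Filter.univ_mem ?_
    filter_upwards [hz] with t ht
    simp [ht]
  rw [h3]

lemma contMDiffAt_conn_apply {D : ConnOp n M} (hD : IsAffineConnectionOn D univ)
    {Y Z : VField n M} {s t : Set M} (hs : IsOpen s) (hY : SmoothFieldOn Y s) {y : M} (hy : y ∈ s)
    (hZ : ContMDiffWithinAt (𝓡 n) ((𝓡 n).prod 𝓘(ℝ, Model n)) ∞
      (fun x ↦ (TotalSpace.mk' (Model n) x (Z x) : TangentBundle (𝓡 n) M)) t y) :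
    ContMDiffWithinAt (𝓡 n) ((𝓡 n).prod 𝓘(ℝ, Model n)) ∞
      (fun z ↦ (TotalSpace.mk' (Model n) z (D Y z (Z z)) : TangentBundle (𝓡 n) M)) t y :=
  (contMDiffAt_conn hD hs hY hy).contMDiffWithinAt.clm_bundle_apply hZ

lemma contMDiffWithinAt_ctrace {D : ConnOp n M} (hD : IsAffineConnectionOn D univ) {x y : M}
    (hx : y ∈ (chartAt (Model n) x).source) {Z : VField n M} {t : Set M}
    (hZ : ContMDiffWithinAt (𝓡 n) ((𝓡 n).prod 𝓘(ℝ, Model n)) ∞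
      (fun x ↦ (TotalSpace.mk' (Model n) x (Z x) : TangentBundle (𝓡 n) M)) t y) :
    ContMDiffWithinAt (𝓡 n) 𝓘(ℝ, ℝ) ∞ (fun z ↦ ctrace D x z (Z z)) t y := by
  simp only [ctrace_apply]
  refine ContMDiffWithinAt.sum fun k _ ↦ ?_
  have h1 := (contMDiffWithinAt_tcoord_iff (r := ⊤) hx).1
    (contMDiffAt_conn_apply hD (chartAt (Model n) x).open_source
      (contMDiffOn_constField x (EuclideanSpace.single k 1)) hx hZ)
  exact ((EuclideanSpace.proj k : Model n →L[ℝ] ℝ).contMDiff.contMDiffAt).comp_contMDiffWithinAt y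
    h1

end Connections

/-! ### Partial derivatives and brackets of coordinate fields -/

section ChartDerivative

variable {n : ℕ} {M : Type*} [TopologicalSpace M] [ChartedSpace (Model n) M]
  [IsManifold (𝓡 n) ∞ M]

lemma constField_eq_mfderiv {x y : M} (hy : y ∈ (chartAt (Model n) x).source) (v : Model n) :
    constField x v y = mfderiv 𝓘(ℝ, Model n) (𝓡 n) (extChartAt (𝓡 n) x).symm
      (extChartAt (𝓡 n) x y) v := by
  have h := TangentBundle.symmL_trivializationAt (I := 𝓡 n) (x₀ := x) (x := y) hy
  have h2 := DFunLike.congr_fun h v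
  rw [ModelWithCorners.range_eq_univ, mfderivWithin_univ] at h2
  exact h2

/-- The derivative of a function along a coordinate field is a partial derivative in the chart. -/
lemma mvfderiv_constField {E : Type*} [NormedAddCommGroup E] [NormedSpace ℝ E] {h : M → E}
    {x y : M} (hy : y ∈ (chartAt (Model n) x).source) (hh : MDifferentiableAt (𝓡 n) 𝓘(ℝ, E) h y)
    (v : Model n) :
    mvfderiv (𝓡 n) h y (constField x v y) =
      fderiv ℝ (h ∘ (extChartAt (𝓡 n) x).symm) (extChartAt (𝓡 n) x y) v := by
  have hy' : y ∈ (extChartAt (𝓡 n) x).source := by rwa [extChartAt_source]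
  have hz := (extChartAt (𝓡 n) x).map_source hy'
  have hs : MDifferentiableAt 𝓘(ℝ, Model n) (𝓡 n) (extChartAt (𝓡 n) x).symm
      (extChartAt (𝓡 n) x y) := by
    have := mdifferentiableWithinAt_extChartAt_symm (I := 𝓡 n) hz
    rwa [ModelWithCorners.range_eq_univ, mdifferentiableWithinAt_univ] at this
  have hl := (extChartAt (𝓡 n) x).left_inv hy'
  have h1 := mfderiv_comp_apply_of_eq (I := 𝓘(ℝ, Model n)) (I' := 𝓡 n) (I'' := 𝓘(ℝ, E))
    (g := h) _ hh hs hl v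
  rw [constField_eq_mfderiv hy, ← mfderiv_eq_fderiv]
  exact h1.symm

lemma lieBracketWithin_eq_zero_of_eventuallyEq_const {E : Type*} [NormedAddCommGroup E]
    [NormedSpace ℝ E] {V W : E → E} {v w z : E} {s : Set E} (hV : V =ᶠ[𝓝 z] fun _ ↦ v)
    (hW : W =ᶠ[𝓝 z] fun _ ↦ w) : VectorField.lieBracketWithin ℝ V W s z = 0 := by
  rw [Filter.EventuallyEq.lieBracketWithin_vectorField_eq (hV.filter_mono nhdsWithin_le_nhds)
    hV.eq_of_nhds (hW.filter_mono nhdsWithin_le_nhds) hW.eq_of_nhds]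
  simp [VectorField.lieBracketWithin]

/-- In the chart at `x` both fields are constant near the image of `x`. -/
lemma mlieBracket_constField (x : M) (v w : Model n) :
    VectorField.mlieBracket (𝓡 n) (constField x v) (constField x w) x = 0 := by
  have h (v : Model n) : (VectorField.mpullbackWithin 𝓘(ℝ, Model n) (𝓡 n)
      (extChartAt (𝓡 n) x).symm (constField x v) (range (𝓡 n))) =ᶠ[𝓝 (extChartAt (𝓡 n) x x)]
        fun _ ↦ v := by
    filter_upwards [extChartAt_target_mem_nhds (I := 𝓡 n) x] with z hz
    have hy := (extChartAt (𝓡 n) x).map_target hz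
    have hy' := hy
    rw [extChartAt_source] at hy'
    rw [VectorField.mpullbackWithin, constField_eq_mfderiv hy', (extChartAt (𝓡 n) x).right_inv hz,
      ModelWithCorners.range_eq_univ, mfderivWithin_univ]
    have hi := isInvertible_mfderivWithin_extChartAt_symm (I := 𝓡 n) hz
    rw [ModelWithCorners.range_eq_univ, mfderivWithin_univ] at hi
    exact hi.inverse_apply_eq.2 rfl
  rw [← VectorField.mlieBracketWithin_univ, VectorField.mlieBracketWithin_apply]
  have h0 := lieBracketWithin_eq_zero_of_eventuallyEq_const
    (s := (extChartAt (𝓡 n) x).symm ⁻¹' univ ∩ range (𝓡 n)) (h v) (h w)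
  exact (congrArg _ h0).trans (map_zero _)

/-- The second partial derivatives of a smooth function commute. -/
lemma mvfderiv_mvfderiv_constField_comm {f : M → ℝ} {x : M}
    (hf : ContMDiffOn (𝓡 n) 𝓘(ℝ, ℝ) ∞ f (chartAt (Model n) x).source) (v w : Model n) :
    mvfderiv (𝓡 n) (fun z ↦ mvfderiv (𝓡 n) f z (constField x w z)) x (constField x v x) =
      mvfderiv (𝓡 n) (fun z ↦ mvfderiv (𝓡 n) f z (constField x v z)) x (constField x w x) := by
  have hx := mem_chart_source (Model n) x
  set F : Model n → ℝ := f ∘ (extChartAt (𝓡 n) x).symm with hF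
  have hFs : ContDiffAt ℝ ∞ F (extChartAt (𝓡 n) x x) := by
    have h := (contMDiffAt_iff.1 (hf.contMDiffAt (chart_source_mem_nhds hx))).2
    rw [ModelWithCorners.range_eq_univ, contDiffWithinAt_univ] at h
    exact h
  have hFd : DifferentiableAt ℝ (fderiv ℝ F) (extChartAt (𝓡 n) x x) :=
    (hFs.fderiv_right (m := ∞) (by simp)).differentiableAt (by simp)
  have key (v w : Model n) :
      mvfderiv (𝓡 n) (fun z ↦ mvfderiv (𝓡 n) f z (constField x w z)) x (constField x v x) =
        fderiv ℝ (fderiv ℝ F) (extChartAt (𝓡 n) x x) v w := by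
    rw [mvfderiv_constField hx]
    · have h : (fun z ↦ mvfderiv (𝓡 n) f z (constField x w z)) ∘ (extChartAt (𝓡 n) x).symm
          =ᶠ[𝓝 (extChartAt (𝓡 n) x x)] fun z ↦ fderiv ℝ F z w := by
        filter_upwards [extChartAt_target_mem_nhds (I := 𝓡 n) x] with z hz
        have hy := (extChartAt (𝓡 n) x).map_target hz
        rw [extChartAt_source] at hy
        rw [Function.comp_apply, mvfderiv_constField hy
          ((hf.contMDiffAt (chart_source_mem_nhds hy)).mdifferentiableAt (by simp)),
          (extChartAt (𝓡 n) x).right_inv hz]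
      rw [h.fderiv_eq, fderiv_clm_apply hFd (differentiableAt_const _)]
      simp
    · exact ((contMDiffOn_mvfderiv (chartAt (Model n) x).open_source hf
        (contMDiffOn_constField x w)).contMDiffAt (chart_source_mem_nhds hx)).mdifferentiableAt
          (by simp)
  rw [key, key]
  exact (hFs.isSymmSndFDerivAt (by
    rw [minSmoothness_of_isRCLikeNormedField]
    exact WithTop.coe_le_coe.2 (le_top (a := (2 : ℕ∞))))) v w

end ChartDerivative

/-! ### The second covariant derivative at a zero of a density -/

section Hessian

variable {n : ℕ} {M : Type*} [TopologicalSpace M] [ChartedSpace (Model n) M]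
  [IsManifold (𝓡 n) ∞ M]

lemma mvfderiv_sum_apply {ι : Type*} (t : Finset ι) {h : ι → M → ℝ} {y : M}
    (hh : ∀ i ∈ t, MDifferentiableAt (𝓡 n) 𝓘(ℝ, ℝ) (h i) y) (u : TangentSpace (𝓡 n) y) :
    MDifferentiableAt (𝓡 n) 𝓘(ℝ, ℝ) (fun z ↦ ∑ i ∈ t, h i z) y ∧
    mvfderiv (𝓡 n) (fun z ↦ ∑ i ∈ t, h i z) y u = ∑ i ∈ t, mvfderiv (𝓡 n) (h i) y u := by
  classical
  induction t using Finset.induction_on with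
  | empty =>
    simp only [Finset.sum_empty]
    refine ⟨mdifferentiableAt_const, ?_⟩
    rw [mvfderiv_const]
    rfl
  | insert a t ha ih =>
    obtain ⟨h1, h2⟩ := ih fun i hi ↦ hh i (Finset.mem_insert_of_mem hi)
    have h3 := hh a (Finset.mem_insert_self a t)
    simp only [Finset.sum_insert ha]
    refine ⟨h3.add h1, ?_⟩
    rw [← h2]
    exact DFunLike.congr_fun (mvfderiv_add h3 h1) u

/-- The one-form `u ↦ (∇df)(u, e_k)`, with `e_k` the coordinate frame of the chart at `x`. -/
def hesscoef (D : ConnOp n M) (x : M) (f : M → ℝ) (k : Fin n) (y : M) :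
    TangentSpace (𝓡 n) y →L[ℝ] ℝ :=
  mvfderiv (𝓡 n) (fun z ↦ mvfderiv (𝓡 n) f z (frame x k z)) y -
    (mvfderiv (𝓡 n) f y) ∘L D (frame x k) y

lemma hesscoef_apply (D : ConnOp n M) (x : M) (f : M → ℝ) (k : Fin n) (y : M)
    (u : TangentSpace (𝓡 n) y) : hesscoef D x f k y u =
      mvfderiv (𝓡 n) (fun z ↦ mvfderiv (𝓡 n) f z (frame x k z)) y u -
        mvfderiv (𝓡 n) f y (D (frame x k) y u) := rfl

/-- `∇df` is tensorial. -/
lemma mvfderiv_mvfderiv_sub {D : ConnOp n M} {s : Set M}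
    (hD : IsCovariantDerivativeOn (Model n) D s) {x y : M} (hs : s ∈ 𝓝 y)
    (hx : y ∈ (chartAt (Model n) x).source) {f : M → ℝ}
    (hf : ContMDiffOn (𝓡 n) 𝓘(ℝ, ℝ) ∞ f (chartAt (Model n) x).source)
    {V : VField n M} (hV : DiffFieldAt V y) (u : TangentSpace (𝓡 n) y) :
    mvfderiv (𝓡 n) (fun z ↦ mvfderiv (𝓡 n) f z (V z)) y u - mvfderiv (𝓡 n) f y (D V y u) =
      ∑ k, tcoord x y (V y) k * hesscoef D x f k y u := by
  have hc := (diffFieldAt_iff_tcoord hx).1 hV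
  let pr (k : Fin n) : Model n →L[ℝ] ℝ := EuclideanSpace.proj k
  have hk (k : Fin n) : MDifferentiableAt (𝓡 n) 𝓘(ℝ, ℝ) (fun z ↦ tcoord x z (V z) k) y :=
    mdifferentiableAt_comp_hasFDerivAt hc (pr k).hasFDerivAt
  have hk' (k : Fin n) : MDifferentiableAt (𝓡 n) 𝓘(ℝ, ℝ)
      (fun z ↦ mvfderiv (𝓡 n) f z (frame x k z)) y :=
    ((contMDiffOn_mvfderiv (chartAt (Model n) x).open_source hf
        (contMDiffOn_constField x _)).contMDiffAt (chart_source_mem_nhds hx)).mdifferentiableAt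
          (by simp)
  have h1 : mvfderiv (𝓡 n) (fun z ↦ mvfderiv (𝓡 n) f z (V z)) y u =
      ∑ k, (tcoord x y (V y) k * mvfderiv (𝓡 n) (fun z ↦ mvfderiv (𝓡 n) f z (frame x k z)) y u
        + mvfderiv (𝓡 n) f y (frame x k y) *
          mvfderiv (𝓡 n) (fun z ↦ tcoord x z (V z)) y u k) := by
    have h2 : ∀ᶠ z in 𝓝 y, mvfderiv (𝓡 n) f z (V z) =
        ∑ k, tcoord x z (V z) k * mvfderiv (𝓡 n) f z (frame x k z) := by
      filter_upwards [chart_source_mem_nhds hx] with z hz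
      conv_lhs => rw [eq_sum_frame hz (V z), map_sum]
      simp
    rw [mvfderiv_congr h2]
    refine (mvfderiv_sum_apply _ (fun k _ ↦ (hk k).mul (hk' k)) u).2.trans ?_
    refine Finset.sum_congr rfl fun k _ ↦ ?_
    refine (mvfderiv_mul_apply (hk k) (hk' k) u).trans ?_
    have h3 := mvfderiv_clm hc (pr k) u
    exact congrArg₂ _ rfl (congrArg _ h3)
  -- The derivatives of the components of `V` occur in both terms and cancel.
  rw [h1, conn_apply hD hs hx hV, map_add, map_sum, constField_eq_sum, map_sum,
    Finset.sum_add_distrib]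
  simp only [map_smul, smul_eq_mul, hesscoef_apply, mul_sub, Finset.sum_sub_distrib]
  have h4 : ∑ k, mvfderiv (𝓡 n) f y (frame x k y) *
      mvfderiv (𝓡 n) (fun z ↦ tcoord x z (V z)) y u k =
      ∑ k, mvfderiv (𝓡 n) (fun z ↦ tcoord x z (V z)) y u k *
        mvfderiv (𝓡 n) f y (frame x k y) := by simp only [mul_comm]
  rw [h4]
  ring

lemma contMDiffOn_extendField {x : M} (v : TangentSpace (𝓡 n) x) :
    SmoothFieldOn (extendField v) (chartAt (Model n) x).source :=
  (contMDiffOn_constField x v).congr fun y hy ↦ by rw [extendField_apply hy]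

/-- The second covariant derivative of a density at its zeros, in terms of the coefficient of the
density in a chart. -/
lemma densityDeriv_densityDeriv_chart [T2Space M] {w : ℝ} {D : ConnOp n M}
    (hD : IsAffineConnectionOn D univ) (σ : Density n M w) {x y : M}
    (hx : y ∈ (chartAt (Model n) x).source) (hσ : dval σ y = 0)
    {V : VField n M} {s : Set M} (hs : IsOpen s) (hy : y ∈ s) (hV : SmoothFieldOn V s)
    (u : TangentSpace (𝓡 n) y) :
    dfactor (n := n) w y x y * (densityDeriv (w := w) D
        (fun z ↦ (densityDeriv D σ z (V z) : ℝ)) y u - densityDeriv D σ y (D V y u)) =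
      ∑ k, tcoord x y (V y) k * hesscoef D x (dcoef x σ) k y u + w / ((n : ℝ) + 1) *
        (mvfderiv (𝓡 n) (dcoef x σ) y u * ctrace D x y (V y) +
          mvfderiv (𝓡 n) (dcoef x σ) y (V y) * ctrace D x y u) := by
  have hD' := hD.isCovariantDerivativeOn
  have hσ0 : dcoef x σ y = 0 := (dcoef_eq_zero_iff _ hx).2 hσ
  have hsm := contMDiffOn_dcoef σ x
  have hVy := hV.diffAt (hs.mem_nhds hy)
  set s' : (z : M) → DensityBundle n M w z := fun z ↦ (densityDeriv D σ z (V z) : ℝ) with hs'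
  have hsz : ∀ z ∈ (chartAt (Model n) x).source, dcoef x s' z =
      mvfderiv (𝓡 n) (dcoef x σ) z (V z) +
        (w / ((n : ℝ) + 1) * dcoef x σ z) * ctrace D x z (V z) := fun z hz ↦
    densityDeriv_chart hD' Filter.univ_mem hz (mdifferentiableAt_dcoef σ hz) (V z)
  have hd1 : MDifferentiableAt (𝓡 n) 𝓘(ℝ, ℝ)
      (fun z ↦ mvfderiv (𝓡 n) (dcoef x σ) z (V z)) y :=
    ((contMDiffOn_mvfderiv ((chartAt (Model n) x).open_source.inter hs)
      (hsm.mono inter_subset_left) (hV.mono inter_subset_right)).contMDiffAt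
        (Filter.inter_mem (chart_source_mem_nhds hx) (hs.mem_nhds hy))).mdifferentiableAt (by simp)
  have hd2 : MDifferentiableAt (𝓡 n) 𝓘(ℝ, ℝ) (fun z ↦ ctrace D x z (V z)) y := by
    have h := contMDiffWithinAt_ctrace hD hx (t := univ) (Z := V)
      ((hV.contMDiffAt (hs.mem_nhds hy)).contMDiffWithinAt)
    exact (contMDiffWithinAt_univ.1 h).mdifferentiableAt (by simp)
  have hd3 : MDifferentiableAt (𝓡 n) 𝓘(ℝ, ℝ) (fun z ↦ w / ((n : ℝ) + 1) * dcoef x σ z) y :=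
    mdifferentiableAt_const.mul (mdifferentiableAt_dcoef σ hx)
  have hev : ∀ᶠ z in 𝓝 y, dcoef x s' z = mvfderiv (𝓡 n) (dcoef x σ) z (V z) +
        (w / ((n : ℝ) + 1) * dcoef x σ z) * ctrace D x z (V z) := by
    filter_upwards [chart_source_mem_nhds hx] with z hz using hsz z hz
  have hs'd : MDifferentiableAt (𝓡 n) 𝓘(ℝ, ℝ) (dcoef x s') y :=
    (hd1.add (hd3.mul hd2)).congr_of_eventuallyEq hev
  have hs'1 : mvfderiv (𝓡 n) (dcoef x s') y u =
      mvfderiv (𝓡 n) (fun z ↦ mvfderiv (𝓡 n) (dcoef x σ) z (V z)) y u +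
        w / ((n : ℝ) + 1) * mvfderiv (𝓡 n) (dcoef x σ) y u * ctrace D x y (V y) := by
    rw [mvfderiv_congr hev]
    have h1 := DFunLike.congr_fun (mvfderiv_add hd1 (hd3.mul hd2)) u
    refine h1.trans ?_
    rw [add_apply]
    congr 1
    refine (mvfderiv_mul_apply hd3 hd2 u).trans ?_
    -- Since `σ` vanishes at `y`, the derivative of the contracted Christoffel symbols drops out.
    rw [hσ0, mul_zero, zero_mul, zero_add]
    have h2 := mvfderiv_clm (mdifferentiableAt_dcoef σ hx)
      ((w / ((n : ℝ) + 1)) • ContinuousLinearMap.id ℝ ℝ) u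
    rw [mul_comm]
    exact congrArg₂ _ h2 rfl
  rw [mul_sub, densityDeriv_chart hD' Filter.univ_mem hx hs'd u,
    densityDeriv_chart hD' Filter.univ_mem hx (mdifferentiableAt_dcoef σ hx), hs'1, hsz y hx, hσ0,
    ← mvfderiv_mvfderiv_sub hD' Filter.univ_mem hx hsm hVy u]
  ring

/-- The expression of the form `∇∇σ`, at a zero of a density of weight `w`, in the chart at `x`;
here `f` is the coefficient of `σ`. -/
def hessForm (w : ℝ) (D : ConnOp n M) (x : M) (f : M → ℝ) (y : M) :
    LinearMap.BilinForm ℝ (TangentSpace (𝓡 n) y) :=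
  LinearMap.mk₂ ℝ (fun u v ↦ ∑ k, tcoord x y v k * hesscoef D x f k y u + w / ((n : ℝ) + 1) *
      (mvfderiv (𝓡 n) f y u * ctrace D x y v + mvfderiv (𝓡 n) f y v * ctrace D x y u))
    (by intro u u' v; simp only [map_add, mul_add, Finset.sum_add_distrib]; ring)
    (by
      intro c u v
      simp only [map_smul, smul_eq_mul, mul_add, Finset.mul_sum]
      congr 1
      · exact Finset.sum_congr rfl fun k _ ↦ by ring
      · ring)
    (by
      intro u v v'
      simp only [map_add, PiLp.add_apply, add_mul, Finset.sum_add_distrib]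
      ring)
    (by
      intro c u v
      simp only [map_smul, PiLp.smul_apply, smul_eq_mul, mul_add, Finset.mul_sum]
      congr 1
      · exact Finset.sum_congr rfl fun k _ ↦ by ring
      · ring)

lemma hessForm_apply (w : ℝ) (D : ConnOp n M) (x : M) (f : M → ℝ) (y : M)
    (u v : TangentSpace (𝓡 n) y) : hessForm w D x f y u v =
      ∑ k, tcoord x y v k * hesscoef D x f k y u + w / ((n : ℝ) + 1) *
      (mvfderiv (𝓡 n) f y u * ctrace D x y v + mvfderiv (𝓡 n) f y v * ctrace D x y u) := rfl

lemma toBilin_basis {V ι : Type*} [AddCommGroup V] [Module ℝ V] [Fintype ι] [DecidableEq ι]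
    (b : Module.Basis ι ℝ V) (A : Matrix ι ι ℝ) (i j : ι) :
    Matrix.toBilin b A (b i) (b j) = A i j := by
  conv_rhs => rw [← LinearMap.BilinForm.toMatrix_toBilin b A]
  rw [LinearMap.BilinForm.toMatrix_apply]

/-- The definition of `hessian` at `y` uses the preferred chart at `y`, which need not vary
continuously with `y`. Up to the transition factor, the right side lives in one chart, where
smoothness in `y` can be read off. Both sides are bilinear, so the coordinate basis at `y` suffices.
-/
theorem hessian_chart [T2Space M] {w : ℝ} {D : ConnOp n M} (hD : IsAffineConnectionOn D univ)
    (σ : Density n M w) {x y : M} (hx : y ∈ (chartAt (Model n) x).source) (hσ : dval σ y = 0) :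
    dfactor (n := n) w y x y • hessian D σ y = hessForm w D x (dcoef x σ) y := by
  refine LinearMap.BilinForm.ext_basis (coordBasis y) fun i j ↦ ?_
  have hy := mem_chart_source (Model n) y
  have h := densityDeriv_densityDeriv_chart hD σ hx hσ (chartAt (Model n) y).open_source hy
    (contMDiffOn_extendField (coordBasis y j)) (coordBasis y i)
  have h1 : extendField (coordBasis y j) y = coordBasis y j := by
    rw [extendField_apply hy]
    exact constField_self y _
  rw [h1] at h
  rw [hessForm_apply, ← h, LinearMap.smul_apply, LinearMap.smul_apply, smul_eq_mul]
  exact congrArg _ (toBilin_basis (coordBasis y) _ i j)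

/-- Coordinate fields have zero bracket, so absence of torsion makes the Christoffel symbols
symmetric; the second partial derivatives commute. -/
lemma hesscoef_symm {D : ConnOp n M} (hD : IsAffineConnectionOn D univ) {f : M → ℝ} {x : M}
    (hf : ContMDiffOn (𝓡 n) 𝓘(ℝ, ℝ) ∞ f (chartAt (Model n) x).source) (i k : Fin n) :
    hesscoef D x f k x (frame x i x) = hesscoef D x f i x (frame x k x) := by
  have hx := mem_chart_source (Model n) x
  have h1 := hD.torsionFree (frame x i) (frame x k) x (mem_univ x)
    (diffFieldAt_constField hx _) (diffFieldAt_constField hx _)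
  rw [mlieBracket_constField, sub_eq_zero] at h1
  rw [hesscoef_apply, hesscoef_apply, h1, mvfderiv_mvfderiv_constField_comm hf]

/-- `∇∇σ` is symmetric at the zeros of `σ`. -/
theorem hessian_symm [T2Space M] {w : ℝ} {D : ConnOp n M} (hD : IsAffineConnectionOn D univ)
    (σ : Density n M w) {y : M} (hσ : dval σ y = 0) (u v : TangentSpace (𝓡 n) y) :
    hessian D σ y u v = hessian D σ y v u := by
  have hy := mem_chart_source (Model n) y
  have h := hessian_chart hD σ hy hσ
  have h0 := (dfactor_pos (n := n) w hy hy).ne'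
  have h2 : hessian D σ y = (dfactor (n := n) w y y y)⁻¹ • hessForm w D y (dcoef y σ) y := by
    rw [← h, smul_smul, inv_mul_cancel₀ h0, one_smul]
  rw [h2]
  simp only [LinearMap.smul_apply]
  congr 1
  rw [hessForm_apply, hessForm_apply]
  congr 1
  · have e (u v : TangentSpace (𝓡 n) y) :
        ∑ k, tcoord y y v k * hesscoef D y (dcoef y σ) k y u =
        ∑ k, ∑ i, tcoord y y v k * (tcoord y y u i *
          hesscoef D y (dcoef y σ) k y (frame y i y)) := by
      refine Finset.sum_congr rfl fun k _ ↦ ?_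
      conv_lhs => rw [eq_sum_frame hy u, map_sum, Finset.mul_sum]
      simp only [map_smul, smul_eq_mul]
    rw [e, e, Finset.sum_comm]
    refine Finset.sum_congr rfl fun i _ ↦ Finset.sum_congr rfl fun k _ ↦ ?_
    rw [hesscoef_symm hD (contMDiffOn_dcoef σ y)]
    ring
  · ring

end Hessian

/-! ### Submersions as coordinate functions -/

section AdaptedCharts

variable {n : ℕ}

/-- The map replaces the `i`-th coordinate by `F`. If its derivative kills `v`, the `i`-th component
gives `dF(v) = 0`; then `v` is a multiple of the `i`-th basis vector, on which `dF` is nonzero, so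
`v = 0`. -/
lemma exists_hasFDerivAt_straighten {F : Model n → ℝ} {z : Model n} {i : Fin n}
    (hF : DifferentiableAt ℝ F z) (hi : fderiv ℝ F z (EuclideanSpace.single i 1) ≠ 0) :
    ∃ A : Model n ≃L[ℝ] Model n, HasFDerivAt
      (fun z ↦ z + (F z - z i) • (EuclideanSpace.single i (1 : ℝ) : Model n))
      (A : Model n →L[ℝ] Model n) z := by
  let p : Model n →L[ℝ] ℝ := EuclideanSpace.proj i
  let A : Model n →L[ℝ] Model n := ContinuousLinearMap.id ℝ _ +
    (fderiv ℝ F z - p).smulRight (EuclideanSpace.single i (1 : ℝ))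
  have hA : HasFDerivAt (fun z ↦ z + (F z - z i) • (EuclideanSpace.single i (1 : ℝ) : Model n))
      A z := (hasFDerivAt_id z).add ((hF.hasFDerivAt.sub p.hasFDerivAt).smul_const _)
  have hinj : Function.Injective (A : Model n →ₗ[ℝ] Model n) := by
    rw [← LinearMap.ker_eq_bot, LinearMap.ker_eq_bot']
    intro v hv
    have h1 : v + (fderiv ℝ F z v - v i) • (EuclideanSpace.single i (1 : ℝ) : Model n) = 0 := hv
    have h2 : fderiv ℝ F z v = 0 := by
      have := congrArg (fun w : Model n ↦ w i) h1
      simpa using this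
    rw [h2, zero_sub, neg_smul, ← sub_eq_add_neg, sub_eq_zero] at h1
    rw [h1, map_smul, smul_eq_mul, mul_eq_zero, or_iff_left hi] at h2
    rw [h1, h2, zero_smul]
  refine ⟨(LinearEquiv.ofInjectiveEndo _ hinj).toContinuousLinearEquiv, ?_⟩
  exact hA.congr_fderiv (by ext1 v; rfl)

/-- A function with nonzero derivative is locally a coordinate. -/
lemma exists_openPartialHomeomorph_coord {F : Model n → ℝ} {t : Set (Model n)} (ht : IsOpen t)
    (hF : ContDiffOn ℝ ∞ F t) {z₀ : Model n} (hz₀ : z₀ ∈ t) (h : fderiv ℝ F z₀ ≠ 0) :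
    ∃ ψ : OpenPartialHomeomorph (Model n) (Model n), ∃ i : Fin n, z₀ ∈ ψ.source ∧ ψ.source ⊆ t ∧
      ContDiffOn ℝ ∞ ψ ψ.source ∧ ContDiffOn ℝ ∞ ψ.symm ψ.target ∧
      ∀ z ∈ ψ.source, ψ z i = F z := by
  obtain ⟨i, hi⟩ : ∃ i, fderiv ℝ F z₀ (EuclideanSpace.single i 1) ≠ 0 := by
    by_contra! hall
    refine h (ContinuousLinearMap.ext fun v ↦ ?_)
    rw [eq_sum_single v, map_sum]
    simp [hall]
  let G : Model n → Model n :=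
    fun z ↦ z + (F z - z i) • (EuclideanSpace.single i (1 : ℝ) : Model n)
  let p : Model n →L[ℝ] ℝ := EuclideanSpace.proj i
  have hG : ContDiffOn ℝ ∞ G t :=
    contDiffOn_id.add ((hF.sub p.contDiff.contDiffOn).smul contDiffOn_const)
  -- On `t'` the derivative of `G` is invertible at every point, so the local inverse is smooth on
  -- its whole domain and not only near the image of `z₀`.
  let t' := t ∩ {z | fderiv ℝ F z (EuclideanSpace.single i 1) ≠ 0}
  have ht' : IsOpen t' := by
    have hc : ContinuousOn (fun z ↦ fderiv ℝ F z (EuclideanSpace.single i 1)) t :=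
      (hF.continuousOn_fderiv_of_isOpen ht (by simp)).clm_apply continuousOn_const
    exact hc.isOpen_inter_preimage ht isOpen_ne
  have hder : ∀ z ∈ t', ∃ A : Model n ≃L[ℝ] Model n,
      HasFDerivAt G (A : Model n →L[ℝ] Model n) z := fun z hz ↦
    exists_hasFDerivAt_straighten ((hF.contDiffAt (ht.mem_nhds hz.1)).differentiableAt (by simp))
      hz.2
  obtain ⟨A, hA⟩ := hder z₀ ⟨hz₀, hi⟩
  have hGz := hG.contDiffAt (ht.mem_nhds hz₀)
  let ψ := (hGz.toOpenPartialHomeomorph G hA (by simp)).restrOpen t' ht'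
  have hsrc : ψ.source ⊆ t' := fun z hz ↦ hz.2
  refine ⟨ψ, i, ⟨hGz.mem_toOpenPartialHomeomorph_source hA (by simp), hz₀, hi⟩,
    fun z hz ↦ (hsrc hz).1, hG.mono fun z hz ↦ (hsrc hz).1, fun z hz ↦ ?_, fun z _ ↦ ?_⟩
  · have h1 := hsrc (ψ.map_target hz)
    obtain ⟨B, hB⟩ := hder _ h1
    exact (ψ.contDiffAt_symm hz hB (hG.contDiffAt (ht.mem_nhds h1.1))).contDiffWithinAt
  · change (z + (F z - z i) • (EuclideanSpace.single i (1 : ℝ) : Model n)) i = F z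
    simp

variable {M : Type*} [TopologicalSpace M] [ChartedSpace (Model n) M]
  [IsManifold (𝓡 n) ∞ M]

/-- A smooth function with nonzero differential is a coordinate function of a chart. -/
theorem exists_adapted_chart {f : M → ℝ} {x : M}
    (hf : ContMDiffOn (𝓡 n) 𝓘(ℝ, ℝ) ∞ f (chartAt (Model n) x).source)
    (hd : mvfderiv (𝓡 n) f x ≠ 0) :
    ∃ φ ∈ IsManifold.maximalAtlas (𝓡 n) ∞ M, ∃ i : Fin n, x ∈ φ.source ∧
      φ.source ⊆ (chartAt (Model n) x).source ∧ ∀ y ∈ φ.source, φ y i = f y := by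
  set c := chartAt (Model n) x with hc
  have hx : x ∈ c.source := mem_chart_source _ x
  have hcM := IsManifold.chart_mem_maximalAtlas (I := 𝓡 n) (n := ∞) x
  have hcs := contMDiffOn_symm_of_mem_maximalAtlas hcM
  have hF : ContDiffOn ℝ ∞ (f ∘ c.symm) c.target := by
    rw [← contMDiffOn_iff_contDiffOn]
    exact hf.comp hcs fun z hz ↦ c.map_target hz
  have hd' : fderiv ℝ (f ∘ c.symm) (c x) ≠ 0 := by
    intro h0
    refine hd (ContinuousLinearMap.ext fun v ↦ ?_)
    have h1 := mvfderiv_constField hx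
      ((hf.contMDiffAt (chart_source_mem_nhds hx)).mdifferentiableAt (by simp)) (tcoord x x v)
    rw [constField_tcoord hx] at h1
    refine h1.trans ?_
    have h2 : fderiv ℝ (f ∘ (extChartAt (𝓡 n) x).symm) (extChartAt (𝓡 n) x x) = 0 := h0
    rw [h2]
    rfl
  obtain ⟨ψ, i, h1, h2, h3, h4, h5⟩ :=
    exists_openPartialHomeomorph_coord c.open_target hF (c.map_source hx) hd'
  refine ⟨c.trans ψ, ?_, i, ⟨hx, h1⟩, fun y hy ↦ hy.1, fun y hy ↦ ?_⟩
  · refine OpenPartialHomeomorph.mem_maximalAtlas_of_contMDiffOn _ ?_ ?_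
    · exact (contMDiffOn_iff_contDiffOn.2 h3).comp
        ((contMDiffOn_of_mem_maximalAtlas hcM).mono fun y hy ↦ hy.1) fun y hy ↦ hy.2
    · exact hcs.comp ((contMDiffOn_iff_contDiffOn.2 h4).mono fun y hy ↦ hy.1) fun y hy ↦ hy.2
  · exact (h5 _ hy.2).trans (congrArg f (c.left_inv hy.1))

end AdaptedCharts

/-! ### Embedded hypersurfaces from slice charts -/

section Slices

variable {m : ℕ}

/-- The isomorphism which inserts a coordinate at the place `i`. -/
def sliceEquiv (i : Fin (m + 1)) : (Model m × ℝ) ≃L[ℝ] Model (m + 1) :=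
  LinearEquiv.toContinuousLinearEquiv
    { toFun := fun p ↦ WithLp.toLp 2 (i.insertNth p.2 p.1.ofLp : Fin (m + 1) → ℝ)
      invFun := fun z ↦ (WithLp.toLp 2 (i.removeNth z.ofLp), z i)
      map_add' := by
        intro p q
        ext j
        refine Fin.succAboveCases i ?_ (fun k ↦ ?_) j <;> simp
      map_smul' := by
        intro c p
        ext j
        refine Fin.succAboveCases i ?_ (fun k ↦ ?_) j <;> simp
      left_inv := by
        intro p
        ext <;> simp
      right_inv := by
        intro z
        ext j
        refine Fin.succAboveCases i ?_ (fun k ↦ ?_) j <;> simp [Fin.removeNth] }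

lemma sliceEquiv_apply_self (i : Fin (m + 1)) (p : Model m × ℝ) : sliceEquiv i p i = p.2 := by
  change (i.insertNth p.2 p.1.ofLp : Fin (m + 1) → ℝ) i = p.2
  simp

lemma sliceEquiv_symm_fst (i : Fin (m + 1)) {z : Model (m + 1)} (hz : z i = 0) :
    sliceEquiv i (((sliceEquiv i).symm z).1, 0) = z := by
  have h : ((sliceEquiv i).symm z).2 = 0 := by
    rw [← sliceEquiv_apply_self i, ContinuousLinearEquiv.apply_symm_apply, hz]
  rw [← h]
  exact (sliceEquiv i).apply_symm_apply z

variable {M : Type*} [TopologicalSpace M]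

open Classical in
/-- The chart of a subset `S` induced by a chart of the ambient manifold in which `S` is a
coordinate hyperplane. -/
def sliceChart {S : Set M} (x₀ : S) (φ : OpenPartialHomeomorph M (Model (m + 1))) (i : Fin (m + 1))
    (h : ∀ y ∈ φ.source, y ∈ S ↔ φ y i = 0) : OpenPartialHomeomorph S (Model m) where
  toFun y := ((sliceEquiv i).symm (φ y)).1
  -- The default `x₀` is never taken on the target: there the point has zero `i`-th coordinate and
  -- so lies in `S`.
  invFun z := if hz : φ.symm (sliceEquiv i (z, 0)) ∈ S then ⟨_, hz⟩ else x₀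
  source := {y | (y : M) ∈ φ.source}
  target := {z | sliceEquiv i (z, 0) ∈ φ.target}
  map_source' y hy := by
    have h1 := sliceEquiv_symm_fst i ((h y hy).1 y.2)
    change sliceEquiv i (((sliceEquiv i).symm (φ y)).1, 0) ∈ φ.target
    rw [h1]
    exact φ.map_source hy
  map_target' z hz := by
    have h0 : φ.symm (sliceEquiv i (z, 0)) ∈ φ.source := φ.map_target hz
    have h1 : φ.symm (sliceEquiv i (z, 0)) ∈ S := by
      rw [h _ h0, φ.right_inv hz, sliceEquiv_apply_self]
    rw [dif_pos h1]
    exact h0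
  left_inv' y hy := by
    have h1 := sliceEquiv_symm_fst i ((h y hy).1 y.2)
    have h2 : φ.symm (sliceEquiv i (((sliceEquiv i).symm (φ y)).1, 0)) = y := by
      rw [h1, φ.left_inv hy]
    have h3 : φ.symm (sliceEquiv i (((sliceEquiv i).symm (φ y)).1, 0)) ∈ S := by
      rw [h2]; exact y.2
    rw [dif_pos h3]
    exact Subtype.ext h2
  right_inv' z hz := by
    have h0 : φ.symm (sliceEquiv i (z, 0)) ∈ φ.source := φ.map_target hz
    have h1 : φ.symm (sliceEquiv i (z, 0)) ∈ S := by
      rw [h _ h0, φ.right_inv hz, sliceEquiv_apply_self]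
    rw [dif_pos h1]
    simp only
    rw [φ.right_inv hz, ContinuousLinearEquiv.symm_apply_apply]
  open_source := φ.open_source.preimage continuous_subtype_val
  open_target := φ.open_target.preimage
    ((sliceEquiv i).continuous.comp (continuous_id.prodMk continuous_const))
  continuousOn_toFun := by
    refine (continuous_fst.comp (sliceEquiv i).symm.continuous).comp_continuousOn ?_
    exact φ.continuousOn.comp continuous_subtype_val.continuousOn fun y hy ↦ hy
  continuousOn_invFun := by
    rw [Topology.IsEmbedding.subtypeVal.continuousOn_iff]
    have h0 : ContinuousOn (fun z : Model m ↦ φ.symm (sliceEquiv i (z, 0)))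
        {z | sliceEquiv i (z, 0) ∈ φ.target} := φ.symm.continuousOn.comp
      ((sliceEquiv i).continuous.comp (continuous_id.prodMk continuous_const)).continuousOn
        fun y hy ↦ hy
    refine h0.congr fun z hz ↦ ?_
    have h0 : φ.symm (sliceEquiv i (z, 0)) ∈ φ.source := φ.map_target hz
    have h1 : φ.symm (sliceEquiv i (z, 0)) ∈ S := by
      rw [h _ h0, φ.right_inv hz, sliceEquiv_apply_self]
    simp only [Function.comp_apply]
    rw [dif_pos h1]

open Classical in
lemma sliceChart_symm_val {S : Set M} (x₀ : S) (φ : OpenPartialHomeomorph M (Model (m + 1)))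
    (i : Fin (m + 1)) (h : ∀ y ∈ φ.source, y ∈ S ↔ φ y i = 0) {z : Model m}
    (hz : z ∈ (sliceChart x₀ φ i h).target) :
    ((sliceChart x₀ φ i h).symm z : M) = φ.symm (sliceEquiv i (z, 0)) := by
  have hz' : sliceEquiv i (z, 0) ∈ φ.target := hz
  have h0 : φ.symm (sliceEquiv i (z, 0)) ∈ φ.source := φ.map_target hz'
  have h1 : φ.symm (sliceEquiv i (z, 0)) ∈ S := by
    rw [h _ h0, φ.right_inv hz', sliceEquiv_apply_self]
  change ((if hz : φ.symm (sliceEquiv i (z, 0)) ∈ S then (⟨_, hz⟩ : S) else x₀ : S) : M) = _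
  rw [dif_pos h1]

/-- A subset which is locally a coordinate hyperplane is an embedded submanifold. -/
theorem exists_isSmoothEmbedding_of_charts [ChartedSpace (Model (m + 1)) M]
    [IsManifold (𝓡 (m + 1)) ∞ M] {S : Set M}
    (hS : ∀ x : S, ∃ φ ∈ IsManifold.maximalAtlas (𝓡 (m + 1)) ∞ M, ∃ i : Fin (m + 1),
      (x : M) ∈ φ.source ∧ ∀ y ∈ φ.source, y ∈ S ↔ φ y i = 0) :
    ∃ (_ : ChartedSpace (Model m) S) (_ : IsManifold (𝓡 m) ∞ S),
      Manifold.IsSmoothEmbedding (𝓡 m) (𝓡 (m + 1)) ∞ (Subtype.val : S → M) := by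
  choose φ hφ i hx hs using hS
  let c (x : S) : OpenPartialHomeomorph S (Model m) := sliceChart x (φ x) (i x) (hs x)
  let C : ChartedSpace (Model m) S :=
    { atlas := range c
      chartAt := c
      mem_chart_source := fun x ↦ hx x
      chart_mem_atlas := fun x ↦ mem_range_self x }
  have hM : IsManifold (𝓡 m) ∞ S := by
    refine isManifold_of_contDiffOn _ _ _ ?_
    rintro _ _ ⟨x, rfl⟩ ⟨y, rfl⟩
    have h1 := contMDiffOn_symm_of_mem_maximalAtlas (hφ x)
    have h2 := contMDiffOn_of_mem_maximalAtlas (hφ y)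
    have h3 : ContMDiffOn (𝓡 m) (𝓡 (m + 1)) ∞ (fun z : Model m ↦ sliceEquiv (i x) (z, 0))
        univ :=
      ((sliceEquiv (i x)).contDiff.comp (contDiff_id.prodMk contDiff_const)).contMDiff.contMDiffOn
    have h4 : ContMDiff (𝓡 (m + 1)) (𝓡 m) ∞
        (fun z : Model (m + 1) ↦ ((sliceEquiv (i y)).symm z).1) :=
      (contDiff_fst.comp (sliceEquiv (i y)).symm.contDiff).contMDiff
    have h5 : ContMDiffOn (𝓡 m) (𝓡 m) ∞ (fun z : Model m ↦ ((sliceEquiv (i y)).symm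
        (φ y ((φ x).symm (sliceEquiv (i x) (z, 0))))).1)
        {z | z ∈ (c x).target ∧ (φ x).symm (sliceEquiv (i x) (z, 0)) ∈ (φ y).source} :=
      h4.comp_contMDiffOn (h2.comp (h1.comp (h3.mono (subset_univ _)) fun z hz ↦ hz.1)
        fun z hz ↦ hz.2)
    refine (contMDiffOn_iff_contDiffOn.1 h5).congr_mono (fun z hz ↦ ?_) fun z hz ↦ ?_
    · have hz' : z ∈ (c x).target := hz.1.1
      have := sliceChart_symm_val x (φ x) (i x) (hs x) hz'
      change ((sliceEquiv (i y)).symm (φ y ((c x).symm z : S))).1 = _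
      rw [this]
    · have hz' : z ∈ (c x).target := hz.1.1
      refine ⟨hz', ?_⟩
      rw [← sliceChart_symm_val x (φ x) (i x) (hs x) hz']
      exact hz.1.2
  -- The complement `ℝ` is the coordinate transverse to `S`; in the slice charts the inclusion is `z
  -- ↦ (z, 0)`.
  refine ⟨C, hM, ⟨ℝ, inferInstance, inferInstance, fun x ↦ ?_⟩,
    Topology.IsEmbedding.subtypeVal⟩
  refine Manifold.IsImmersionAtOfComplement.mk_of_continuousAt continuous_subtype_val.continuousAt
    (sliceEquiv (i x)) (c x) (φ x) (hx x) (hx x)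
    (IsManifold.subset_maximalAtlas (mem_range_self x)) (hφ x) fun z hz ↦ ?_
  have hz' : z ∈ (c x).target := by simpa using hz
  have h1 := sliceChart_symm_val x (φ x) (i x) (hs x) hz'
  change φ x ((c x).symm z : S) = sliceEquiv (i x) (z, 0)
  rw [h1, (φ x).right_inv hz']

end Slices

/-! ### Injectivity of the differential of an immersion -/

section Immersions

variable {m n : ℕ} {M S : Type*} [TopologicalSpace M] [ChartedSpace (Model n) M]
  [TopologicalSpace S] [ChartedSpace (Model m) S]

/-- The derivative of an immersion is injective. -/
lemma mfderiv_injective_of_isImmersionAt {F : Type*} [NormedAddCommGroup F] [NormedSpace ℝ F]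
    {f : S → M} {x : S}
    (h : Manifold.IsImmersionAtOfComplement F (𝓡 m) (𝓡 n) ∞ f x) :
    Function.Injective (mfderiv (𝓡 m) (𝓡 n) f x) := by
  let p : Model n → Model m := fun z ↦ (h.equiv.symm z).1
  -- In the normal form `z ↦ (z, 0)`, projection to the first factor is a left inverse; `L`
  -- transports it to a local left inverse of `f` that is differentiable at `f x`.
  let L : M → S := fun y ↦ h.domChart.symm (p (h.codChart y))
  have h1 : ∀ y ∈ h.domChart.source, h.codChart (f y) = h.equiv (h.domChart y, 0) := by
    intro y hy
    have ht : h.domChart y ∈ (h.domChart.extend (𝓡 m)).target := by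
      simpa using h.domChart.map_source hy
    have h2 : h.codChart (f (h.domChart.symm (h.domChart y))) = h.equiv (h.domChart y, 0) :=
      h.writtenInCharts ht
    rwa [h.domChart.left_inv hy] at h2
  have hp : ∀ y ∈ h.domChart.source, p (h.codChart (f y)) = h.domChart y := by
    intro y hy
    change (h.equiv.symm (h.codChart (f y))).1 = _
    rw [h1 y hy, ContinuousLinearEquiv.symm_apply_apply]
  have hL : L ∘ f =ᶠ[𝓝 x] id := by
    filter_upwards [h.domChart.open_source.mem_nhds h.mem_domChart_source] with y hy
    change h.domChart.symm (p (h.codChart (f y))) = y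
    rw [hp y hy, h.domChart.left_inv hy]
  have hpd : ContMDiff (𝓡 n) (𝓡 m) ∞ p :=
    (contDiff_fst.comp h.equiv.symm.contDiff).contMDiff
  have hLd : MDifferentiableAt (𝓡 n) (𝓡 m) L (f x) := by
    have h3 := contMDiffAt_of_mem_maximalAtlas h.codChart_mem_maximalAtlas h.mem_codChart_source
    have h4 := contMDiffAt_symm_of_mem_maximalAtlas h.domChart_mem_maximalAtlas
      (x := p (h.codChart (f x)))
      (by rw [hp x h.mem_domChart_source]; exact h.domChart.map_source h.mem_domChart_source)
    exact (h4.comp (f x) (hpd.contMDiffAt.comp (f x) h3)).mdifferentiableAt (by simp)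
  have hfd : MDifferentiableAt (𝓡 m) (𝓡 n) f x := h.contMDiffAt.mdifferentiableAt (by simp)
  have hid : ∀ u : TangentSpace (𝓡 m) x,
      mfderiv (𝓡 n) (𝓡 m) L (f x) (mfderiv (𝓡 m) (𝓡 n) f x u) = u := by
    intro u
    rw [← mfderiv_comp_apply x hLd hfd u, hL.mfderiv_eq, mfderiv_id]
    rfl
  exact Function.LeftInverse.injective hid

end Immersions

/-! ### The rank condition and the zero locus -/

section ZeroLocus

variable {n : ℕ} {M : Type*} [TopologicalSpace M] [ChartedSpace (Model n) M]
  [IsManifold (𝓡 n) ∞ M]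

lemma tractorForm_apply (D : ConnOp n M) (τ : Density n M 2) (x : M)
    (V W : TractorFiber (n := n) x) : tractorForm D τ x V W =
      ((1 / 2 : ℝ) * hessian D τ x V.1 W.1 + dval τ x * schouten D x V.1 W.1)
        + (1 / 2) * densityDeriv D τ x V.1 * W.2 + (1 / 2) * densityDeriv D τ x W.1 * V.2
        + dval τ x * V.2 * W.2 := rfl

lemma tractorForm_apply_of_zero (D : ConnOp n M) {τ : Density n M 2} {x : M} (hx : dval τ x = 0)
    (u v : TangentSpace (𝓡 n) x) (a b : ℝ) : tractorForm D τ x (u, a) (v, b) =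
      (1 / 2 : ℝ) * hessian D τ x u v + (1 / 2) * densityDeriv D τ x u * b +
        (1 / 2) * densityDeriv D τ x v * a := by
  rw [tractorForm_apply, hx]
  ring

/-- The connection term is proportional to `σ`, so at a zero the covariant derivative is the
differential of the coefficient, for every connection. -/
lemma densityDeriv_of_zero {w : ℝ} {D : ConnOp n M} (hD : IsAffineConnectionOn D univ)
    (σ : Density n M w) {x y : M} (hx : y ∈ (chartAt (Model n) x).source) (hσ : dval σ y = 0)
    (u : TangentSpace (𝓡 n) y) :
    dfactor (n := n) w y x y * densityDeriv D σ y u = mvfderiv (𝓡 n) (dcoef x σ) y u := by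
  rw [densityDeriv_chart hD.isCovariantDerivativeOn Filter.univ_mem hx
    (mdifferentiableAt_dcoef σ hx), (dcoef_eq_zero_iff _ hx).2 hσ]
  ring

/-- A nondegenerate `L(τ)` has rank `n + 1`, while a form on `T_x M` has rank at most `n`. -/
theorem rankLTRank_of_nondegenerateL {P : ProjStructure n M} {τ : Density n M 2}
    (h : NondegenerateL P τ) : RankLTRank P τ := by
  intro x _
  obtain ⟨D, hD, hL⟩ := h x
  refine ⟨D, hD, ?_⟩
  have h1 : Module.finrank ℝ (TangentSpace (𝓡 n) x) = n :=
    finrank_euclideanSpace_fin (𝕜 := ℝ) (n := n)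
  have hfd : FiniteDimensional ℝ (TangentSpace (𝓡 n) x) :=
    inferInstanceAs (FiniteDimensional ℝ (Model n))
  rw [formRank_eq_finrank_of_nondegenerate hL, Module.finrank_prod, h1, Module.finrank_self]
  exact Nat.lt_succ_of_le ((formRank_le_finrank _).trans h1.le)

/-- Otherwise all slots of `L(τ)` except `½∇∇τ` vanish at `y`, so `L(τ)` factors through the
projection to `TM` and its rank is at most that of `∇∇τ`. -/
lemma mvfderiv_dcoef_ne_zero {P : ProjStructure n M} {τ : Density n M 2} (h : RankLTRank P τ)
    {x y : M} (hx : y ∈ (chartAt (Model n) x).source) (hy : dval τ y = 0) :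
    mvfderiv (𝓡 n) (dcoef x τ) y ≠ 0 := by
  intro h0
  obtain ⟨D, hD, hlt⟩ := h y hy
  have hfd : FiniteDimensional ℝ (TangentSpace (𝓡 n) y) :=
    inferInstanceAs (FiniteDimensional ℝ (Model n))
  have h1 (u : TangentSpace (𝓡 n) y) : densityDeriv D τ y u = 0 := by
    have := densityDeriv_of_zero (P.isAffine D hD) τ hx hy u
    rw [h0] at this
    exact (mul_eq_zero.1 this).resolve_left (dfactor_pos 2 (mem_chart_source _ y) hx).ne'
  refine hlt.not_ge (formRank_le_of_factor (LinearMap.fst ℝ _ _) (1 / 2) fun V W ↦ ?_)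
  rw [← Prod.mk.eta (p := V), ← Prod.mk.eta (p := W), tractorForm_apply_of_zero D hy, h1, h1]
  simp

/-- The value of `L(τ)` on the nonzero tractor `(0, 1)` is `τ`, hence zero. -/
lemma not_isDefiniteForm_tractorForm (D : ConnOp n M) {τ : Density n M 2} {x : M}
    (hx : dval τ x = 0) : ¬ IsDefiniteForm (tractorForm D τ x) := by
  have h0 : tractorForm D τ x ((0 : TangentSpace (𝓡 n) x), (1 : ℝ)) (0, 1) = 0 := by
    rw [tractorForm_apply_of_zero D hx]
    simp
  have hne : ((0 : TangentSpace (𝓡 n) x), (1 : ℝ)) ≠ 0 := by simp [Prod.ext_iff]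
  rintro (h | h)
  · exact (h _ hne).ne' h0
  · exact (h _ hne).ne h0

/-- Near a zero, the coefficient of `τ` is a coordinate function. -/
lemma exists_chart_of_mem_zeroLocus {P : ProjStructure n M} {τ : Density n M 2}
    (h : RankLTRank P τ) {x : M} (hx : x ∈ zeroLocus τ) :
    ∃ φ ∈ IsManifold.maximalAtlas (𝓡 n) ∞ M, ∃ i : Fin n, x ∈ φ.source ∧
      φ.source ⊆ (chartAt (Model n) x).source ∧ ∀ y ∈ φ.source, φ y i = dcoef x τ y :=
  exists_adapted_chart (contMDiffOn_dcoef τ x)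
    (mvfderiv_dcoef_ne_zero h (mem_chart_source _ x) hx)

lemma dcoef_neg_iff {w : ℝ} (σ : (x : M) → DensityBundle n M w x) {x y : M}
    (hx : y ∈ (chartAt (Model n) x).source) : dcoef x σ y < 0 ↔ dval σ y < 0 := by
  have h := dfactor_pos (n := n) w (mem_chart_source _ y) hx
  rw [dcoef_eq]
  exact ⟨fun h1 ↦ by nlinarith, fun h1 ↦ mul_neg_of_pos_of_neg h h1⟩

lemma continuousAt_dcoef {w : ℝ} (σ : Density n M w) {x y : M}
    (hx : y ∈ (chartAt (Model n) x).source) : ContinuousAt (dcoef x σ) y :=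
  (mdifferentiableAt_dcoef σ hx).continuousAt

lemma isOpen_posLocus (τ : Density n M 2) : IsOpen (posLocus τ) := by
  refine isOpen_iff_mem_nhds.2 fun x hx ↦ ?_
  have h := mem_chart_source (Model n) x
  filter_upwards [(continuousAt_dcoef τ h).eventually (lt_mem_nhds ((dcoef_pos_iff _ h).2 hx)),
    chart_source_mem_nhds h] with y hy hys
  exact (dcoef_pos_iff _ hys).1 hy

lemma isOpen_negLocus (τ : Density n M 2) : IsOpen (negLocus τ) := by
  refine isOpen_iff_mem_nhds.2 fun x hx ↦ ?_
  have h := mem_chart_source (Model n) x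
  filter_upwards [(continuousAt_dcoef τ h).eventually (gt_mem_nhds ((dcoef_neg_iff _ h).2 hx)),
    chart_source_mem_nhds h] with y hy hys
  exact (dcoef_neg_iff _ hys).1 hy

lemma zeroLocus_eq_compl (τ : Density n M 2) : zeroLocus τ = (posLocus τ ∪ negLocus τ)ᶜ := by
  ext x
  simp only [zeroLocus, posLocus, negLocus, mem_compl_iff, mem_union, mem_ofPred_eq, not_or, not_lt]
  exact ⟨fun h ↦ ⟨h.le, h.ge⟩, fun h ↦ le_antisymm h.1 h.2⟩

lemma isClosed_zeroLocus (τ : Density n M 2) : IsClosed (zeroLocus τ) := by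
  rw [zeroLocus_eq_compl]
  exact ((isOpen_posLocus τ).union (isOpen_negLocus τ)).isClosed_compl

/-- Each zero is a limit of points with positive values, and of points with negative values. -/
lemma mem_closure_posLocus_negLocus {P : ProjStructure n M} {τ : Density n M 2}
    (h : RankLTRank P τ) {x : M} (hx : x ∈ zeroLocus τ) :
    x ∈ closure (posLocus τ) ∧ x ∈ closure (negLocus τ) := by
  obtain ⟨φ, -, i, hxs, hsub, hφ⟩ := exists_chart_of_mem_zeroLocus h hx
  -- This is the coordinate line through `x` along which, for small `t`, the coefficient of `τ`
  -- equals `t`; its two halves approach `x` from the two sides.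
  let c : ℝ → M := fun t ↦ φ.symm (φ x + t • EuclideanSpace.single i (1 : ℝ))
  have hline : Continuous fun t : ℝ ↦ φ x + t • (EuclideanSpace.single i (1 : ℝ) : Model n) := by
    fun_prop
  have hline0 : φ x + (0 : ℝ) • (EuclideanSpace.single i (1 : ℝ) : Model n) = φ x := by simp
  have hc : Filter.Tendsto c (𝓝 0) (𝓝 x) := by
    have h1 : ContinuousAt c 0 := by
      refine ContinuousAt.comp (g := φ.symm) ?_ hline.continuousAt
      rw [hline0]
      exact φ.continuousAt_symm (φ.map_source hxs)
    have h2 : c 0 = x := by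
      change φ.symm _ = x
      rw [hline0, φ.left_inv hxs]
    rw [ContinuousAt, h2] at h1
    exact h1
  have ht : ∀ᶠ t : ℝ in 𝓝 0, c t ∈ φ.source ∧ dcoef x τ (c t) = t := by
    have h1 : ∀ᶠ t : ℝ in 𝓝 0,
        φ x + t • (EuclideanSpace.single i (1 : ℝ) : Model n) ∈ φ.target := by
      refine hline.continuousAt.eventually (φ.open_target.mem_nhds ?_)
      beta_reduce
      rw [hline0]
      exact φ.map_source hxs
    filter_upwards [h1] with t ht
    have h2 : c t ∈ φ.source := φ.map_target ht
    refine ⟨h2, ?_⟩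
    have h0 : φ x i = 0 := by
      rw [hφ x hxs]
      exact (dcoef_eq_zero_iff _ (mem_chart_source _ x)).2 hx
    rw [← hφ _ h2, φ.right_inv ht]
    simp [h0]
  constructor
  · refine mem_closure_of_tendsto (hc.mono_left (nhdsWithin_le_nhds (s := Ioi 0))) ?_
    filter_upwards [self_mem_nhdsWithin, nhdsWithin_le_nhds ht] with t ht0 ht
    exact (dcoef_pos_iff _ (hsub ht.1)).1 (ht.2.symm ▸ ht0)
  · refine mem_closure_of_tendsto (hc.mono_left (nhdsWithin_le_nhds (s := Iio 0))) ?_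
    filter_upwards [self_mem_nhdsWithin, nhdsWithin_le_nhds ht] with t ht0 ht
    exact (dcoef_neg_iff _ (hsub ht.1)).1 (ht.2.symm ▸ ht0)

theorem separates_zeroLocus {P : ProjStructure n M} {τ : Density n M 2} (h : RankLTRank P τ) :
    Separates (zeroLocus τ) (posLocus τ) (negLocus τ) where
  isClosed := isClosed_zeroLocus τ
  isOpen_left := isOpen_posLocus τ
  isOpen_right := isOpen_negLocus τ
  cover := eq_univ_of_forall fun x ↦ by
    rcases lt_trichotomy (dval τ x) 0 with h | h | h
    · exact Or.inr h
    · exact Or.inl (Or.inr h)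
    · exact Or.inl (Or.inl h)
  disjoint_left := disjoint_left.2 fun x hx hx' ↦ ne_of_gt hx hx'
  disjoint_right := disjoint_left.2 fun x hx hx' ↦ ne_of_lt hx' hx
  disjoint := disjoint_left.2 fun x hx hx' ↦ lt_asymm (α := ℝ) hx hx'
  frontier_left := by
    rw [(isOpen_posLocus τ).frontier_eq]
    refine Subset.antisymm (fun x hx ↦ ?_) fun x hx ↦
      ⟨(mem_closure_posLocus_negLocus h hx).1, fun hx' ↦ ne_of_gt hx' hx⟩
    rcases lt_trichotomy (dval τ x) 0 with h | h | h
    · obtain ⟨y, hy, hy'⟩ := mem_closure_iff.1 hx.1 _ (isOpen_negLocus τ) h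
      exact (lt_asymm (α := ℝ) hy hy').elim
    · exact h
    · exact (hx.2 h).elim
  frontier_right := by
    rw [(isOpen_negLocus τ).frontier_eq]
    refine Subset.antisymm (fun x hx ↦ ?_) fun x hx ↦
      ⟨(mem_closure_posLocus_negLocus h hx).2, fun hx' ↦ ne_of_lt hx' hx⟩
    rcases lt_trichotomy (dval τ x) 0 with h | h | h
    · exact (hx.2 h).elim
    · exact h
    · obtain ⟨y, hy, hy'⟩ := mem_closure_iff.1 hx.1 _ (isOpen_posLocus τ) h
      exact (lt_asymm (α := ℝ) hy hy').elim

end ZeroLocus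

/-! ### Positive densities -/

section PositiveDensity

variable {n : ℕ} {M : Type*} [TopologicalSpace M] [ChartedSpace (Model n) M]
  [IsManifold (𝓡 n) ∞ M] [T2Space M] [SigmaCompactSpace M]

/-- The density bundles are trivial. -/
lemma exists_pos_density (w : ℝ) : ∃ ρ : Density n M w, ∀ x, 0 < dval ρ x := by
  -- Positive values form a convex set in each fibre, so local positive sections can be glued. Near
  -- `x` the local section is the density with coefficient `1` in the chart at `x`.
  refine exists_contMDiffSection_forall_mem_convex_of_local (𝓡 n) (DensityBundle n M w)
    (fun _ ↦ (Ioi (0 : ℝ) : Set ℝ)) (fun _ ↦ convex_Ioi (0 : ℝ)) fun x ↦ ?_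
  refine ⟨_, chart_source_mem_nhds (mem_chart_source (Model n) x),
    fun y ↦ ((dfactor (n := n) w y x y)⁻¹ : ℝ), ?_, fun y hy ↦
      inv_pos.2 (dfactor_pos w (mem_chart_source _ y) hy)⟩
  refine ((trivializationAt ℝ (DensityBundle n M w) x).contMDiffOn_section_baseSet_iff
    (IB := 𝓡 n) (n := ∞)).2 ?_
  refine (contMDiffOn_const (c := (1 : ℝ))).congr fun y hy ↦ ?_
  exact mul_inv_cancel₀ (dfactor_pos (n := n) w (mem_chart_source _ y) hy).ne'

end PositiveDensity

/-! ### The form induced by `∇∇τ` on the zero locus -/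

section InducedMetric

variable {n : ℕ} {M : Type*} [TopologicalSpace M] [ChartedSpace (Model n) M]
  [IsManifold (𝓡 n) ∞ M]

lemma contMDiffOn_hesscoef [T2Space M] {D : ConnOp n M} (hD : IsAffineConnectionOn D univ)
    {f : M → ℝ} {x : M} (hf : ContMDiffOn (𝓡 n) 𝓘(ℝ, ℝ) ∞ f (chartAt (Model n) x).source)
    (k l : Fin n) :
    ContMDiffOn (𝓡 n) 𝓘(ℝ, ℝ) ∞ (fun z ↦ hesscoef D x f k z (frame x l z))
      (chartAt (Model n) x).source := by
  have ho := (chartAt (Model n) x).open_source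
  have hk := contMDiffOn_constField (n := n) x (EuclideanSpace.single k 1)
  have hl := contMDiffOn_constField (n := n) x (EuclideanSpace.single l 1)
  refine (contMDiffOn_mvfderiv ho (contMDiffOn_mvfderiv ho hf hk) hl).sub
    (contMDiffOn_mvfderiv ho hf (Y := fun z ↦ D (frame x k) z (frame x l z)) fun y hy ↦ ?_)
  exact contMDiffAt_conn_apply hD ho hk hy (hl y hy)

/-- On the kernel of `df` the trace terms disappear, leaving a double sum with smooth coefficients.
-/
lemma hessForm_eq_sum {w : ℝ} {D : ConnOp n M} {x y : M} (hy : y ∈ (chartAt (Model n) x).source)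
    {f : M → ℝ} {u v : TangentSpace (𝓡 n) y} (hu : mvfderiv (𝓡 n) f y u = 0)
    (hv : mvfderiv (𝓡 n) f y v = 0) : hessForm w D x f y u v =
      ∑ k, ∑ l, tcoord x y v k * (tcoord x y u l * hesscoef D x f k y (frame x l y)) := by
  rw [hessForm_apply, hu, hv, zero_mul, zero_mul, add_zero, mul_zero, add_zero]
  refine Finset.sum_congr rfl fun k _ ↦ ?_
  conv_lhs => rw [eq_sum_frame hy u, map_sum, Finset.mul_sum]
  simp only [map_smul, smul_eq_mul]

/-- On the kernel of `∇σ`, at a zero of `σ`, the form `∇∇σ` depends only on the projective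
structure. -/
lemma hessian_eq_of_projRelated [T2Space M] {w : ℝ} {D D' : ConnOp n M}
    (hD : IsAffineConnectionOn D univ) (hD' : IsAffineConnectionOn D' univ)
    (h : ProjRelatedOn D D' univ) (σ : Density n M w) {y : M} (hσ : dval σ y = 0)
    {u v : TangentSpace (𝓡 n) y} (hu : mvfderiv (𝓡 n) (dcoef y σ) y u = 0)
    (hv : mvfderiv (𝓡 n) (dcoef y σ) y v = 0) : hessian D' σ y u v = hessian D σ y u v := by
  have hy := mem_chart_source (Model n) y
  have e1 := congrArg (fun B : LinearMap.BilinForm ℝ (TangentSpace (𝓡 n) y) ↦ B u v)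
    (hessian_chart hD σ hy hσ)
  have e2 := congrArg (fun B : LinearMap.BilinForm ℝ (TangentSpace (𝓡 n) y) ↦ B u v)
    (hessian_chart hD' σ hy hσ)
  simp only [LinearMap.smul_apply, smul_eq_mul] at e1 e2
  refine mul_left_cancel₀ (dfactor_pos (n := n) w hy hy).ne' (e2.trans (Eq.trans ?_ e1.symm))
  rw [hessForm_apply, hessForm_apply, hu, hv, zero_mul, zero_mul, zero_mul, zero_mul,
    add_right_cancel_iff]
  obtain ⟨U, -, hU⟩ := h
  -- The projective change also contributes `Υ(e_k) df(u)`, which is zero. The term shown here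
  -- becomes `Υ(u) df(v) = 0` after contraction with the components of `v`.
  have hk (k : Fin n) : hesscoef D' y (dcoef y σ) k y u = hesscoef D y (dcoef y σ) k y u -
      U y u * mvfderiv (𝓡 n) (dcoef y σ) y (frame y k y) := by
    rw [hesscoef_apply, hesscoef_apply, hU _ y (mem_univ y) (diffFieldAt_constField hy _) u,
      map_add, map_add, map_smul, map_smul, hu, smul_zero, add_zero, smul_eq_mul]
    ring
  simp only [hk, mul_sub, Finset.sum_sub_distrib]
  have h3 : ∑ k, tcoord y y v k * (U y u * mvfderiv (𝓡 n) (dcoef y σ) y (frame y k y)) = 0 := by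
    have h4 : U y u * mvfderiv (𝓡 n) (dcoef y σ) y v = 0 := by rw [hv, mul_zero]
    rw [← h4]
    conv_rhs => rw [eq_sum_frame hy v, map_sum, Finset.mul_sum]
    refine Finset.sum_congr rfl fun k _ ↦ ?_
    rw [map_smul, smul_eq_mul]
    ring
  rw [h3, sub_zero]

variable {m : ℕ} {S : Set M} [ChartedSpace (Model m) S]

/-- The differential of the inclusion of a submanifold. -/
abbrev incl (y : S) : TangentSpace (𝓡 m) y →L[ℝ] TangentSpace (𝓡 n) (y : M) :=
  mfderiv (𝓡 m) (𝓡 n) (Subtype.val : S → M) y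

lemma mvfderiv_incl (hι : ContMDiff (𝓡 m) (𝓡 n) ∞ (Subtype.val : S → M)) {f : M → ℝ} {y : S}
    (hf : MDifferentiableAt (𝓡 n) 𝓘(ℝ, ℝ) f (y : M)) (h0 : ∀ᶠ z : S in 𝓝 y, f z = 0)
    (u : TangentSpace (𝓡 m) y) : mvfderiv (𝓡 n) f (y : M) (incl (n := n) y u) = 0 := by
  have h1 := mfderiv_comp_apply y hf ((hι y).mdifferentiableAt (by simp)) u
  have h2 : mfderiv (𝓡 m) 𝓘(ℝ, ℝ) (f ∘ (Subtype.val : S → M)) y = 0 := by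
    have h3 : f ∘ (Subtype.val : S → M) =ᶠ[𝓝 y] fun _ ↦ (0 : ℝ) := h0
    rw [h3.mfderiv_eq]
    exact mfderiv_const
  rw [h2] at h1
  exact h1.symm

/-- The restriction of `∇∇τ` to `TS`, rescaled with a density `ρ`. -/
def inducedForm (D : ConnOp n M) (τ ρ : Density n M 2) (y : S) :
    TangentSpace (𝓡 m) y →L[ℝ] TangentSpace (𝓡 m) y →L[ℝ] ℝ :=
  haveI : FiniteDimensional ℝ (TangentSpace (𝓡 m) y) :=
    inferInstanceAs (FiniteDimensional ℝ (Model m))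
  haveI : T2Space (TangentSpace (𝓡 m) y) := inferInstanceAs (T2Space (Model m))
  LinearMap.toContinuousBilinearMap ((dval ρ (y : M))⁻¹ • (hessian D τ (y : M)).compl₁₂
    (incl (n := n) (m := m) y).toLinearMap (incl (n := n) (m := m) y).toLinearMap)

lemma inducedForm_apply (D : ConnOp n M) (τ ρ : Density n M 2) (y : S)
    (u v : TangentSpace (𝓡 m) y) : inducedForm D τ ρ y u v =
      (dval ρ (y : M))⁻¹ * hessian D τ (y : M) (incl (n := n) y u) (incl (n := n) y v) := rfl

variable [IsManifold (𝓡 m) ∞ S]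

lemma contMDiffAt_tcoord_incl (hι : ContMDiff (𝓡 m) (𝓡 n) ∞ (Subtype.val : S → M)) (x : S)
    (k : Fin m) : ContMDiffAt (𝓡 m) 𝓘(ℝ, Model n) ∞
      (fun y : S ↦ tcoord (x : M) (y : M) (incl (n := n) y (frame x k y))) x := by
  have h1 := (hι.contMDiff_tangentMap (m := ∞) le_rfl).contMDiffAt.comp x
    ((contMDiffOn_constField (n := m) x (EuclideanSpace.single k 1)).contMDiffAt
      (chart_source_mem_nhds (mem_chart_source _ x)))
  have h2 := ((contMDiffAt_totalSpace (F := Model n) (E := (TangentSpace (𝓡 n) : M → Type _))).1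
    h1).2
  refine h2.congr_of_eventuallyEq ?_
  filter_upwards [hι.continuous.continuousAt.preimage_mem_nhds
    (chart_source_mem_nhds (n := n) (mem_chart_source (Model n) (x : M)))] with y hy
  exact tcoord_eq hy _

lemma contMDiff_inducedForm [T2Space M] (hι : ContMDiff (𝓡 m) (𝓡 n) ∞ (Subtype.val : S → M))
    {D : ConnOp n M} (hD : IsAffineConnectionOn D univ) (τ ρ : Density n M 2)
    (hS : ∀ y ∈ S, dval τ y = 0) (hρ : ∀ y, 0 < dval ρ y) :
    ContMDiff (𝓡 m) ((𝓡 m).prod 𝓘(ℝ, Model m →L[ℝ] Model m →L[ℝ] ℝ)) ∞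
    (fun x ↦ TotalSpace.mk' (Model m →L[ℝ] Model m →L[ℝ] ℝ)
      (E := fun x : S ↦ TangentSpace (𝓡 m) x →L[ℝ] TangentSpace (𝓡 m) x →L[ℝ] ℝ) x
        (inducedForm D τ ρ x)) := by
  intro x
  have hs : ContMDiffAt (𝓡 m) 𝓘(ℝ, ℝ) ∞ (fun y : S ↦ dcoef (x : M) ρ y) x :=
    ((contMDiffOn_dcoef ρ (x : M)).contMDiffAt
      (chart_source_mem_nhds (mem_chart_source _ _))).comp x (hι x)
  have hs0 : dcoef (x : M) ρ x ≠ 0 := by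
    rw [dcoef_self]; exact (hρ x).ne'
  have hH (k l : Fin n) : ContMDiffAt (𝓡 m) 𝓘(ℝ, ℝ) ∞
      (fun y : S ↦ hesscoef D (x : M) (dcoef x τ) k y (frame (x : M) l y)) x :=
    ((contMDiffOn_hesscoef hD (contMDiffOn_dcoef τ (x : M)) k l).contMDiffAt
      (chart_source_mem_nhds (mem_chart_source _ _))).comp x (hι x)
  let pr (k : Fin n) : Model n →L[ℝ] ℝ := EuclideanSpace.proj k
  have ht (i : Fin m) (k : Fin n) : ContMDiffAt (𝓡 m) 𝓘(ℝ, ℝ) ∞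
      (fun y : S ↦ tcoord (x : M) (y : M) (incl (n := n) y (frame x i y)) k) x :=
    (pr k).contMDiff.contMDiffAt.comp x (contMDiffAt_tcoord_incl hι x i)
  have key (i j : Fin m) : ContMDiffAt (𝓡 m) 𝓘(ℝ, ℝ) ∞
      (fun y : S ↦ inducedForm D τ ρ y (frame x i y) (frame x j y)) x := by
    have h1 : ContMDiffAt (𝓡 m) 𝓘(ℝ, ℝ) ∞ (fun y : S ↦ (dcoef (x : M) ρ y)⁻¹ *
        ∑ k, ∑ l, tcoord (x : M) (y : M) (incl (n := n) y (frame x j y)) k *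
          (tcoord (x : M) (y : M) (incl (n := n) y (frame x i y)) l *
            hesscoef D (x : M) (dcoef x τ) k y (frame (x : M) l y))) x :=
      (hs.inv₀ hs0).mul (ContMDiffAt.sum fun k _ ↦ ContMDiffAt.sum fun l _ ↦
        (ht j k).mul ((ht i l).mul (hH k l)))
    refine h1.congr_of_eventuallyEq ?_
    have hev := hι.continuous.continuousAt.preimage_mem_nhds
      (chart_source_mem_nhds (n := n) (mem_chart_source (Model n) (x : M)))
    -- A whole neighbourhood of `y` in `S` must lie in the chart domain: the differential of the
    -- coefficient vanishes along `S` because the coefficient vanishes on `S` near `y`.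
    filter_upwards [eventually_mem_nhds_iff.2 hev] with y hy'
    have hy : (y : M) ∈ (chartAt (Model n) (x : M)).source :=
      mem_of_mem_nhds (s := Subtype.val ⁻¹' _) hy'
    have h0 (u : TangentSpace (𝓡 m) y) :
        mvfderiv (𝓡 n) (dcoef (x : M) τ) (y : M) (incl (n := n) y u) = 0 := by
      refine mvfderiv_incl hι (mdifferentiableAt_dcoef τ hy) ?_ u
      filter_upwards [hy'] with z hz
      exact (dcoef_eq_zero_iff _ hz).2 (hS z z.2)
    rw [← hessForm_eq_sum (w := 2) hy (h0 _) (h0 _), ← hessian_chart hD τ hy (hS y y.2),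
      inducedForm_apply, dcoef_eq, LinearMap.smul_apply, LinearMap.smul_apply, smul_eq_mul]
    -- Both `τ` and `ρ` have weight 2, so the transition factors cancel in the quotient.
    have h3 := (dfactor_pos (n := n) 2 (mem_chart_source _ (y : M)) hy).ne'
    have h4 := (hρ (y : M)).ne'
    field_simp
  -- A bilinear form is a section of `Hom(TS, Hom(TS, ℝ))`, so the frame criterion is used twice.
  refine contMDiffAt_hom_of_frame (F := Model m →L[ℝ] ℝ)
    (V := fun y : S ↦ TangentSpace (𝓡 m) y →L[ℝ] Bundle.Trivial S ℝ y) fun i ↦ ?_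
  refine contMDiffAt_hom_of_frame (F := ℝ) (V := Bundle.Trivial S ℝ) fun j ↦ ?_
  rw [Bundle.contMDiffAt_section]
  exact key i j

end InducedMetric

/-! ### Conformal classes -/

section ConformalClass

variable {m : ℕ} {S : Type*} [TopologicalSpace S] [ChartedSpace (Model m) S]
  [IsManifold (𝓡 m) ∞ S]

/-- The conformal class of a pseudo-Riemannian metric. -/
def PseudoMetric.conformalClass (g : PseudoMetric m S) : ConformalStructure m S where
  metrics := {g' | ∃ f : S → ℝ, ContMDiff (𝓡 m) 𝓘(ℝ, ℝ) ∞ f ∧ (∀ x, 0 < f x) ∧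
    ∀ x u v, g'.form x u v = f x * g.form x u v}
  nonempty := ⟨g, fun _ ↦ 1, contMDiff_const, fun _ ↦ one_pos, fun x u v ↦ (one_mul _).symm⟩
  mem_iff := by
    rintro g₁ ⟨f₁, hf₁, hp₁, h₁⟩ g₂
    constructor
    · rintro ⟨f₂, hf₂, hp₂, h₂⟩
      refine ⟨fun x ↦ f₂ x * (f₁ x)⁻¹, hf₂.mul (hf₁.inv₀ fun x ↦ (hp₁ x).ne'),
        fun x ↦ mul_pos (hp₂ x) (inv_pos.2 (hp₁ x)), fun x u v ↦ ?_⟩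
      have := (hp₁ x).ne'
      rw [h₂, h₁]
      field_simp
    · rintro ⟨f₂, hf₂, hp₂, h₂⟩
      refine ⟨fun x ↦ f₂ x * f₁ x, hf₂.mul hf₁, fun x ↦ mul_pos (hp₂ x) (hp₁ x),
        fun x u v ↦ ?_⟩
      rw [h₂, h₁, mul_assoc]

end ConformalClass

/-! ### The conformal structure on the zero locus -/

section ConformalInfinity

variable {m : ℕ} {M : Type*} [TopologicalSpace M] [T2Space M]
  [ChartedSpace (Model (m + 1)) M] [IsManifold (𝓡 (m + 1)) ∞ M]
  {P : ProjStructure (m + 1) M} {τ : Density (m + 1) M 2}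
  [ChartedSpace (Model m) (zeroLocus τ)] [IsManifold (𝓡 m) ∞ (zeroLocus τ)]

lemma mvfderiv_dcoef_incl
    (hι : ContMDiff (𝓡 m) (𝓡 (m + 1)) ∞ (Subtype.val : zeroLocus τ → M)) (y : zeroLocus τ)
    (u : TangentSpace (𝓡 m) y) :
    mvfderiv (𝓡 (m + 1)) (dcoef (y : M) τ) (y : M) (incl (n := m + 1) y u) = 0 := by
  have hy := mem_chart_source (Model (m + 1)) (y : M)
  refine mvfderiv_incl hι (mdifferentiableAt_dcoef τ hy) ?_ u
  filter_upwards [hι.continuous.continuousAt.preimage_mem_nhds (chart_source_mem_nhds hy)] with z hz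
  exact (dcoef_eq_zero_iff _ hz).2 z.2

/-- Vectors tangent to the zero locus lie in the kernel of `∇τ`, so the only surviving slot is
`½∇∇τ`, and `a`, `b` do not matter. -/
lemma tractorForm_incl {D : ConnOp (m + 1) M} (hD : IsAffineConnectionOn D univ)
    (hι : ContMDiff (𝓡 m) (𝓡 (m + 1)) ∞ (Subtype.val : zeroLocus τ → M)) (y : zeroLocus τ)
    (u v : TangentSpace (𝓡 m) y) (a b : ℝ) :
    tractorForm D τ (y : M) (incl (n := m + 1) y u, a) (incl (n := m + 1) y v, b) =
      1 / 2 * hessian D τ (y : M) (incl (n := m + 1) y u) (incl (n := m + 1) y v) := by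
  have hy := mem_chart_source (Model (m + 1)) (y : M)
  have h0 (u : TangentSpace (𝓡 m) y) :
      densityDeriv D τ (y : M) (incl (n := m + 1) y u) = 0 := by
    have := densityDeriv_of_zero hD τ hy y.2 (incl (n := m + 1) y u)
    rw [mvfderiv_dcoef_incl hι] at this
    exact (mul_eq_zero.1 this).resolve_left (dfactor_pos 2 hy hy).ne'
  rw [tractorForm_apply_of_zero D y.2, h0, h0]
  ring

lemma hessian_incl_eq {D D' : ConnOp (m + 1) M} (hD : D ∈ P.conns) (hD' : D' ∈ P.conns)
    (hι : ContMDiff (𝓡 m) (𝓡 (m + 1)) ∞ (Subtype.val : zeroLocus τ → M)) (y : zeroLocus τ)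
    (u v : TangentSpace (𝓡 m) y) :
    hessian D' τ (y : M) (incl (n := m + 1) y u) (incl (n := m + 1) y v) =
      hessian D τ (y : M) (incl (n := m + 1) y u) (incl (n := m + 1) y v) :=
  hessian_eq_of_projRelated (P.isAffine D hD) (P.isAffine D' hD') ((P.mem_iff D hD D').1 hD').2 τ
    y.2 (mvfderiv_dcoef_incl hι y u) (mvfderiv_dcoef_incl hι y v)

/-- The signature of `L(τ)` may be given in any splitting: on `TM_0` the form `∇∇τ` is the same for
all connections of the class. -/
lemma hasSignature_hessian_incl {D : ConnOp (m + 1) M} (hD : D ∈ P.conns)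
    (hι : Manifold.IsSmoothEmbedding (𝓡 m) (𝓡 (m + 1)) ∞ (Subtype.val : zeroLocus τ → M))
    (y : zeroLocus τ) {p q : ℕ}
    (hsig : ∃ D ∈ P.conns, HasSignature (tractorForm D τ (y : M)) p q 0) :
    1 ≤ p ∧ 1 ≤ q ∧ HasSignature ((hessian D τ (y : M)).compl₁₂
      (incl (n := m + 1) (m := m) y).toLinearMap (incl (n := m + 1) (m := m) y).toLinearMap)
      (p - 1) (q - 1) 0 := by
  obtain ⟨D', hD', hsig⟩ := hsig
  have hfd : FiniteDimensional ℝ (TangentSpace (𝓡 m) y) :=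
    inferInstanceAs (FiniteDimensional ℝ (Model m))
  have hfd' : FiniteDimensional ℝ (TangentSpace (𝓡 (m + 1)) (y : M)) :=
    inferInstanceAs (FiniteDimensional ℝ (Model (m + 1)))
  have h1 : Module.finrank ℝ (TangentSpace (𝓡 m) y) = m :=
    finrank_euclideanSpace_fin (𝕜 := ℝ) (n := m)
  have h2 : Module.finrank ℝ (TangentSpace (𝓡 (m + 1)) (y : M)) = m + 1 :=
    finrank_euclideanSpace_fin (𝕜 := ℝ) (n := m + 1)
  have hinj : Function.Injective (incl (n := m + 1) (m := m) y) := by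
    obtain ⟨F, _, _, h⟩ := hι.isImmersion
    exact mfderiv_injective_of_isImmersionAt (h y)
  have hι' := hι.contMDiff
  obtain ⟨hp, hq, hs⟩ := hasSignature_of_null_quotient
    (β := (1 / 2 : ℝ) • (hessian D τ (y : M)).compl₁₂
      (incl (n := m + 1) (m := m) y).toLinearMap (incl (n := m + 1) (m := m) y).toLinearMap)
    (incl (n := m + 1) (m := m) y).toLinearMap hinj (by rw [h1, h2]) (fun s t a b ↦ by
      refine (tractorForm_incl (P.isAffine D' hD') hι' y s t a b).trans ?_
      rw [hessian_incl_eq hD hD' hι']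
      rfl) hsig
  -- The factor 2 undoes the `½` in the top slot of `L(τ)`.
  refine ⟨hp, hq, hs.smul_pos two_pos fun u v ↦ ?_⟩
  rw [LinearMap.smul_apply, LinearMap.smul_apply, smul_eq_mul]
  ring

/-- If `L(τ)` is nondegenerate along the zero locus of `τ`, then it induces a conformal structure
on the zero locus. -/
theorem exists_induced_conformalStructure [SigmaCompactSpace M]
    (hι : Manifold.IsSmoothEmbedding (𝓡 m) (𝓡 (m + 1)) ∞ (Subtype.val : zeroLocus τ → M))
    (hne : (zeroLocus τ).Nonempty) {p q : ℕ}
    (hsig : ∀ x ∈ zeroLocus τ, ∃ D ∈ P.conns, HasSignature (tractorForm D τ x) p q 0) :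
    1 ≤ p ∧ 1 ≤ q ∧ ∃ c : ConformalStructure m (zeroLocus τ), c.HasSig (p - 1) (q - 1) ∧
      ∀ g ∈ c.metrics, ∀ x : zeroLocus τ, ∃ k : ℝ, 0 < k ∧ ∀ D ∈ P.conns,
        ∀ u v : TangentSpace (𝓡 m) x, ∀ a b : ℝ,
          tractorForm D τ (x : M) (incl (n := m + 1) x u, a) (incl (n := m + 1) x v, b) =
            k * g.form x u v := by
  obtain ⟨D, hD⟩ := P.nonempty
  obtain ⟨ρ, hρ⟩ := exists_pos_density (n := m + 1) (M := M) 2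
  have hι' := hι.contMDiff
  have hs (y : zeroLocus τ) := hasSignature_hessian_incl hD hι y (hsig y y.2)
  have hsymm (y : zeroLocus τ) (u v : TangentSpace (𝓡 m) y) :
      inducedForm D τ ρ y u v = inducedForm D τ ρ y v u := by
    rw [inducedForm_apply, inducedForm_apply, hessian_symm (P.isAffine D hD) τ y.2]
  let g : PseudoMetric m (zeroLocus τ) :=
    { form := inducedForm D τ ρ
      symm := hsymm
      nondegenerate := fun y u hu ↦ by
        have hfd : FiniteDimensional ℝ (TangentSpace (𝓡 m) y) :=
          inferInstanceAs (FiniteDimensional ℝ (Model m))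
        refine (hs y).2.2.eq_zero_of_forall (fun u v ↦ ?_) (u := u) fun v ↦ ?_
        · exact hessian_symm (P.isAffine D hD) τ y.2 _ _
        · have h := hu v
          rw [inducedForm_apply] at h
          exact (mul_eq_zero.1 h).resolve_left (inv_pos.2 (hρ _)).ne'
      smooth := contMDiff_inducedForm hι' (P.isAffine D hD) τ ρ (fun y hy ↦ hy) hρ }
  obtain ⟨x₀, hx₀⟩ := hne
  refine ⟨(hs ⟨x₀, hx₀⟩).1, (hs ⟨x₀, hx₀⟩).2.1, g.conformalClass, ?_, ?_⟩
  · rintro g' ⟨f, -, hf, hg'⟩ x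
    refine (hs x).2.2.smul_pos (mul_pos (hf x) (inv_pos.2 (hρ (x : M)))) fun u v ↦ ?_
    refine (hg' x u v).trans ?_
    rw [mul_assoc]
    rfl
  · rintro g' ⟨f, -, hf, hg'⟩ x
    -- `L(τ)` restricts to `½∇∇τ`, and the metric is `f/ρ` times `∇∇τ`; their ratio is `ρ/(2f)`.
    refine ⟨dval ρ (x : M) / (2 * f x), div_pos (hρ _) (mul_pos two_pos (hf x)),
      fun D' hD' u v a b ↦ ?_⟩
    have h1 : g.form x u v = _ := inducedForm_apply D τ ρ x u v
    rw [tractorForm_incl (P.isAffine D' hD') hι', hessian_incl_eq hD hD' hι', hg', h1]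
    have h2 := (hρ (x : M)).ne'
    have h3 := (hf x).ne'
    field_simp

end ConformalInfinity

/-! ### Projective changes of connections -/

section ProjectiveChange

variable {n : ℕ} {M : Type*} [TopologicalSpace M] [ChartedSpace (Model n) M]
  [IsManifold (𝓡 n) ∞ M]

/-- The projective change `∇_u Y + Υ(u) Y + Υ(Y) u` of a connection. -/
def projChange (D : ConnOp n M) (U : (x : M) → TangentSpace (𝓡 n) x →L[ℝ] ℝ) : ConnOp n M :=
  fun Y x ↦ D Y x + ((U x).smulRight (Y x) + U x (Y x) • ContinuousLinearMap.id ℝ _)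

lemma projChange_apply (D : ConnOp n M) (U : (x : M) → TangentSpace (𝓡 n) x →L[ℝ] ℝ)
    (Y : VField n M) (x : M) (u : TangentSpace (𝓡 n) x) :
    projChange D U Y x u = D Y x u + U x u • Y x + U x (Y x) • u :=
  (add_assoc _ _ _).symm

lemma SmoothOneFormOn.contMDiffAt_apply {U : (x : M) → TangentSpace (𝓡 n) x →L[ℝ] ℝ} {s : Set M}
    (hU : SmoothOneFormOn U s) {y : M} (hs : s ∈ 𝓝 y) {Y : VField n M}
    (hY : ContMDiffAt (𝓡 n) ((𝓡 n).prod 𝓘(ℝ, Model n)) ∞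
      (fun x ↦ (TotalSpace.mk' (Model n) x (Y x) : TangentBundle (𝓡 n) M)) y) :
    ContMDiffAt (𝓡 n) 𝓘(ℝ, ℝ) ∞ (fun z ↦ U z (Y z)) y := by
  have h := (hU.contMDiffAt hs).clm_bundle_apply (F₂ := ℝ) (E₂ := Bundle.Trivial M ℝ) hY
  exact (Bundle.contMDiffAt_section _).1 h

lemma smoothOneFormOn_of_frame {U : (x : M) → TangentSpace (𝓡 n) x →L[ℝ] ℝ} {s : Set M}
    (h : ∀ x ∈ s, ∀ k, ContMDiffAt (𝓡 n) 𝓘(ℝ, ℝ) ∞ (fun z ↦ U z (frame x k z)) x) :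
    SmoothOneFormOn U s := fun x hx ↦
  (contMDiffAt_hom_of_frame (F := ℝ) (V := Bundle.Trivial M ℝ) fun k ↦
    (Bundle.contMDiffAt_section _).2 (h x hx k)).contMDiffWithinAt

lemma isCovariantDerivativeOn_projChange {D : ConnOp n M} {s : Set M}
    (hD : IsCovariantDerivativeOn (Model n) D s)
    (U : (x : M) → TangentSpace (𝓡 n) x →L[ℝ] ℝ) :
    IsCovariantDerivativeOn (Model n) (projChange D U) s where
  add {Y Y' x} hY hY' hx := by
    ext1 u
    rw [add_apply, projChange_apply, projChange_apply, projChange_apply, hD.add hY hY' hx,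
      add_apply, Pi.add_apply, map_add, smul_add, add_smul]
    abel
  leibniz {Y g x} hY hg hx := by
    ext1 u
    have h1 : D (g • Y) x u = g x • D Y x u + mvfderiv (𝓡 n) g x u • Y x := by
      rw [hD.leibniz hY hg hx]; rfl
    have h2 : (g • Y) x = g x • Y x := rfl
    have h3 : (g x • projChange D U Y x + (mvfderiv (𝓡 n) g x).smulRight (Y x)) u =
      g x • projChange D U Y x u + mvfderiv (𝓡 n) g x u • Y x := rfl
    rw [h3, projChange_apply, projChange_apply, h1, h2, map_smul, smul_eq_mul]
    module

/-- The added terms `Υ(X) Y + Υ(Y) X` are symmetric in `X` and `Y`, so the torsion stays zero. -/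
theorem isAffineConnectionOn_projChange [T2Space M] {D : ConnOp n M}
    (hD : IsAffineConnectionOn D univ) {U : (x : M) → TangentSpace (𝓡 n) x →L[ℝ] ℝ} {s : Set M}
    (hs : IsOpen s) (hU : SmoothOneFormOn U s) : IsAffineConnectionOn (projChange D U) s where
  isCovariantDerivativeOn :=
    (isCovariantDerivativeOn_projChange hD.isCovariantDerivativeOn U).mono (subset_univ s)
  smooth := ⟨fun {Y} hY y hy ↦ by
    have hY' : SmoothFieldOn Y s := hY
    have hYy := hY'.contMDiffAt (hs.mem_nhds hy)
    refine (contMDiffAt_hom_of_frame (F := Model n) (V := (TangentSpace (𝓡 n) : M → Type _))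
      fun k ↦ ?_).contMDiffWithinAt
    have he := (contMDiffOn_constField (n := n) y (EuclideanSpace.single k 1)).contMDiffAt
      (chart_source_mem_nhds (mem_chart_source _ y))
    have h1 := contMDiffAt_conn_apply hD hs hY' hy (he.contMDiffWithinAt (s := univ))
    have h2 := (hU.contMDiffAt_apply (hs.mem_nhds hy) he).smul_section hYy
    have h3 := (hU.contMDiffAt_apply (hs.mem_nhds hy) hYy).smul_section he
    refine (((contMDiffWithinAt_univ.1 h1).add_section h2).add_section h3).congr_of_eventuallyEq
      (Filter.Eventually.of_forall fun z ↦ ?_)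
    exact congrArg (TotalSpace.mk' (Model n) z) (projChange_apply D U Y z _)⟩
  torsionFree X Y x _ hX hY := by
    rw [← hD.torsionFree X Y x (mem_univ x) hX hY, projChange_apply, projChange_apply]
    module

lemma SmoothOneFormOn.add {U V : (x : M) → TangentSpace (𝓡 n) x →L[ℝ] ℝ} {s : Set M}
    (hU : SmoothOneFormOn U s) (hV : SmoothOneFormOn V s) :
    SmoothOneFormOn (fun x ↦ U x + V x) s :=
  ContMDiffOn.add_section hU hV

lemma ProjRelatedOn.projChange {D D' : ConnOp n M} {s : Set M} (h : ProjRelatedOn D D' univ)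
    {U : (x : M) → TangentSpace (𝓡 n) x →L[ℝ] ℝ} (hU : SmoothOneFormOn U s) :
    ProjRelatedOn D (projChange D' U) s := by
  obtain ⟨V, hV, h⟩ := h
  refine ⟨fun x ↦ V x + U x, SmoothOneFormOn.add (hV.mono (subset_univ s)) hU,
    fun Y x _ hY u ↦ ?_⟩
  rw [projChange_apply, h Y x (mem_univ x) hY, add_apply, add_apply]
  module

/-- The behaviour of the derivative of a density under projective changes. -/
lemma densityDeriv_of_projRelated {w : ℝ} {D D' : ConnOp n M} {s : Set M}
    (hD : IsCovariantDerivativeOn (Model n) D s) (hD' : IsCovariantDerivativeOn (Model n) D' s)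
    {x : M} (hs : s ∈ 𝓝 x) {U : TangentSpace (𝓡 n) x →L[ℝ] ℝ}
    (h : ∀ Y : VField n M, DiffFieldAt Y x → ∀ u : TangentSpace (𝓡 n) x,
      D' Y x u = D Y x u + U u • Y x + U (Y x) • u)
    (σ : (x : M) → DensityBundle n M w x) (u : TangentSpace (𝓡 n) x) :
    densityDeriv D' σ x u = densityDeriv D σ x u + w * dval σ x * U u := by
  have hx := mem_chart_source (Model n) x
  -- Tracing gives `n Υ(u)` from the first added term and `Υ(u)` from the second; the sum cancels
  -- the normalization `w/(n+1)`.
  have h1 : ctrace D' x x u = ctrace D x x u + ((n : ℝ) + 1) * U u := by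
    have hk (k : Fin n) : tcoord x x (D' (frame x k) x u) k =
        tcoord x x (D (frame x k) x u) k + U u + tcoord x x u k * U (frame x k x) := by
      rw [h _ (diffFieldAt_constField hx _), map_add, map_add, map_smul, map_smul,
        tcoord_constField hx]
      simp [mul_comm]
    rw [ctrace_apply, ctrace_apply]
    simp only [hk, Finset.sum_add_distrib]
    have h2 : ∑ k, tcoord x x u k * U (frame x k x) = U u := by
      conv_rhs => rw [eq_sum_frame hx u, map_sum]
      simp only [map_smul, smul_eq_mul]
    rw [h2]
    simp
    ring
  rw [densityDeriv_apply hD hs, densityDeriv_apply hD' hs, h1, dcoef_self]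
  have : (n : ℝ) + 1 ≠ 0 := by positivity
  field_simp
  ring

end ProjectiveChange

/-! ### The connection preserving `τ` -/

section ScaleConnection

variable {n : ℕ} {M : Type*} [TopologicalSpace M] [ChartedSpace (Model n) M]
  [IsManifold (𝓡 n) ∞ M]

/-- The one-form which relates a connection to the connection preserving `τ`. -/
def scaleForm (D : ConnOp n M) (τ : Density n M 2) (x : M) : TangentSpace (𝓡 n) x →L[ℝ] ℝ :=
  (-(2 * dval τ x)⁻¹) • densityDeriv D τ x

lemma scaleForm_apply (D : ConnOp n M) (τ : Density n M 2) (x : M) (u : TangentSpace (𝓡 n) x) :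
    scaleForm D τ x u = -(2 * dval τ x)⁻¹ * densityDeriv D τ x u := rfl

/-- This isolates the singular part `-df/(2f)` at the zero locus; the trace term is smooth across
it. -/
lemma scaleForm_chart {D : ConnOp n M} (hD : IsAffineConnectionOn D univ) {τ : Density n M 2}
    {x y : M} (hx : y ∈ (chartAt (Model n) x).source) (hy : dval τ y ≠ 0)
    (u : TangentSpace (𝓡 n) y) : scaleForm D τ y u =
      -(mvfderiv (𝓡 n) (dcoef x τ) y u / (2 * dcoef x τ y)) - ctrace D x y u / ((n : ℝ) + 1) := by
  have h := densityDeriv_chart hD.isCovariantDerivativeOn Filter.univ_mem hx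
    (mdifferentiableAt_dcoef τ hx) u
  have h1 : mvfderiv (𝓡 n) (dcoef x τ) y u = dfactor (n := n) 2 y x y * densityDeriv D τ y u -
    2 / ((n : ℝ) + 1) * dcoef x τ y * ctrace D x y u := by rw [h]; ring
  have h2 := (dfactor_pos (n := n) 2 (mem_chart_source _ y) hx).ne'
  have h3 : (n : ℝ) + 1 ≠ 0 := by positivity
  rw [scaleForm_apply, h1, dcoef_eq]
  field_simp
  ring

lemma smoothOneFormOn_scaleForm [T2Space M] {D : ConnOp n M} (hD : IsAffineConnectionOn D univ)
    (τ : Density n M 2) : SmoothOneFormOn (scaleForm D τ) (zeroLocus τ)ᶜ := by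
  refine smoothOneFormOn_of_frame fun x hx k ↦ ?_
  have hxs := mem_chart_source (Model n) x
  have ho := (chartAt (Model n) x).open_source
  have he := contMDiffOn_constField (n := n) x (EuclideanSpace.single k 1)
  have hf := contMDiffOn_dcoef τ x
  have h1 := (contMDiffOn_mvfderiv ho hf he).contMDiffAt (chart_source_mem_nhds hxs)
  have h2 := hf.contMDiffAt (chart_source_mem_nhds hxs)
  have h3 := contMDiffWithinAt_univ.1 (contMDiffWithinAt_ctrace hD hxs (t := univ)
    (he.contMDiffAt (chart_source_mem_nhds hxs)).contMDiffWithinAt)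
  have h4 : (2 : ℝ) * dcoef x τ x ≠ 0 := by
    rw [dcoef_self]
    exact mul_ne_zero two_ne_zero hx
  have h5 : ContMDiffAt (𝓡 n) 𝓘(ℝ, ℝ) ∞ (fun z ↦ -(mvfderiv (𝓡 n) (dcoef x τ) z (frame x k z) *
      (2 * dcoef x τ z)⁻¹) - ctrace D x z (frame x k z) * ((n : ℝ) + 1)⁻¹) x :=
    (h1.mul ((contMDiffAt_const.mul h2).inv₀ h4)).neg.sub (h3.mul contMDiffAt_const)
  refine h5.congr_of_eventuallyEq ?_
  filter_upwards [chart_source_mem_nhds hxs, (isClosed_zeroLocus τ).isOpen_compl.mem_nhds hx]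
    with z hz hz0
  rw [scaleForm_chart hD hz hz0, div_eq_mul_inv, div_eq_mul_inv]

/-- For weight 2, the change by `Υ` turns `∇τ` into `∇τ + 2τΥ`, which vanishes for `Υ = -∇τ/(2τ)`.
-/
theorem isScaleConnection_projChange [T2Space M] {P : ProjStructure n M} {D : ConnOp n M}
    (hD : D ∈ P.conns) (τ : Density n M 2) :
    IsScaleConnection P τ (projChange D (scaleForm D τ)) := by
  have hs := (isClosed_zeroLocus τ).isOpen_compl
  have hU := smoothOneFormOn_scaleForm (P.isAffine D hD) τ
  have hA := isAffineConnectionOn_projChange (P.isAffine D hD) hs hU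
  refine ⟨⟨hA, fun D₁ hD₁ ↦ ((P.mem_iff D₁ hD₁ D).1 hD).2.projChange hU⟩, fun x hx ↦ ?_⟩
  ext u
  have hx' : dval τ x ≠ 0 := hx
  rw [densityDeriv_of_projRelated
    ((P.isAffine D hD).isCovariantDerivativeOn.mono (subset_univ (zeroLocus τ)ᶜ))
    hA.isCovariantDerivativeOn (hs.mem_nhds hx) (U := scaleForm D τ x)
    (fun Y _ u ↦ projChange_apply D _ Y x u), scaleForm_apply]
  change _ = (0 : ℝ)
  field_simp
  ring

/-- The connection which preserves `τ` is unique. -/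
lemma IsScaleConnection.apply_eq {P : ProjStructure n M} {τ : Density n M 2} {D D₀ : ConnOp n M}
    (h : IsScaleConnection P τ D) (hD₀ : D₀ ∈ P.conns) {x : M} (hx : dval τ x ≠ 0)
    {Y : VField n M} (hY : DiffFieldAt Y x) (u : TangentSpace (𝓡 n) x) :
    D Y x u = D₀ Y x u + scaleForm D₀ τ x u • Y x + scaleForm D₀ τ x (Y x) • u := by
  have hs := (isClosed_zeroLocus τ).isOpen_compl
  obtain ⟨U, -, hU⟩ := h.1.2 D₀ hD₀
  -- The condition `∇τ + 2τΥ = 0` determines `Υ` wherever `τ ≠ 0`.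
  have h1 (u : TangentSpace (𝓡 n) x) : scaleForm D₀ τ x u = U x u := by
    have h2 := densityDeriv_of_projRelated (D' := D)
      ((P.isAffine D₀ hD₀).isCovariantDerivativeOn.mono (subset_univ (zeroLocus τ)ᶜ))
      h.1.1.isCovariantDerivativeOn (hs.mem_nhds hx) (U := U x) (fun Y hY u ↦ hU Y x hx hY u) τ u
    rw [h.2 x hx] at h2
    have h3 : densityDeriv D₀ τ x u = -(2 * dval τ x * U x u) := by
      have h4 : (0 : ℝ) = densityDeriv D₀ τ x u + 2 * dval τ x * U x u := h2
      linarith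
    rw [scaleForm_apply, h3]
    field_simp
  rw [h1, h1]
  exact hU Y x hx hY u

end ScaleConnection

/-! ### Projective compactness of order 2 -/

section Compactification

variable {n : ℕ} {M : Type*} [TopologicalSpace M] [ChartedSpace (Model n) M]
  [IsManifold (𝓡 n) ∞ M]

lemma contMDiffOn_const_mul_dcoef (ε : ℝ) (τ : Density n M 2) (x : M) :
    ContMDiffOn (𝓡 n) 𝓘(ℝ, ℝ) ∞ (fun y ↦ ε * dcoef x τ y) (chartAt (Model n) x).source :=
  contMDiffOn_const.mul (contMDiffOn_dcoef τ x)

lemma mvfderiv_const_mul_dcoef (ε : ℝ) (τ : Density n M 2) {x y : M}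
    (hy : y ∈ (chartAt (Model n) x).source) (u : TangentSpace (𝓡 n) y) :
    mvfderiv (𝓡 n) (fun y ↦ ε * dcoef x τ y) y u = ε * mvfderiv (𝓡 n) (dcoef x τ) y u :=
  mvfderiv_clm (mdifferentiableAt_dcoef τ hy) (ε • ContinuousLinearMap.id ℝ ℝ) u

/-- Near a zero, a multiple of the coefficient of `τ` is a coordinate function. -/
lemma exists_chart_const_mul_dcoef {P : ProjStructure n M} {τ : Density n M 2}
    (h : RankLTRank P τ) {ε : ℝ} (hε : ε ≠ 0) {x : M} (hx : x ∈ zeroLocus τ) :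
    ∃ φ ∈ IsManifold.maximalAtlas (𝓡 n) ∞ M, ∃ i : Fin n, x ∈ φ.source ∧
      φ.source ⊆ (chartAt (Model n) x).source ∧ ∀ y ∈ φ.source, φ y i = ε * dcoef x τ y := by
  refine exists_adapted_chart (contMDiffOn_const_mul_dcoef ε τ x) fun h0 ↦ ?_
  refine mvfderiv_dcoef_ne_zero h (mem_chart_source _ x) hx (ContinuousLinearMap.ext fun u ↦ ?_)
  have h1 := mvfderiv_const_mul_dcoef ε τ (mem_chart_source _ x) u
  rw [h0] at h1
  exact (mul_eq_zero.1 h1.symm).resolve_left hε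

/-- The half space is convex with nonempty interior. This is needed to differentiate up to the
boundary. -/
lemma uniqueDiffOn_halfSpace (i : Fin n) : UniqueDiffOn ℝ {z : Model n | 0 ≤ z i} := by
  have hc : Continuous fun z : Model n ↦ z i := (EuclideanSpace.proj i : Model n →L[ℝ] ℝ).continuous
  refine uniqueDiffOn_convex ?_ ⟨EuclideanSpace.single i 1, ?_⟩
  · exact convex_halfSpace_ge (EuclideanSpace.proj i : Model n →L[ℝ] ℝ).toLinearMap.isLinear 0
  · refine interior_mono (fun z hz ↦ le_of_lt (α := ℝ) hz)
      ((isOpen_lt continuous_const hc).interior_eq.symm ▸ ?_)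
    simp

/-- In a chart in which it is a half space, a subset has unique derivatives. -/
lemma uniqueMDiffOn_of_chart {φ : OpenPartialHomeomorph M (Model n)}
    (hφ : φ ∈ IsManifold.maximalAtlas (𝓡 n) ∞ M) {i : Fin n} {N : Set M}
    (hN : ∀ y ∈ φ.source, y ∈ N ↔ 0 ≤ φ y i) : UniqueMDiffOn (𝓡 n) (φ.source ∩ N) := by
  have h1 : UniqueMDiffOn (𝓡 n) {z : Model n | 0 ≤ z i} :=
    uniqueMDiffOn_iff_uniqueDiffOn.2 (uniqueDiffOn_halfSpace i)
  have h2 : φ.symm.MDifferentiable (𝓡 n) (𝓡 n) :=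
    ⟨(contMDiffOn_symm_of_mem_maximalAtlas hφ).mdifferentiableOn (by simp),
      (contMDiffOn_of_mem_maximalAtlas hφ).mdifferentiableOn (by simp)⟩
  have h3 := h1.uniqueMDiffOn_preimage h2
  have h4 : φ.source ∩ N = φ.symm.target ∩ φ.symm.symm ⁻¹' {z : Model n | 0 ≤ z i} := by
    ext y
    exact ⟨fun h ↦ ⟨h.1, (hN y h.1).1 h.2⟩, fun h ↦ ⟨h.1, (hN y h.1).2 h.2⟩⟩
  rw [h4]
  exact h3

/-- The connection part of a projectively compact connection extends to the boundary. -/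
lemma exists_smooth_extension [T2Space M] {P : ProjStructure n M} {D D₀ : ConnOp n M}
    {τ : Density n M 2} (hD : IsScaleConnection P τ D) (hD₀ : D₀ ∈ P.conns) {x : M} {t : Set M}
    (ht : t ⊆ (chartAt (Model n) x).source) (hut : UniqueMDiffOn (𝓡 n) t) {ε : ℝ} (hε : ε ≠ 0)
    {μ ξ : VField n M} (hμ : SmoothFieldOn μ t) (hξ : SmoothFieldOn ξ t) :
    ∃ η : VField n M, SmoothFieldOn η t ∧ ∀ y, t ∈ 𝓝 y → dval τ y ≠ 0 →
      η y = D ξ y (μ y) +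
        (mvfderiv (𝓡 n) (fun y ↦ ε * dcoef x τ y) y (μ y) / (2 * (ε * dcoef x τ y))) • ξ y +
        (mvfderiv (𝓡 n) (fun y ↦ ε * dcoef x τ y) y (ξ y) / (2 * (ε * dcoef x τ y))) • μ y := by
  have hA := P.isAffine D₀ hD₀
  have hξc : ContMDiffOn (𝓡 n) 𝓘(ℝ, Model n) ∞ (fun z ↦ tcoord x z (ξ z)) t := fun y hy ↦
    (contMDiffWithinAt_tcoord_iff (r := ⊤) (ht hy)).1 (hξ y hy)
  have hμc : ContMDiffOn (𝓡 n) 𝓘(ℝ, Model n) ∞ (fun z ↦ tcoord x z (μ z)) t := fun y hy ↦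
    (contMDiffWithinAt_tcoord_iff (r := ⊤) (ht hy)).1 (hμ y hy)
  -- This is the expected value after cancellation, in coordinates. The derivative is taken within
  -- `t` because `ξ` is smooth only up to the boundary and `D₀` cannot be applied to it there.
  let η : VField n M := fun y ↦
    constField x (mvfderivWithin (𝓡 n) (fun z ↦ tcoord x z (ξ z)) t y (μ y)) y +
      ∑ k, tcoord x y (ξ y) k • D₀ (frame x k) y (μ y) -
      (ctrace D₀ x y (μ y) * ((n : ℝ) + 1)⁻¹) • ξ y - (ctrace D₀ x y (ξ y) * ((n : ℝ) + 1)⁻¹) • μ y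
  refine ⟨η, fun y hy ↦ (contMDiffWithinAt_tcoord_iff (r := ⊤) (ht hy)).2 ?_, fun y hty hy0 ↦ ?_⟩
  · have h1 := contMDiffOn_mvfderivWithin hut hξc hμ y hy
    have h2 (k : Fin n) : ContMDiffWithinAt (𝓡 n) 𝓘(ℝ, Model n) ∞
        (fun z ↦ tcoord x z (D₀ (frame x k) z (μ z))) t y :=
      (contMDiffWithinAt_tcoord_iff (r := ⊤) (ht hy)).1
        (contMDiffAt_conn_apply hA (chartAt (Model n) x).open_source
          (contMDiffOn_constField x (EuclideanSpace.single k 1)) (ht hy) (hμ y hy))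
    have h3 (k : Fin n) : ContMDiffWithinAt (𝓡 n) 𝓘(ℝ, ℝ) ∞ (fun z ↦ tcoord x z (ξ z) k) t y :=
      ((EuclideanSpace.proj k : Model n →L[ℝ] ℝ).contMDiff.contMDiffAt).comp_contMDiffWithinAt y
        (hξc y hy)
    have h4 := contMDiffWithinAt_ctrace hA (ht hy) (hμ y hy)
    have h5 := contMDiffWithinAt_ctrace hA (ht hy) (hξ y hy)
    have h6 : ContMDiffWithinAt (𝓡 n) 𝓘(ℝ, Model n) ∞ (fun z ↦
        mvfderivWithin (𝓡 n) (fun z ↦ tcoord x z (ξ z)) t z (μ z) +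
        ∑ k, tcoord x z (ξ z) k • tcoord x z (D₀ (frame x k) z (μ z)) -
        (ctrace D₀ x z (μ z) * ((n : ℝ) + 1)⁻¹) • tcoord x z (ξ z) -
        (ctrace D₀ x z (ξ z) * ((n : ℝ) + 1)⁻¹) • tcoord x z (μ z)) t y :=
      ((h1.add (ContMDiffWithinAt.sum fun k _ ↦ (h3 k).smul (h2 k))).sub
        ((h4.mul contMDiffWithinAt_const).smul (hξc y hy))).sub
        ((h5.mul contMDiffWithinAt_const).smul (hμc y hy))
    have h7 (z : M) (hz : z ∈ t) : tcoord x z (η z) =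
        mvfderivWithin (𝓡 n) (fun z ↦ tcoord x z (ξ z)) t z (μ z) +
        ∑ k, tcoord x z (ξ z) k • tcoord x z (D₀ (frame x k) z (μ z)) -
        (ctrace D₀ x z (μ z) * ((n : ℝ) + 1)⁻¹) • tcoord x z (ξ z) -
        (ctrace D₀ x z (ξ z) * ((n : ℝ) + 1)⁻¹) • tcoord x z (μ z) := by
      change tcoord x z (_ + _ - _ - _) = _
      rw [map_sub, map_sub, map_add, map_smul, map_smul, map_sum, tcoord_constField (ht hz)]
      simp only [map_smul]
    exact h6.congr h7 (h7 y hy)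
  · have hyt : y ∈ (chartAt (Model n) x).source := ht (mem_of_mem_nhds hty)
    have hξd : DiffFieldAt ξ y := hξ.diffAt hty
    have h1 : mvfderivWithin (𝓡 n) (fun z ↦ tcoord x z (ξ z)) t y =
        mvfderiv (𝓡 n) (fun z ↦ tcoord x z (ξ z)) y := by
      have : mfderivWithin (𝓡 n) 𝓘(ℝ, Model n) (fun z ↦ tcoord x z (ξ z)) t y =
          mfderiv (𝓡 n) 𝓘(ℝ, Model n) (fun z ↦ tcoord x z (ξ z)) y := mfderivWithin_of_mem_nhds hty
      rw [mvfderivWithin, this]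
      rfl
    have h0 : dcoef x τ y ≠ 0 := fun h ↦ hy0 ((dcoef_eq_zero_iff _ hyt).1 h)
    -- The correction with `r = ε f` cancels `-df/(2f)`; the constant `ε` drops out of `dr/r`.
    have h2 (u : TangentSpace (𝓡 n) y) : scaleForm D₀ τ y u +
        mvfderiv (𝓡 n) (fun y ↦ ε * dcoef x τ y) y u / (2 * (ε * dcoef x τ y)) =
          -(ctrace D₀ x y u * ((n : ℝ) + 1)⁻¹) := by
      rw [scaleForm_chart hA hyt hy0, mvfderiv_const_mul_dcoef ε τ hyt]
      field_simp
      ring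
    rw [hD.apply_eq hD₀ hy0 hξd, conn_apply hA.isCovariantDerivativeOn Filter.univ_mem hyt hξd,
      ← h1]
    have h3 := h2 (μ y)
    have h4 := h2 (ξ y)
    rw [← eq_sub_iff_add_eq'] at h3 h4
    rw [h3, h4]
    change _ + _ - _ - _ = _
    module

/-- The sign `ε` treats both sides of the zero locus at once: `ε` times the coefficient of `τ` is a
coordinate that is nonnegative exactly on `N`. -/
lemma isSmoothDomain_sign {P : ProjStructure n M} {τ : Density n M 2}
    (h : RankLTRank P τ) {ε : ℝ} (hε : ε ≠ 0) {N Ω : Set M} (hΩ : IsOpen Ω)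
    (hN : ∀ y, y ∈ N ↔ 0 ≤ ε * dval τ y) (hΩε : ∀ y, y ∈ Ω ↔ 0 < ε * dval τ y) :
    IsSmoothDomain (n := n) N Ω (zeroLocus τ) where
  isOpen := hΩ
  union := by
    ext y
    have h0 : y ∈ zeroLocus τ ↔ ε * dval τ y = 0 := by
      rw [mul_eq_zero, or_iff_right hε]; rfl
    rw [mem_union, hN, hΩε, h0, le_iff_lt_or_eq, eq_comm (a := (0 : ℝ))]
  disjoint := disjoint_left.2 fun y hy hy' ↦ by
    have h1 := (hΩε y).1 hy
    have h2 : dval τ y = 0 := hy'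
    rw [h2, mul_zero] at h1
    exact lt_irrefl _ h1
  charts x hx := by
    obtain ⟨φ, hφ, i, hxs, hsub, hi⟩ := exists_chart_const_mul_dcoef h hε hx
    refine ⟨φ, hφ, i, hxs, fun y hy ↦ ?_⟩
    have h1 := dfactor_pos (n := n) 2 (mem_chart_source _ y) (hsub hy)
    rw [hi y hy, hN, dcoef_eq, mul_left_comm]
    refine ⟨(mul_nonneg_iff_of_pos_left h1).symm, ?_⟩
    rw [mul_eq_zero, mul_eq_zero, or_iff_right h1.ne', or_iff_right hε]
    rfl

theorem isProjCompactOfOrder_sign [T2Space M] {P : ProjStructure n M} {τ : Density n M 2}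
    (h : RankLTRank P τ) {D : ConnOp n M} (hD : IsScaleConnection P τ D)
    {ε : ℝ} (hε : ε ≠ 0) {N Ω : Set M} (hΩ : IsOpen Ω)
    (hN : ∀ y, y ∈ N ↔ 0 ≤ ε * dval τ y) (hΩε : ∀ y, y ∈ Ω ↔ 0 < ε * dval τ y) :
    IsProjCompactOfOrder 2 N Ω (zeroLocus τ) D := by
  obtain ⟨D₀, hD₀⟩ := P.nonempty
  intro x hx
  obtain ⟨φ, hφ, i, hxs, hsub, hi⟩ := exists_chart_const_mul_dcoef h hε hx
  have hpos {y : M} (hy : y ∈ φ.source) :=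
    dfactor_pos (n := n) 2 (mem_chart_source _ y) (hsub hy)
  refine ⟨φ.source, φ.open_source, hxs, fun y ↦ ε * dcoef x τ y, ⟨?_, ?_, ?_, ?_⟩, ?_⟩
  · exact (contMDiffOn_const_mul_dcoef ε τ x).mono hsub
  · rintro y ⟨hy, hyΩ⟩
    rw [dcoef_eq, mul_left_comm]
    exact mul_pos (hpos hy) ((hΩε y).1 hyΩ)
  · rintro y ⟨hy, hy0⟩
    rw [(dcoef_eq_zero_iff _ (hsub hy)).2 hy0, mul_zero]
  · rintro y ⟨hy, hy0⟩ h0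
    refine mvfderiv_dcoef_ne_zero h (hsub hy) hy0 (ContinuousLinearMap.ext fun u ↦ ?_)
    have h1 := mvfderiv_const_mul_dcoef ε τ (hsub hy) u
    rw [h0] at h1
    exact (mul_eq_zero.1 h1.symm).resolve_left hε
  · intro μ ξ hμ hξ
    have hut : UniqueMDiffOn (𝓡 n) (φ.source ∩ N) := by
      refine uniqueMDiffOn_of_chart hφ (i := i) fun y hy ↦ ?_
      rw [hi y hy, hN, dcoef_eq, mul_left_comm]
      exact (mul_nonneg_iff_of_pos_left (hpos hy)).symm
    obtain ⟨η, hη, hη'⟩ := exists_smooth_extension hD hD₀ (inter_subset_left.trans hsub) hut hε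
      hμ hξ
    refine ⟨η, hη, fun y hy ↦ hη' y ?_ ?_⟩
    · refine Filter.mem_of_superset ((φ.open_source.inter hΩ).mem_nhds hy) ?_
      exact inter_subset_inter_right _ fun z hz ↦ (hN z).2 ((hΩε z).1 hz).le
    · intro h0
      have h1 := (hΩε y).1 hy.2
      rw [h0, mul_zero] at h1
      exact lt_irrefl _ h1

theorem isProjCompactification_sign [T2Space M] [CompactSpace M] {P : ProjStructure n M}
    {τ : Density n M 2} (h : RankLTRank P τ) {D : ConnOp n M} (hD : IsScaleConnection P τ D)
    {ε : ℝ} (hε : ε ≠ 0) {N Ω : Set M} (hNc : IsClosed N) (hΩ : IsOpen Ω)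
    (hN : ∀ y, y ∈ N ↔ 0 ≤ ε * dval τ y) (hΩε : ∀ y, y ∈ Ω ↔ 0 < ε * dval τ y) :
    IsProjCompactification P 2 N Ω (zeroLocus τ) D where
  isCompact := hNc.isCompact
  isSmoothDomain := isSmoothDomain_sign h hε hΩ hN hΩε
  mem := by
    have hsub : Ω ⊆ (zeroLocus τ)ᶜ := fun y hy hy0 ↦ by
      have h1 := (hΩε y).1 hy
      have h2 : dval τ y = 0 := hy0
      rw [h2, mul_zero] at h1
      exact lt_irrefl _ h1
    obtain ⟨D₀, hD₀⟩ := P.nonempty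
    refine ⟨⟨hD.1.1.isCovariantDerivativeOn.mono hsub, ?_, fun X Y x hx ↦
      hD.1.1.torsionFree X Y x (hsub hx)⟩, fun D₁ hD₁ ↦ ?_⟩
    · have hA := isAffineConnectionOn_projChange (P.isAffine D₀ hD₀) hΩ
        ((smoothOneFormOn_scaleForm (P.isAffine D₀ hD₀) τ).mono hsub)
      refine ⟨fun {Y} hY ↦ (hA.smooth.contMDiff hY).congr fun y hy ↦ ?_⟩
      have hY' : SmoothFieldOn Y Ω := hY
      refine congrArg (TotalSpace.mk' (Model n →L[ℝ] Model n)
        (E := fun z : M ↦ TangentSpace (𝓡 n) z →L[ℝ] TangentSpace (𝓡 n) z) y) ?_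
      ext1 u
      rw [hD.apply_eq hD₀ (hsub hy) (hY'.diffAt (hΩ.mem_nhds hy)), projChange_apply]
    · obtain ⟨U, hU, hU'⟩ := hD.1.2 D₁ hD₁
      exact ⟨U, hU.mono hsub, fun Y x hx ↦ hU' Y x (hsub hx)⟩
  isProjCompact := isProjCompactOfOrder_sign h hD hε hΩ hN hΩε

end Compactification

end ProjDiff

end

theorem lemma4p1 {n : ℕ} (hn : 2 ≤ n) {M : Type*} [TopologicalSpace M] [T2Space M]
    [SigmaCompactSpace M] [ChartedSpace (Model n) M] [IsManifold (𝓡 n) ∞ M]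
    (P : ProjStructure n M) (τ : Density n M 2) :
    (NondegenerateL P τ → RankLTRank P τ) ∧
    (RankLTRank P τ →
      -- (i) and (ii)
      (Separates (zeroLocus τ) (posLocus τ) (negLocus τ) ∧
        (zeroLocus τ = ∅ ∨
          ((zeroLocus τ).Nonempty ∧
            (∀ x ∈ zeroLocus τ, ∀ D ∈ P.conns, ¬ IsDefiniteForm (tractorForm D τ x)) ∧
            ∃ (_ : ChartedSpace (Model (n - 1)) (zeroLocus τ))
              (_ : IsManifold (𝓡 (n - 1)) ∞ (zeroLocus τ)),
              Manifold.IsSmoothEmbedding (𝓡 (n - 1)) (𝓡 n) ∞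
                (Subtype.val : zeroLocus τ → M) ∧
              ∀ p q : ℕ,
                (∀ x ∈ zeroLocus τ, ∃ D ∈ P.conns, HasSignature (tractorForm D τ x) p q 0) →
                1 ≤ p ∧ 1 ≤ q ∧
                ∃ c : ConformalStructure (n - 1) (zeroLocus τ),
                  c.HasSig (p - 1) (q - 1) ∧ IsInducedConformal P τ (zeroLocus τ) c))) ∧
      -- (iii)
      (∃ D, IsScaleConnection P τ D) ∧
      ∀ D, IsScaleConnection P τ D → CompactSpace M →
        IsProjCompactification P 2 (negLocus τ)ᶜ (posLocus τ) (zeroLocus τ) D ∧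
        IsProjCompactification P 2 (posLocus τ)ᶜ (negLocus τ) (zeroLocus τ) D) := by
  refine ⟨rankLTRank_of_nondegenerateL, fun h ↦ ⟨⟨separates_zeroLocus h, ?_⟩, ?_, ?_⟩⟩
  · rcases (zeroLocus τ).eq_empty_or_nonempty with h0 | h0
    · exact Or.inl h0
    · refine Or.inr ⟨h0, fun x hx D _ ↦ not_isDefiniteForm_tractorForm D hx, ?_⟩
      -- The substitution makes `n - 1` reduce to `m`, so the slice charts have the required model
      -- space.
      obtain ⟨m, rfl⟩ : ∃ m, n = m + 1 := ⟨n - 1, by omega⟩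
      obtain ⟨C, hC, hι⟩ := exists_isSmoothEmbedding_of_charts (m := m) (S := zeroLocus τ)
        fun x ↦ by
          obtain ⟨φ, hφ, i, hx, hsub, hi⟩ := exists_chart_of_mem_zeroLocus h x.2
          refine ⟨φ, hφ, i, hx, fun y hy ↦ ?_⟩
          rw [hi y hy, dcoef_eq_zero_iff _ (hsub hy)]
          rfl
      exact ⟨C, hC, hι, fun p q hsig ↦ exists_induced_conformalStructure hι h0 hsig⟩
  · obtain ⟨D, hD⟩ := P.nonempty
    exact ⟨_, isScaleConnection_projChange hD τ⟩
  · intro D hD _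
    -- The two sides are the cases `ε = 1` and `ε = -1`.
    refine ⟨isProjCompactification_sign h hD one_ne_zero (isOpen_negLocus τ).isClosed_compl
      (isOpen_posLocus τ) (fun y ↦ ?_) fun y ↦ ?_,
      isProjCompactification_sign h hD (neg_ne_zero.2 one_ne_zero)
      (isOpen_posLocus τ).isClosed_compl (isOpen_negLocus τ) (fun y ↦ ?_) fun y ↦ ?_⟩
    · rw [one_mul]; exact not_lt (α := ℝ)
    · rw [one_mul]; rfl
    · rw [neg_one_mul, neg_nonneg]; exact not_lt (α := ℝ)
    · rw [neg_one_mul, neg_pos]; rfl
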